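/- Let $N\ge 2$, let $F,G\in\mathbb C^{N\times N}$ be fixed with $G$ invertible, and let $\sigma>0$. Consider the memoryless channel $$y=(F+sG)x+z,\qquad s\sim\mathcal{CN}(0,\sigma^2),\quad z\sim\mathcal{CN}(0,I_N),$$ with $x,s,z$ independent, $F,G,\sigma$ known and $s$ unknown to transmitter and receiver. Logarithms are natural. For $P>0$ let $C(P)=\sup I(x;y)$ over all laws of $x$ with $\mathbb E\|x\|^2\le P$, and let $C(P,r)$ be the same supremum over the laws that are moreover supported in $\{\|x\|\le r\}$. *Gaussian signaling.* For $Q\succeq0$ put $$R_G(Q)=\mathbb E_s\log\det\big(I+(F+sG)Q(F+sG)^H\big)-\log\big(1+\sigma^2\operatorname{tr}(GQG^H)\big).$$ *Pilot-based subspace alignment.* Choose $V\in\mathbb C^{N\times(N-1)}$ with $V^HV=I$ and $\operatorname{rank}[FV\ \ GV]\le N-1$; matrices $U$, $U_\perp$ whose columns are orthonormal bases of the column span $\mathcal S$ of $[FV\ \ GV]$ and of $\mathcal S^\perp$; a unit vector $v_p$; a deterministic $w_p\in\mathbb C$; and $Q_d\succeq0$ with $\operatorname{tr}Q_d+|w_p|^2\le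 P$. The input is $x=Vw_d+x_p$ with $w_d\sim\mathcal{CN}(0,Q_d)$ and pilot $x_p=w_pv_p$. With $\sigma_e^2=(\|U_\perp^HGx_p\|^2+\sigma^{-2})^{-1}$ and $R=I+\sigma_e^2\,U^HG(x_px_p^H+VQ_dV^H)G^HU$, the rate of the scheme is $$R_{\mathrm{SA}}=\mathbb E_{\hat s\sim\mathcal{CN}(0,\sigma^2-\sigma_e^2)}\log\det\big(I+Q_dV^H(F+\hat sG)^HUR^{-1}U^H(F+\hat sG)V\big).$$ *Duality bound.* For $r\ge0$, $\alpha\in(0,N]$, $S\succ0$, $Q\succeq 0$ put $\gamma(S,x)=\operatorname{tr}S+x^H(F^HSF+\sigma^2G^HSG)x$, $\bar\gamma(S,Q)=\operatorname{tr}\big(S(I+FQF^H+\sigma^2GQG^H)\big)$, $\beta=\bar\gamma(S,Q)/\alpha$ and $$R_{\mathrm{UB}}(\alpha,S,Q)=\alpha\log\beta+\log\tfrac{\Gamma(\alpha)}{\Gamma(N)}+\alpha-N-\log\det S+\sup_{\|x\|\le r}\log\frac{\gamma(S,x)^{N-\alpha}}{1+\sigma^2\|Gx\|^2}.$$ Then,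 where $O(1)$ denotes a quantity bounded as $P\to\infty$ by a constant depending only on $N,F,G,\sigma$: 1. For $Q\succeq0$ with $\operatorname{tr}Q\le P$, the input $x\sim\mathcal{CN}(0,Q)$ satisfies $R_G(Q)\le I(x;y)\le C(P)$, and $\sup_{Q\succeq0,\,\operatorname{tr}Q\le P}R_G(Q)=(N-1)\log P+O(1)$. 2. For every choice of the parameters of the pilot-based scheme, its input satisfies $R_{\mathrm{SA}}\le I(x;y)\le C(P)$, and the supremum of $R_{\mathrm{SA}}$ over all these choices is $(N-1)\log P+O(1)$. 3. For all $P>0$ and $r\ge0$, $C(P,r)\le\sup_{Q\succeq0,\,\operatorname{tr}Q\le P}R_{\mathrm{UB}}(N-1,I,Q)$, and this supremum is $(N-1)\log P+O(1)$, uniformly in $r$. Moreover, for every $r\ge 0$ and $Q\succeq0$, $R_{\mathrm{UB}}(N-1,I,Q)\le B(Q)$, where $$B(Q)=(N-1)\log\frac{\bar\gamma(I,Q)}{N-1}+\log\frac1{N-1}-1+\log\max\big\{N,\ \lambda_{\max}\big(I+\sigma^{-2}(G^HG)^{-1}F^HF\big)\big\},$$ and $C(P)\le\sup_{Q\succeq0,\,\operatorname{tr}Q\le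 P}B(Q)=(N-1)\log P+O(1)$. 4. Consequently $C(P)=(N-1)\log P+O(1)$, and the channel has exactly $N-1$ degrees of freedom: $C(P)<\infty$ for large $P$ and $\lim_{P\to\infty}C(P)/\log P=N-1$. -/

import Mathlib

open MeasureTheory ProbabilityTheory InformationTheory Filter Topology Matrix
open scoped ENNReal NNReal ComplexOrder MatrixOrder

namespace RankOneChannel

noncomputable section

/-- Squared Euclidean norm of a complex vector. -/
def sqNorm {ι : Type*} [Fintype ι] (x : ι → ℂ) : ℝ := ∑ i, ‖x i‖ ^ 2

/-- The circularly symmetric complex Gaussian law `CN(0, v)` on `ℂ`: independent real and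
imaginary parts, each of variance `v / 2`. -/
def cn (v : ℝ) : Measure ℂ :=
  ((gaussianReal 0 (v / 2).toNNReal).prod (gaussianReal 0 (v / 2).toNNReal)).map
    (fun p : ℝ × ℝ => (⟨p.1, p.2⟩ : ℂ))

/-- The law `CN(0, I)` on `ℂ^ι`. -/
def cnStd (ι : Type*) [Fintype ι] : Measure (ι → ℂ) := Measure.pi fun _ => cn 1

/-- The law `CN(0, Q)` on `ℂ^ι` for a positive semidefinite `Q`. -/
def cnVec {ι : Type*} [Fintype ι] [DecidableEq ι] (Q : Matrix ι ι ℂ) : Measure (ι → ℂ) :=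
  (cnStd ι).map fun w => CFC.sqrt Q *ᵥ w

/-- Joint law of `(x, y)`, where `y = (F + s G) x + z`, the input `x` has law `μ`,
`s ∼ CN(0, σ²)`, `z ∼ CN(0, I)`, and `x`, `s`, `z` are independent. -/
def jointLaw {N : ℕ} (F G : Matrix (Fin N) (Fin N) ℂ) (σ : ℝ) (μ : Measure (Fin N → ℂ)) :
    Measure ((Fin N → ℂ) × (Fin N → ℂ)) :=
  (μ.prod ((cn (σ ^ 2)).prod (cnStd (Fin N)))).map
    fun p => (p.1, (F + p.2.1 • G) *ᵥ p.1 + p.2.2)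

/-- Mutual information `I(x; y)` in nats for the input law `μ`. -/
def mutualInfo {N : ℕ} (F G : Matrix (Fin N) (Fin N) ℂ) (σ : ℝ) (μ : Measure (Fin N → ℂ)) :
    ℝ≥0∞ :=
  klDiv (jointLaw F G σ μ) ((jointLaw F G σ μ).fst.prod (jointLaw F G σ μ).snd)

/-- `μ` is an input law of average power at most `P`. -/
def IsInput {N : ℕ} (P : ℝ) (μ : Measure (Fin N → ℂ)) : Prop :=
  IsProbabilityMeasure μ ∧ ∫⁻ x, ENNReal.ofReal (sqNorm x) ∂μ ≤ ENNReal.ofReal P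

/-- The capacity `C(P)`. -/
def capacity {N : ℕ} (F G : Matrix (Fin N) (Fin N) ℂ) (σ P : ℝ) : ℝ≥0∞ :=
  ⨆ μ : {μ : Measure (Fin N → ℂ) // IsInput P μ}, mutualInfo F G σ μ.1

/-- The capacity `C(P, r)` with inputs moreover supported in the closed ball of radius `r`. -/
def peakCapacity {N : ℕ} (F G : Matrix (Fin N) (Fin N) ℂ) (σ P r : ℝ) : ℝ≥0∞ :=
  ⨆ μ : {μ : Measure (Fin N → ℂ) // IsInput P μ ∧ ∀ᵐ x ∂μ, sqNorm x ≤ r ^ 2},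
    mutualInfo F G σ μ.1

/-- Input covariance matrices of trace at most `P`. -/
def covSet (N : ℕ) (P : ℝ) : Set (Matrix (Fin N) (Fin N) ℂ) :=
  {Q | Q.PosSemidef ∧ Q.trace.re ≤ P}

/-! ### Gaussian signaling -/

/-- `R_G(Q) = E_s log det (I + (F + sG) Q (F + sG)ᴴ) - log (1 + σ² tr (G Q Gᴴ))`. -/
def gaussianRate {N : ℕ} (F G : Matrix (Fin N) (Fin N) ℂ) (σ : ℝ)
    (Q : Matrix (Fin N) (Fin N) ℂ) : ℝ :=
  (∫ s, Real.log (1 + (F + s • G) * Q * (F + s • G)ᴴ).det.re ∂(cn (σ ^ 2)))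
    - Real.log (1 + σ ^ 2 * (G * Q * Gᴴ).trace.re)

/-! ### Pilot-based subspace alignment -/

/-- A configuration of total power at most `P` of the pilot-based subspace-alignment scheme, with
input `x = V w_d + w_p v_p`, where `w_d ∼ CN(0, Q_d)` is the data and `w_p v_p` is a deterministic
pilot. -/
structure PilotScheme {N : ℕ} (F G : Matrix (Fin N) (Fin N) ℂ) (P : ℝ) where
  /-- semi-unitary precoder with `N - 1` columns -/
  V : Matrix (Fin N) (Fin (N - 1)) ℂ
  V_semiunitary : Vᴴ * V = 1
  /-- subspace alignment: `rank [F V, G V] ≤ N - 1` -/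
  aligned : (fromCols (F * V) (G * V)).rank ≤ N - 1
  /-- dimension of `𝒮 = span (F V, G V)` -/
  k : ℕ
  /-- the columns of `U` are an orthonormal basis of `𝒮` -/
  U : Matrix (Fin N) (Fin k) ℂ
  U_semiunitary : Uᴴ * U = 1
  U_range : LinearMap.range U.mulVecLin = LinearMap.range (fromCols (F * V) (G * V)).mulVecLin
  /-- dimension of the orthogonal complement of `𝒮` -/
  d : ℕ
  /-- the columns of `Uperp` are an orthonormal basis of the orthogonal complement of `𝒮` -/
  Uperp : Matrix (Fin N) (Fin d) ℂ
  Uperp_semiunitary : Uperpᴴ * Uperp = 1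
  Uperp_range : LinearMap.range Uperp.mulVecLin =
    LinearMap.ker ((fromCols (F * V) (G * V))ᴴ).mulVecLin
  /-- pilot direction -/
  vp : Fin N → ℂ
  vp_unit : sqNorm vp = 1
  /-- pilot symbol -/
  wp : ℂ
  /-- data covariance -/
  Qd : Matrix (Fin (N - 1)) (Fin (N - 1)) ℂ
  Qd_posSemidef : Qd.PosSemidef
  power : Qd.trace.re + ‖wp‖ ^ 2 ≤ P

namespace PilotScheme

variable {N : ℕ} {F G : Matrix (Fin N) (Fin N) ℂ} {P : ℝ}

/-- The pilot vector `x_p`. -/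
def xp (S : PilotScheme F G P) : Fin N → ℂ := S.wp • S.vp

/-- The law of the input `x = V w_d + x_p`. -/
def inputLaw (S : PilotScheme F G P) : Measure (Fin N → ℂ) :=
  (cnVec S.Qd).map fun w => S.V *ᵥ w + S.xp

/-- Error variance of the MMSE estimate `ŝ` of `s` from the projection of the output
onto the orthogonal complement of `𝒮`. -/
def errVar (S : PilotScheme F G P) (σ : ℝ) : ℝ :=
  (sqNorm (S.Uperpᴴ *ᵥ (G *ᵥ S.xp)) + (σ ^ 2)⁻¹)⁻¹

/-- The disturbance covariance
`R = I + Uᴴ σ_e² G (x_p x_pᴴ + V Q_d Vᴴ) Gᴴ U`. -/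
def distCov (S : PilotScheme F G P) (σ : ℝ) : Matrix (Fin S.k) (Fin S.k) ℂ :=
  1 + S.Uᴴ * (((S.errVar σ : ℝ) : ℂ) •
    (G * (vecMulVec S.xp (star S.xp) + S.V * S.Qd * S.Vᴴ) * Gᴴ)) * S.U

/-- The rate of the scheme,
`E log det (I + Q_d Vᴴ (F + ŝG)ᴴ U R⁻¹ Uᴴ (F + ŝG) V)` with `ŝ ∼ CN(0, σ² - σ_e²)`. -/
def rate (S : PilotScheme F G P) (σ : ℝ) : ℝ :=
  ∫ s, Real.log (1 + S.Qd * S.Vᴴ * (F + s • G)ᴴ * S.U * (S.distCov σ)⁻¹ * S.Uᴴ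
    * (F + s • G) * S.V).det.re ∂(cn (σ ^ 2 - S.errVar σ))

end PilotScheme

/-! ### Duality upper bound -/

/-- `γ(S, x) = tr S + xᴴ (Fᴴ S F + σ² Gᴴ S G) x`. -/
def gam {N : ℕ} (F G : Matrix (Fin N) (Fin N) ℂ) (σ : ℝ) (S : Matrix (Fin N) (Fin N) ℂ)
    (x : Fin N → ℂ) : ℝ :=
  (S.trace + star x ⬝ᵥ ((Fᴴ * S * F + ((σ ^ 2 : ℝ) : ℂ) • (Gᴴ * S * G)) *ᵥ x)).re

/-- The mean of `γ(S, x)` when `E[x xᴴ] = Q`: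
`tr (S (I + F Q Fᴴ + σ² G Q Gᴴ))`. -/
def meanGam {N : ℕ} (F G : Matrix (Fin N) (Fin N) ℂ) (σ : ℝ)
    (S Q : Matrix (Fin N) (Fin N) ℂ) : ℝ :=
  (S * (1 + F * Q * Fᴴ + ((σ ^ 2 : ℝ) : ℂ) • (G * Q * Gᴴ))).trace.re

/-- The duality bound `R_UB(α, S, Q)` for inputs in the closed ball of radius `r`, with
`β(Q, S) = meanGam S Q / α`. -/
def dualityBound {N : ℕ} (F G : Matrix (Fin N) (Fin N) ℂ) (σ r α : ℝ)
    (S Q : Matrix (Fin N) (Fin N) ℂ) : ℝ :=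
  α * Real.log (meanGam F G σ S Q / α) + Real.log (Real.Gamma α / Real.Gamma N) + α - N
    - Real.log S.det.re
    + sSup ((fun x => Real.log (gam F G σ S x ^ ((N : ℝ) - α) / (1 + σ ^ 2 * sqNorm (G *ᵥ x))))
        '' {x | sqNorm x ≤ r ^ 2})

/-- Largest real eigenvalue. -/
def lambdaMax {N : ℕ} (A : Matrix (Fin N) (Fin N) ℂ) : ℝ :=
  sSup {t : ℝ | (t : ℂ) ∈ spectrum ℂ A}

/-- The closed form of the duality bound for `α = N - 1`, `S = I`, valid for every radius. -/
def closedBound {N : ℕ} (F G : Matrix (Fin N) (Fin N) ℂ) (σ : ℝ)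
    (Q : Matrix (Fin N) (Fin N) ℂ) : ℝ :=
  ((N : ℝ) - 1) * Real.log (1 / ((N : ℝ) - 1) * meanGam F G σ 1 Q)
    + Real.log (1 / ((N : ℝ) - 1)) - 1
    + Real.log (max (N : ℝ) (lambdaMax (1 + (((σ ^ 2)⁻¹ : ℝ) : ℂ) • ((Gᴴ * G)⁻¹ * (Fᴴ * F)))))

/-! ### High-SNR behavior -/

/-- `R(P) = d log P + O(1)` as `P → ∞`. -/
def LogGrowth (R : ℝ → EReal) (d : ℝ) : Prop :=
  ∃ K : ℝ, ∀ᶠ P in atTop, ((d * Real.log P - K : ℝ) : EReal) ≤ R P ∧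
    R P ≤ ((d * Real.log P + K : ℝ) : EReal)

/-- A channel with capacity `C(P)` (finite for large `P`) has `d` degrees of freedom if
`C(P) / log P → d` as `P → ∞`. -/
def HasDegreesOfFreedom (C : ℝ → ℝ≥0∞) (d : ℝ) : Prop :=
  (∀ᶠ P in atTop, C P ≠ ⊤) ∧ Tendsto (fun P => (C P).toReal / Real.log P) atTop (𝓝 d)

end

end RankOneChannel

open RankOneChannel

namespace RankOneChannel
noncomputable section

/-! ### The scalar complex Gaussian law -/

/-! The number `N - 1` is a difference of logarithms. Given `x`, the output is Gaussian with mean `F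
x` and covariance `I + σ² (G x)(G x)ᴴ`, a rank-one perturbation of the identity. So the conditional
entropy of `y` is a constant plus `E log (1 + σ² ‖G x‖²)`: not knowing the scalar `s` costs one `log
P`, while the output has `N` complex dimensions.

For any input of finite power, `mutualInfo_coe_eq` writes `I(x; y)` as the mean of `log p(y|x) - log
p(y)`. Both terms are integrable because `p(y)` lies between `c exp (-2‖y‖²)` and `π^(-N)`. Every
comparison of log densities is then an instance of Gibbs' inequality,
`integral_nonpos_of_lintegral_exp_le_one`.

Upper bound (`mutualInfo_le_duality`): replace `p(y)` by the density proportional to `‖y‖⁻² exp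
(-‖y‖²/β)`. Its singular factor contributes `E log ‖y‖² ≤ E log γ(x)`, where `γ(x)` is the
conditional mean of `‖y‖²`. This is compensated by `-E log (1 + σ² ‖G x‖²)`, because `G` is
invertible and the ratio of the two arguments is bounded (`gam_div_le_ratioBound`). What is left is
`(N - 1) log β` with `β` of order `P`.

Gaussian inputs (`gaussianRate_le_mutualInfo`): conditioning on `s` reduces the output entropy, and
Jensen's inequality bounds the fading penalty. Pilot scheme (`rate_le_mutualInfo`): a decoding
metric `r` with `E_x r(x, y) ≤ 1` gives `E log r ≤ I(x; y)`. The metric used pretends that the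
whitened disturbance is standard Gaussian noise; `map_estimate` supplies the independence of
estimate, estimation error and in-space noise needed to evaluate its mean.

Growth of both rates rests on `exists_le_integral_logDet`: `det (A + s B)` is a polynomial in `s`
with leading coefficient `det B ≠ 0`, and `log |s - l| ≥ -1/|s - l|` has a mean bounded below
uniformly in the root `l`. For the scheme, an eigenvector of `(G⁻¹ F)ᴴ` provides the aligned
hyperplane (`exists_alignment`), and a pilot carrying half the power makes the estimation error
`O(1/P)`, so the disturbance covariance stays bounded. -/

lemma measurable_complex_mk : Measurable (fun p : ℝ × ℝ => (⟨p.1, p.2⟩ : ℂ)) :=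
  Complex.measurableEquivRealProd.symm.measurable

instance isProbabilityMeasure_cn (v : ℝ) : IsProbabilityMeasure (cn v) :=
  Measure.isProbabilityMeasure_map measurable_complex_mk.aemeasurable

instance isProbabilityMeasure_cnStd (ι : Type*) [Fintype ι] : IsProbabilityMeasure (cnStd ι) := by
  unfold cnStd; infer_instance

instance isProbabilityMeasure_cnVec {ι : Type*} [Fintype ι] [DecidableEq ι] (Q : Matrix ι ι ℂ) :
    IsProbabilityMeasure (cnVec Q) :=
  Measure.isProbabilityMeasure_map
    (Continuous.matrix_mulVec continuous_const continuous_id).measurable.aemeasurable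

lemma cn_one_eq : cn 1 =
    volume.withDensity (fun z : ℂ => ENNReal.ofReal (Real.pi⁻¹ * Real.exp (-‖z‖ ^ 2))) := by
  have hv : (1 / 2 : ℝ).toNNReal ≠ 0 := by simp
  unfold cn
  rw [gaussianReal_of_var_ne_zero _ hv,
    prod_withDensity (measurable_gaussianPDF _ _) (measurable_gaussianPDF _ _)]
  refine Measure.ext_of_lintegral _ fun f hf => ?_
  have hf' : Measurable fun p : ℝ × ℝ => f ⟨p.1, p.2⟩ := hf.comp measurable_complex_mk
  rw [lintegral_map hf measurable_complex_mk,
    lintegral_withDensity_eq_lintegral_mul _ (by fun_prop) hf',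
    lintegral_withDensity_eq_lintegral_mul _ (by fun_prop) hf]
  have := Complex.volume_preserving_equiv_real_prod.symm.lintegral_comp
    (f := fun z : ℂ => ENNReal.ofReal (Real.pi⁻¹ * Real.exp (-‖z‖ ^ 2)) * f z) (by fun_prop)
  simp only [Pi.mul_apply]
  rw [← this]
  refine lintegral_congr fun p => ?_
  simp only [Complex.measurableEquivRealProd_symm_apply]
  congr 1
  rw [gaussianPDF, gaussianPDF, ← ENNReal.ofReal_mul (gaussianPDFReal_nonneg _ _ _)]
  congr 1
  have h2 : (((1 / 2 : ℝ).toNNReal : ℝ≥0) : ℝ) = 1 / 2 := by simp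
  simp only [gaussianPDFReal, h2]
  have h3 : (2 * Real.pi * (1 / 2) : ℝ) = Real.pi := by ring
  rw [h3, mul_mul_mul_comm, ← mul_inv, Real.mul_self_sqrt Real.pi_pos.le, ← Real.exp_add,
    ← Complex.normSq_eq_norm_sq, Complex.normSq_mk]
  congr 2
  ring

/-- Gaussian computations are done at variance one and transported by scaling. The case `v = 0` is
included because `σ² - σ_e²` vanishes when the pilot is invisible outside `𝒮`. -/
lemma cn_eq_map {v : ℝ} (hv : 0 ≤ v) : cn v = (cn 1).map (fun z => (Real.sqrt v : ℂ) * z) := by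
  have h : gaussianReal 0 (v / 2).toNNReal =
      (gaussianReal 0 (1 / 2 : ℝ).toNNReal).map (fun x => Real.sqrt v * x) := by
    rw [gaussianReal_map_const_mul, mul_zero]
    congr 1
    ext
    simp [Real.sq_sqrt hv, hv, div_eq_mul_inv]
  unfold cn
  rw [h, Measure.map_prod_map _ _ (by fun_prop) (by fun_prop),
    Measure.map_map measurable_complex_mk (by fun_prop),
    Measure.map_map (by fun_prop) measurable_complex_mk]
  congr 1
  ext p
  simp [Complex.ext_iff]

/-- The quadratic term merges with the density into `exp (-(1 + d)|z|²)`. Real `a` gives the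
exponential moments behind the Gaussian mixtures, imaginary `a` the characteristic function. -/
lemma integral_cexp_cn_one {d : ℝ} (hd : 0 ≤ d) (a c : ℂ) :
    ∫ z : ℂ, Complex.exp (-d * ‖z‖ ^ 2 + a * (inner ℝ c z : ℝ)) ∂(cn 1) =
      (1 + d : ℂ)⁻¹ * Complex.exp (a ^ 2 * ‖c‖ ^ 2 / (4 * (1 + d))) := by
  have h1 := GaussianFourier.integral_cexp_neg_mul_sq_norm_add (V := ℂ) (b := 1 + d)
    (by simp; positivity) a c
  rw [cn_one_eq, integral_withDensity_eq_integral_toReal_smul (by fun_prop) (by simp)]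
  have h2 : ∀ z : ℂ, (ENNReal.ofReal (Real.pi⁻¹ * Real.exp (-‖z‖ ^ 2))).toReal •
      Complex.exp (-d * ‖z‖ ^ 2 + a * (inner ℝ c z : ℝ)) =
      (Real.pi : ℂ)⁻¹ * Complex.exp (-(1 + d) * ‖z‖ ^ 2 + a * (inner ℝ c z : ℝ)) := by
    intro z
    rw [ENNReal.toReal_ofReal (by positivity), Complex.real_smul]
    push_cast
    rw [mul_assoc, ← Complex.exp_add]
    congr 2; ring
  simp_rw [h2]
  rw [integral_const_mul, h1]
  simp only [Complex.finrank_real_complex]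
  have : ((2 : ℕ) : ℂ) / 2 = 1 := by norm_num
  rw [this, Complex.cpow_one]
  have hp : (Real.pi : ℂ) ≠ 0 := by exact_mod_cast Real.pi_ne_zero
  field_simp

lemma lintegral_exp_cn_one {d : ℝ} (hd : 0 ≤ d) (c : ℂ) :
    ∫⁻ z : ℂ, ENNReal.ofReal (Real.exp (-d * ‖z‖ ^ 2 + 2 * (inner ℝ c z : ℝ))) ∂(cn 1) =
      ENNReal.ofReal ((1 + d)⁻¹ * Real.exp (‖c‖ ^ 2 / (1 + d))) := by
  have h1 := integral_cexp_cn_one hd 2 c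
  have hd' : (0 : ℝ) < 1 + d := by positivity
  have h2 : ∀ z : ℂ, Complex.exp (-d * ‖z‖ ^ 2 + 2 * (inner ℝ c z : ℝ)) =
      ((Real.exp (-d * ‖z‖ ^ 2 + 2 * (inner ℝ c z : ℝ)) : ℝ) : ℂ) := by
    intro z; push_cast; rfl
  have h3 : (1 + d : ℂ)⁻¹ * Complex.exp (2 ^ 2 * ‖c‖ ^ 2 / (4 * (1 + d))) =
      (((1 + d)⁻¹ * Real.exp (‖c‖ ^ 2 / (1 + d)) : ℝ) : ℂ) := by
    push_cast
    congr 2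
    rw [show (2 ^ 2 : ℂ) = 4 by norm_num, mul_div_mul_left _ _ (by norm_num)]
  simp_rw [h2] at h1
  rw [h3, integral_complex_ofReal] at h1
  have h4 : ∫ z : ℂ, Real.exp (-d * ‖z‖ ^ 2 + 2 * (inner ℝ c z : ℝ)) ∂(cn 1) =
      (1 + d)⁻¹ * Real.exp (‖c‖ ^ 2 / (1 + d)) := by exact_mod_cast h1
  rw [← h4, ofReal_integral_eq_lintegral_ofReal]
  -- A non-integrable function has Bochner integral zero, whereas the value just computed is
  -- positive. The same device yields integrability in several later places.
  · by_contra h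
    rw [integral_undef h] at h4
    have : 0 < (1 + d)⁻¹ * Real.exp (‖c‖ ^ 2 / (1 + d)) := by positivity
    linarith
  · exact ae_of_all _ fun z => (Real.exp_pos _).le

lemma charFun_cn_one (c : ℂ) :
    ∫ z : ℂ, Complex.exp ((inner ℝ c z : ℝ) * Complex.I) ∂(cn 1) =
      Complex.exp (-(‖c‖ ^ 2 / 4 : ℝ)) := by
  have h1 := integral_cexp_cn_one le_rfl Complex.I c
  simp only [Complex.ofReal_zero, neg_zero, zero_mul, zero_add, add_zero, inv_one, one_mul,
    mul_one, Complex.I_sq] at h1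
  simp_rw [mul_comm _ Complex.I]
  rw [h1]
  push_cast
  congr 1; ring

lemma lintegral_norm_sq_cn_one : ∫⁻ z : ℂ, ENNReal.ofReal (‖z‖ ^ 2) ∂(cn 1) = 1 := by
  have h := Complex.integral_rpow_mul_exp_neg_rpow (p := 2) (q := 2) (by norm_num) (by norm_num)
  have h2 : Real.Gamma ((2 + 2) / 2) = 1 := by
    rw [show ((2 + 2) / 2 : ℝ) = 2 by norm_num, Real.Gamma_two]
  rw [h2] at h
  have h3 : ∫ z : ℂ, Real.pi⁻¹ * Real.exp (-‖z‖ ^ 2) * ‖z‖ ^ 2 = 1 := by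
    have : ∀ z : ℂ, Real.pi⁻¹ * Real.exp (-‖z‖ ^ 2) * ‖z‖ ^ 2 =
        Real.pi⁻¹ * (‖z‖ ^ (2 : ℝ) * Real.exp (-‖z‖ ^ (2 : ℝ))) := by
      intro z; simp only [Real.rpow_two]; ring
    simp_rw [this]
    rw [integral_const_mul, h]
    field_simp
  rw [cn_one_eq, lintegral_withDensity_eq_lintegral_mul _ (by fun_prop) (by fun_prop)]
  simp only [Pi.mul_apply]
  simp_rw [← ENNReal.ofReal_mul (show 0 ≤ Real.pi⁻¹ * Real.exp (-‖_‖ ^ 2) by positivity)]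
  rw [← ofReal_integral_eq_lintegral_ofReal, h3, ENNReal.ofReal_one]
  · by_contra h
    rw [integral_undef h] at h3
    norm_num at h3
  · exact ae_of_all _ fun z => by positivity

/-- The inverse distance to a point has a bounded mean. -/
lemma exists_lintegral_inv_norm_sub_le :
    ∃ K : ℝ≥0, ∀ l : ℂ, ∫⁻ s, ENNReal.ofReal ‖s - l‖⁻¹ ∂(cn 1) ≤ K := by
  have h := Complex.integral_rpow_mul_exp_neg_rpow (p := 1) (q := -1) (by norm_num) (by norm_num)
  simp only [Real.rpow_one] at h
  have hint : Integrable (fun z : ℂ => ‖z‖ ^ (-1 : ℝ) * Real.exp (-‖z‖)) := by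
    by_contra hc
    rw [integral_undef hc] at h
    have : 0 < 2 * Real.pi / 1 * Real.Gamma ((-1 + 2) / 1) := by
      have := Real.Gamma_pos_of_pos (show (0 : ℝ) < (-1 + 2) / 1 by norm_num)
      positivity
    linarith
  set I := ∫⁻ z : ℂ, ENNReal.ofReal (‖z‖ ^ (-1 : ℝ) * Real.exp (-‖z‖)) with hI
  have hIfin : I ≠ ⊤ := by
    have := hint.lintegral_lt_top
    exact this.ne
  -- Outside the unit disc around `l` the integrand is at most `1`. Inside, it is at most `e |s -
  -- l|⁻¹ exp (-|s - l|)`, whose Lebesgue integral in the plane is finite and translation invariant;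
  -- the Gaussian density is at most `1`. Hence the bound does not depend on `l`.
  refine ⟨(1 + ENNReal.ofReal (Real.exp 1) * I).toNNReal, fun l => ?_⟩
  rw [ENNReal.coe_toNNReal (by finiteness)]
  have hb : ∀ s : ℂ, ENNReal.ofReal ‖s - l‖⁻¹ ≤
      1 + ENNReal.ofReal (Real.exp 1) *
        ENNReal.ofReal (‖s - l‖ ^ (-1 : ℝ) * Real.exp (-‖s - l‖)) := by
    intro s
    rw [← ENNReal.ofReal_mul (by positivity), ← ENNReal.ofReal_one,
      ← ENNReal.ofReal_add (by norm_num) (by positivity)]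
    refine ENNReal.ofReal_le_ofReal ?_
    rw [Real.rpow_neg_one]
    rcases le_total ‖s - l‖ 1 with h1 | h1
    · have : 1 ≤ Real.exp 1 * Real.exp (-‖s - l‖) := by
        rw [← Real.exp_add]; exact Real.one_le_exp (by linarith)
      have h0 : 0 ≤ ‖s - l‖⁻¹ := by positivity
      nlinarith [mul_le_mul_of_nonneg_left this h0]
    · have : ‖s - l‖⁻¹ ≤ 1 := inv_le_one_of_one_le₀ h1
      have : 0 ≤ Real.exp 1 * (‖s - l‖⁻¹ * Real.exp (-‖s - l‖)) := by positivity
      linarith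
  refine (lintegral_mono hb).trans ?_
  rw [lintegral_add_left measurable_const, lintegral_const, measure_univ, one_mul]
  gcongr
  rw [lintegral_const_mul _ (by fun_prop)]
  gcongr
  rw [cn_one_eq, lintegral_withDensity_eq_lintegral_mul _ (by fun_prop) (by fun_prop)]
  calc _ ≤ ∫⁻ s : ℂ, ENNReal.ofReal (‖s - l‖ ^ (-1 : ℝ) * Real.exp (-‖s - l‖)) := by
        refine lintegral_mono fun s => ?_
        simp only [Pi.mul_apply]
        refine mul_le_of_le_one_left (by positivity) ?_
        rw [ENNReal.ofReal_le_one]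
        have h1 : Real.pi⁻¹ ≤ 1 := inv_le_one_of_one_le₀ (by linarith [Real.pi_gt_three])
        have h2 : Real.exp (-‖s‖ ^ 2) ≤ 1 := Real.exp_le_one_iff.2 (by simp)
        exact mul_le_one₀ h1 (Real.exp_pos _).le h2
    _ = I := lintegral_sub_right_eq_self
        (fun z : ℂ => ENNReal.ofReal (‖z‖ ^ (-1 : ℝ) * Real.exp (-‖z‖))) l

end
end RankOneChannel
namespace RankOneChannel
noncomputable section

/-! ### The standard complex Gaussian vector -/

variable {ι κ : Type*} [Fintype ι] [Fintype κ]

lemma sqNorm_nonneg (x : ι → ℂ) : 0 ≤ sqNorm x := Finset.sum_nonneg fun _ _ => by positivity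

@[simp] lemma sqNorm_zero : sqNorm (0 : ι → ℂ) = 0 := by simp [sqNorm]

lemma sqNorm_smul (c : ℂ) (x : ι → ℂ) : sqNorm (c • x) = ‖c‖ ^ 2 * sqNorm x := by
  simp [sqNorm, Finset.mul_sum, mul_pow]

lemma star_dotProduct_self (x : ι → ℂ) : star x ⬝ᵥ x = (sqNorm x : ℂ) := by
  simp only [dotProduct, sqNorm, Pi.star_apply, RCLike.star_def]
  push_cast
  exact Finset.sum_congr rfl fun i _ => Complex.conj_mul' _

lemma sqNorm_eq (x : ι → ℂ) : sqNorm x = (star x ⬝ᵥ x).re := by simp [star_dotProduct_self]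

@[fun_prop] lemma continuous_sqNorm : Continuous (sqNorm : (ι → ℂ) → ℝ) := by
  unfold sqNorm; fun_prop

@[fun_prop] lemma measurable_sqNorm : Measurable (sqNorm : (ι → ℂ) → ℝ) :=
  continuous_sqNorm.measurable

lemma sqNorm_add_le (x y : ι → ℂ) : sqNorm (x + y) ≤ 2 * sqNorm x + 2 * sqNorm y := by
  simp only [sqNorm, Finset.mul_sum, ← Finset.sum_add_distrib, Pi.add_apply]
  refine Finset.sum_le_sum fun i _ => ?_
  have := norm_add_le (x i) (y i)
  nlinarith [sq_nonneg (‖x i‖ - ‖y i‖), norm_nonneg (x i + y i), norm_nonneg (x i),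
    norm_nonneg (y i)]

lemma lintegral_ofReal_prod_pi {μ : ι → Measure ℂ} [∀ i, SigmaFinite (μ i)] {f : ι → ℂ → ℝ}
    (hf : ∀ i, Integrable (f i) (μ i)) (h0 : ∀ i z, 0 ≤ f i z) :
    ∫⁻ x : ι → ℂ, ENNReal.ofReal (∏ i, f i (x i)) ∂(Measure.pi μ) =
      ∏ i, ∫⁻ z, ENNReal.ofReal (f i z) ∂(μ i) := by
  rw [← ofReal_integral_eq_lintegral_ofReal (Integrable.fintype_prod hf)
    (ae_of_all _ fun x => Finset.prod_nonneg fun i _ => h0 i _), integral_fintype_prod_eq_prod,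
    ENNReal.ofReal_prod_of_nonneg fun i _ => integral_nonneg (h0 i)]
  exact Finset.prod_congr rfl fun i _ =>
    ofReal_integral_eq_lintegral_ofReal (hf i) (ae_of_all _ (h0 i))

lemma pi_withDensity_ofReal {μ : ι → Measure ℂ} [∀ i, SigmaFinite (μ i)] {f : ι → ℂ → ℝ}
    (hf : ∀ i, Integrable (f i) (μ i)) (h0 : ∀ i z, 0 ≤ f i z) :
    Measure.pi (fun i => (μ i).withDensity fun z => ENNReal.ofReal (f i z)) =
      (Measure.pi μ).withDensity fun x => ENNReal.ofReal (∏ i, f i (x i)) := by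
  refine Measure.pi_eq fun s hs => ?_
  rw [withDensity_apply _ (MeasurableSet.univ_pi hs), ← lintegral_indicator
    (MeasurableSet.univ_pi hs)]
  have h : ∀ x : ι → ℂ, (Set.univ.pi s).indicator (fun x => ENNReal.ofReal (∏ i, f i (x i))) x =
      ENNReal.ofReal (∏ i, (s i).indicator (f i) (x i)) := by
    intro x
    by_cases hx : x ∈ Set.univ.pi s
    · rw [Set.indicator_of_mem hx]
      congr 1
      exact Finset.prod_congr rfl fun i _ => (Set.indicator_of_mem (hx i trivial) _).symm
    · rw [Set.indicator_of_notMem hx]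
      simp only [Set.mem_pi, Set.mem_univ, true_implies, not_forall] at hx
      obtain ⟨i, hi⟩ := hx
      rw [Finset.prod_eq_zero (Finset.mem_univ i) (Set.indicator_of_notMem hi _),
        ENNReal.ofReal_zero]
  simp_rw [h]
  rw [lintegral_ofReal_prod_pi (fun i => (hf i).indicator (hs i))
    (fun i z => Set.indicator_nonneg (fun z _ => h0 i z) z)]
  refine Finset.prod_congr rfl fun i _ => ?_
  rw [withDensity_apply _ (hs i), ← lintegral_indicator (hs i)]
  refine lintegral_congr fun z => ?_
  by_cases hz : z ∈ s i <;> simp [hz]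

/-- Density of the standard complex Gaussian vector. -/
def stdDens (v : ι → ℂ) : ℝ := (Real.pi ^ Fintype.card ι)⁻¹ * Real.exp (-sqNorm v)

lemma stdDens_pos (v : ι → ℂ) : 0 < stdDens v := by
  have hpi := Real.pi_pos
  unfold stdDens; positivity

lemma continuous_stdDens : Continuous (stdDens : (ι → ℂ) → ℝ) := by unfold stdDens; fun_prop

lemma integrable_exp_neg_mul_norm_sq {t : ℝ} (ht : 0 < t) :
    Integrable (fun z : ℂ => Real.exp (-t * ‖z‖ ^ 2)) := by
  have h := GaussianFourier.integral_rexp_neg_mul_sq_norm (V := ℂ) ht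
  by_contra hc
  rw [integral_undef hc] at h
  have : 0 < (Real.pi / t) ^ ((Module.finrank ℝ ℂ : ℝ) / 2) := by positivity
  linarith

lemma integral_exp_neg_mul_norm_sq {t : ℝ} (ht : 0 < t) :
    ∫ z : ℂ, Real.exp (-t * ‖z‖ ^ 2) = Real.pi / t := by
  rw [GaussianFourier.integral_rexp_neg_mul_sq_norm (V := ℂ) ht, Complex.finrank_real_complex]
  norm_num

/-- The free parameter `t` matters: integrating over `t > a` later produces the normalizing constant
of the duality density. -/
lemma lintegral_exp_neg_mul_sqNorm {t : ℝ} (ht : 0 < t) :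
    ∫⁻ v : ι → ℂ, ENNReal.ofReal (Real.exp (-t * sqNorm v)) =
      ENNReal.ofReal ((Real.pi / t) ^ Fintype.card ι) := by
  have h : ∀ v : ι → ℂ, Real.exp (-t * sqNorm v) = ∏ i, Real.exp (-t * ‖v i‖ ^ 2) := by
    intro v; rw [← Real.exp_sum, sqNorm, Finset.mul_sum]
  simp_rw [h]
  rw [volume_pi, lintegral_ofReal_prod_pi (f := fun _ z => Real.exp (-t * ‖z‖ ^ 2))
    (fun _ => integrable_exp_neg_mul_norm_sq ht) (fun _ _ => (Real.exp_pos _).le)]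
  rw [← ofReal_integral_eq_lintegral_ofReal (integrable_exp_neg_mul_norm_sq ht)
    (ae_of_all _ fun _ => (Real.exp_pos _).le), integral_exp_neg_mul_norm_sq ht,
    Finset.prod_const, ENNReal.ofReal_pow (by positivity), Finset.card_univ]

lemma cnStd_eq : cnStd ι = volume.withDensity fun v => ENNReal.ofReal (stdDens v) := by
  have hint : Integrable fun z : ℂ => Real.pi⁻¹ * Real.exp (-‖z‖ ^ 2) := by
    simpa using (integrable_exp_neg_mul_norm_sq one_pos).const_mul Real.pi⁻¹
  unfold cnStd
  rw [cn_one_eq, pi_withDensity_ofReal (f := fun _ z => Real.pi⁻¹ * Real.exp (-‖z‖ ^ 2))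
    (fun _ => hint) (fun _ _ => by positivity), ← volume_pi]
  congr 1
  ext v
  rw [Finset.prod_mul_distrib, ← Real.exp_sum, stdDens, sqNorm]
  simp

lemma integrable_exp_cn_one {d : ℝ} (hd : 0 ≤ d) (c : ℂ) :
    Integrable (fun z : ℂ => Real.exp (-d * ‖z‖ ^ 2 + 2 * (inner ℝ c z : ℝ))) (cn 1) := by
  refine ⟨by fun_prop, ?_⟩
  rw [hasFiniteIntegral_iff_ofReal (ae_of_all _ fun _ => (Real.exp_pos _).le),
    lintegral_exp_cn_one hd]
  exact ENNReal.ofReal_lt_top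

/-- The coordinates factor, so the scalar formula applies to each. The `d i` will be the eigenvalues
of `Kᴴ K`. -/
lemma lintegral_exp_cnStd {d : ι → ℝ} (hd : ∀ i, 0 ≤ d i) (c : ι → ℂ) :
    ∫⁻ g, ENNReal.ofReal (Real.exp (∑ i, (-d i * ‖g i‖ ^ 2 + 2 * (inner ℝ (c i) (g i) : ℝ))))
      ∂(cnStd ι) =
      ENNReal.ofReal ((∏ i, (1 + d i))⁻¹ * Real.exp (∑ i, ‖c i‖ ^ 2 / (1 + d i))) := by
  simp_rw [Real.exp_sum]
  unfold cnStd
  rw [lintegral_ofReal_prod_pi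
    (f := fun i z => Real.exp (-d i * ‖z‖ ^ 2 + 2 * (inner ℝ (c i) z : ℝ)))
    (fun i => integrable_exp_cn_one (hd i) _) (fun _ _ => (Real.exp_pos _).le)]
  simp_rw [fun i => lintegral_exp_cn_one (hd i) (c i)]
  rw [← ENNReal.ofReal_prod_of_nonneg, Finset.prod_mul_distrib, Finset.prod_inv_distrib]
  intro i _
  have := hd i
  positivity

lemma inner_eq_re (c z : ℂ) : (inner ℝ c z : ℝ) = (star c * z).re := by
  rw [Complex.inner]; simp [mul_comm]

/-- The factor `1/4` is the usual `1/2` times the variance `1/2` of each real coordinate. -/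
lemma charFun_cnStd (t : ι → ℂ) :
    ∫ g, Complex.exp (((star t ⬝ᵥ g).re : ℝ) * Complex.I) ∂(cnStd ι) =
      Complex.exp (-(sqNorm t / 4 : ℝ)) := by
  have h : ∀ g : ι → ℂ, Complex.exp (((star t ⬝ᵥ g).re : ℝ) * Complex.I) =
      ∏ i, Complex.exp ((inner ℝ (t i) (g i) : ℝ) * Complex.I) := by
    intro g
    rw [← Complex.exp_sum, ← Finset.sum_mul, ← Complex.ofReal_sum]
    simp only [dotProduct, Complex.re_sum, inner_eq_re, Pi.star_apply]
  simp_rw [h]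
  unfold cnStd
  rw [integral_fintype_prod_eq_prod (f := fun i z => Complex.exp ((inner ℝ (t i) z : ℝ) * Complex.I))]
  simp_rw [charFun_cn_one]
  rw [← Complex.exp_sum]
  congr 1
  push_cast [sqNorm]
  rw [Finset.sum_div, Finset.sum_neg_distrib]

lemma charFun_cn {v : ℝ} (hv : 0 ≤ v) (c : ℂ) :
    ∫ z : ℂ, Complex.exp (((star c * z).re : ℝ) * Complex.I) ∂(cn v) =
      Complex.exp (-(v * ‖c‖ ^ 2 / 4 : ℝ)) := by
  rw [cn_eq_map hv, integral_map (by fun_prop) (by fun_prop)]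
  have h := charFun_cn_one (Real.sqrt v * c)
  rw [norm_mul, mul_pow, Complex.norm_real, Real.norm_eq_abs, sq_abs, Real.sq_sqrt hv] at h
  rw [← h]
  refine integral_congr_ae (ae_of_all _ fun z => ?_)
  simp only [inner_eq_re, star_mul', RCLike.star_def, Complex.conj_ofReal]
  congr 4
  ring

/-- Real functionals on `ℂ^ι` are real parts of Hermitian products. -/
lemma exists_eq_re_dotProduct (L : StrongDual ℝ (ι → ℂ)) :
    ∃ t : ι → ℂ, ∀ g, L g = (star t ⬝ᵥ g).re := by
  classical
  refine ⟨fun i => ⟨L (Pi.single i 1), L (Pi.single i Complex.I)⟩, fun g => ?_⟩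
  have h : g = ∑ i, ((g i).re • (Pi.single i 1 : ι → ℂ) +
      (g i).im • (Pi.single i Complex.I : ι → ℂ)) := by
    ext j
    simp [Finset.sum_apply, Pi.single_apply, Finset.sum_add_distrib, Complex.re_add_im]
  conv_lhs => rw [h]
  simp only [map_sum, map_add, map_smul, dotProduct, Complex.re_sum, smul_eq_mul]
  refine Finset.sum_congr rfl fun i _ => ?_
  simp; ring

lemma exists_eq_re_mul (L : StrongDual ℝ ℂ) : ∃ t : ℂ, ∀ g, L g = (star t * g).re := by
  refine ⟨⟨L 1, L Complex.I⟩, fun g => ?_⟩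
  have h : g = g.re • (1 : ℂ) + g.im • Complex.I := by simp [Complex.re_add_im]
  conv_lhs => rw [h]
  simp only [map_add, map_smul, smul_eq_mul]
  simp; ring

lemma sqNorm_conjTranspose_mulVec (A : Matrix ι κ ℂ) (t : ι → ℂ) :
    (sqNorm (Aᴴ *ᵥ t) : ℂ) = star t ⬝ᵥ (A * Aᴴ) *ᵥ t := by
  rw [← star_dotProduct_self, star_mulVec, conjTranspose_conjTranspose, ← dotProduct_mulVec,
    mulVec_mulVec]

@[fun_prop] lemma measurable_mulVec (A : Matrix ι κ ℂ) : Measurable fun v => A *ᵥ v :=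
  (Continuous.matrix_mulVec continuous_const continuous_id).measurable

/-- The law of `A g` depends on `A Aᴴ` only. -/
lemma cnStd_map_mulVec [DecidableEq ι] {A : Matrix ι κ ℂ} (hA : A * Aᴴ = 1) :
    (cnStd κ).map (fun g => A *ᵥ g) = cnStd ι := by
  have : IsProbabilityMeasure ((cnStd κ).map fun g => A *ᵥ g) :=
    Measure.isProbabilityMeasure_map (measurable_mulVec A).aemeasurable
  refine Measure.ext_of_charFunDual (funext fun L => ?_)
  obtain ⟨t, ht⟩ := exists_eq_re_dotProduct L
  simp only [charFunDual_apply, ht]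
  rw [integral_map (measurable_mulVec A).aemeasurable (by
    refine Continuous.aestronglyMeasurable ?_; unfold dotProduct; fun_prop), charFun_cnStd]
  have h : ∀ g, star t ⬝ᵥ (A *ᵥ g) = star (Aᴴ *ᵥ t) ⬝ᵥ g := fun g => by
    rw [star_mulVec, conjTranspose_conjTranspose, dotProduct_mulVec]
  simp_rw [h]
  rw [charFun_cnStd]
  have h2 : sqNorm (Aᴴ *ᵥ t) = sqNorm t := by
    have := sqNorm_conjTranspose_mulVec A t
    rw [hA, one_mulVec, star_dotProduct_self] at this
    exact_mod_cast this
  rw [h2]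

end
end RankOneChannel
namespace RankOneChannel
noncomputable section

/-! ### Second moments of Gaussian vectors -/

variable {ι κ : Type*} [Fintype ι] [Fintype κ]

lemma measurePreserving_eval_cnStd (i : ι) :
    MeasurePreserving (fun g : ι → ℂ => g i) (cnStd ι) (cn 1) :=
  measurePreserving_eval (fun _ : ι => cn 1) i

lemma lintegral_norm_sq_cnStd (i : ι) :
    ∫⁻ g, ENNReal.ofReal (‖g i‖ ^ 2) ∂(cnStd ι) = 1 := by
  rw [← lintegral_norm_sq_cn_one]
  exact (measurePreserving_eval_cnStd i).lintegral_comp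
    (f := fun z : ℂ => ENNReal.ofReal (‖z‖ ^ 2)) (by fun_prop)

lemma integrable_norm_sq_cnStd (i : ι) : Integrable (fun g => ‖g i‖ ^ 2) (cnStd ι) := by
  refine ⟨Measurable.aestronglyMeasurable (by fun_prop), ?_⟩
  rw [hasFiniteIntegral_iff_ofReal (ae_of_all _ fun _ => by positivity), lintegral_norm_sq_cnStd]
  exact ENNReal.one_lt_top

lemma integral_norm_sq_cnStd (i : ι) : ∫ g, ‖g i‖ ^ 2 ∂(cnStd ι) = 1 := by
  rw [integral_eq_lintegral_of_nonneg_ae (ae_of_all _ fun _ => by positivity)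
    (Measurable.aestronglyMeasurable (by fun_prop)), lintegral_norm_sq_cnStd, ENNReal.toReal_one]

lemma integrable_coord_cnStd (i : ι) : Integrable (fun g => g i) (cnStd ι) := by
  refine ((integrable_norm_sq_cnStd i).add (integrable_const 1)).mono'
    (Measurable.aestronglyMeasurable (by fun_prop))
    (ae_of_all _ fun g => ?_)
  simp only [Pi.add_apply]
  nlinarith [sq_nonneg (‖g i‖ - 1), sq_nonneg (‖g i‖)]

lemma integrable_star_mul_cnStd (i j : ι) :
    Integrable (fun g => star (g i) * g j) (cnStd ι) := by
  refine ((integrable_norm_sq_cnStd i).add (integrable_norm_sq_cnStd j)).mono'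
    (Measurable.aestronglyMeasurable (by fun_prop))
    (ae_of_all _ fun g => ?_)
  simp only [Pi.add_apply, norm_mul, norm_star]
  nlinarith [sq_nonneg (‖g i‖ - ‖g j‖), sq_nonneg (‖g i‖), sq_nonneg (‖g j‖)]

/-- Changing the sign of one coordinate is unitary and preserves the law. This kills first moments
and off-diagonal second moments without computing an integral. -/
lemma integral_flip_cnStd [DecidableEq ι] (i : ι) (f : (ι → ℂ) → ℂ) (hf : Measurable f) :
    ∫ g, f (fun k => (if k = i then -1 else 1) * g k) ∂(cnStd ι) = ∫ g, f g ∂(cnStd ι) := by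
  set W : Matrix ι ι ℂ := diagonal fun k => if k = i then -1 else 1
  have hW : W * Wᴴ = 1 := by
    rw [diagonal_conjTranspose, diagonal_mul_diagonal, ← diagonal_one]
    congr 1; ext k
    by_cases h : k = i <;> simp [h]
  conv_rhs => rw [← cnStd_map_mulVec hW, integral_map (by fun_prop) hf.aestronglyMeasurable]
  refine integral_congr_ae (ae_of_all _ fun g => ?_)
  simp only
  congr 1
  ext k
  rw [mulVec_diagonal]

lemma integral_coord_cnStd (i : ι) : ∫ g, g i ∂(cnStd ι) = 0 := by
  classical
  have h := integral_flip_cnStd i (fun g => g i) (by fun_prop)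
  simp only [if_true, neg_mul, one_mul, integral_neg] at h
  exact self_eq_neg.1 h.symm

lemma integral_star_mul_cnStd [DecidableEq ι] (i j : ι) :
    ∫ g, star (g i) * g j ∂(cnStd ι) = if i = j then 1 else 0 := by
  split_ifs with hij
  · subst hij
    have h : ∀ g : ι → ℂ, star (g i) * g i = ((‖g i‖ ^ 2 : ℝ) : ℂ) := fun g => by
      push_cast; exact Complex.conj_mul' _
    simp_rw [h]
    rw [integral_complex_ofReal, integral_norm_sq_cnStd, Complex.ofReal_one]
  · have h := integral_flip_cnStd i (fun g => star (g i) * g j) (by fun_prop)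
    simp only [if_true, neg_mul, one_mul, Ne.symm hij, if_false, star_neg, integral_neg] at h
    exact self_eq_neg.1 h.symm

/-- Real part of the Hermitian form of `M`. -/
def qf (M : Matrix ι ι ℂ) (v : ι → ℂ) : ℝ := (star v ⬝ᵥ M *ᵥ v).re

lemma qf_nonneg {M : Matrix ι ι ℂ} (hM : M.PosSemidef) (v : ι → ℂ) : 0 ≤ qf M v :=
  hM.re_dotProduct_nonneg v

lemma qf_one [DecidableEq ι] (v : ι → ℂ) : qf (1 : Matrix ι ι ℂ) v = sqNorm v := by
  rw [qf, one_mulVec, sqNorm_eq]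

lemma continuous_dotProduct_mulVec {X : Type*} [TopologicalSpace X] {M : X → Matrix ι κ ℂ}
    {u : X → ι → ℂ} {v : X → κ → ℂ} (hM : Continuous M) (hu : Continuous u) (hv : Continuous v) :
    Continuous fun x => u x ⬝ᵥ M x *ᵥ v x :=
  Continuous.dotProduct hu (hM.matrix_mulVec hv)

@[fun_prop] lemma continuous_qf (M : Matrix ι ι ℂ) : Continuous (qf M) :=
  Complex.continuous_re.comp (continuous_dotProduct_mulVec continuous_const continuous_star
    continuous_id)

lemma qf_conjTranspose_mul_mul (M : Matrix ι ι ℂ) (A : Matrix ι κ ℂ) (v : κ → ℂ) :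
    qf (Aᴴ * M * A) v = qf M (A *ᵥ v) := by
  rw [qf, qf, star_mulVec, ← mulVec_mulVec, ← mulVec_mulVec, dotProduct_mulVec (star v)]

lemma hasIntegral_form_cnStd (B : Matrix κ κ ℂ) :
    Integrable (fun g => star g ⬝ᵥ B *ᵥ g) (cnStd κ) ∧
      ∫ g, star g ⬝ᵥ B *ᵥ g ∂(cnStd κ) = B.trace := by
  classical
  have h : ∀ g : κ → ℂ, star g ⬝ᵥ B *ᵥ g = ∑ i, ∑ j, B i j * (star (g i) * g j) := by
    intro g
    simp only [dotProduct, mulVec, Finset.mul_sum, Pi.star_apply]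
    exact Finset.sum_congr rfl fun i _ => Finset.sum_congr rfl fun j _ => by ring
  simp_rw [h]
  constructor
  · exact integrable_finsetSum _ fun i _ => integrable_finsetSum _ fun j _ =>
      (integrable_star_mul_cnStd i j).const_mul _
  · have e : ∀ i, ∫ g, ∑ j, B i j * (star (g i) * g j) ∂(cnStd κ) = B i i := by
      intro i
      rw [integral_finsetSum _ fun j _ => (integrable_star_mul_cnStd i j).const_mul (B i j)]
      simp_rw [integral_const_mul, integral_star_mul_cnStd]
      simp
    rw [integral_finsetSum _ fun i _ => integrable_finsetSum _ fun j _ =>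
      (integrable_star_mul_cnStd i j).const_mul (B i j)]
    simp_rw [e]
    rfl

lemma hasIntegral_dotProduct_cnStd (d : κ → ℂ) :
    Integrable (fun g => d ⬝ᵥ g) (cnStd κ) ∧ ∫ g, d ⬝ᵥ g ∂(cnStd κ) = 0 := by
  simp only [dotProduct]
  constructor
  · exact integrable_finsetSum _ fun i _ => (integrable_coord_cnStd i).const_mul _
  · rw [integral_finsetSum _ fun i _ => (integrable_coord_cnStd i).const_mul _]
    simp [integral_const_mul, integral_coord_cnStd]

/-- After expansion the cross terms are linear in `g` and have mean zero; the quadratic term has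
mean `tr (Aᴴ M A)`. -/
lemma hasIntegral_qf_affine (M : Matrix ι ι ℂ) (A : Matrix ι κ ℂ) (c : ι → ℂ) :
    Integrable (fun g => qf M (A *ᵥ g + c)) (cnStd κ) ∧
      ∫ g, qf M (A *ᵥ g + c) ∂(cnStd κ) = (M * (A * Aᴴ)).trace.re + qf M c := by
  obtain ⟨i1, e1⟩ := hasIntegral_form_cnStd (Aᴴ * M * A)
  obtain ⟨i2, e2⟩ := hasIntegral_dotProduct_cnStd (star c ᵥ* M ᵥ* A)
  obtain ⟨i3, e3⟩ := hasIntegral_dotProduct_cnStd (star (Aᴴ *ᵥ M *ᵥ c))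
  have h : ∀ g, qf M (A *ᵥ g + c) = (star g ⬝ᵥ (Aᴴ * M * A) *ᵥ g).re +
      ((star c ᵥ* M ᵥ* A) ⬝ᵥ g).re + (star (Aᴴ *ᵥ M *ᵥ c) ⬝ᵥ g).re + qf M c := by
    intro g
    have e : (star (Aᴴ *ᵥ M *ᵥ c) ⬝ᵥ g).re = (star g ⬝ᵥ (Aᴴ *ᵥ M *ᵥ c)).re := by
      rw [star_dotProduct, ← Complex.conj_re]; rfl
    rw [e]
    simp only [qf, mulVec_add, star_add, dotProduct_add, add_dotProduct, Complex.add_re,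
      star_mulVec, ← mulVec_mulVec, dotProduct_mulVec, add_vecMul, vecMul_vecMul]
    ring
  simp_rw [h]
  refine ⟨(((i1.re).add i2.re).add i3.re).add (integrable_const _), ?_⟩
  have e1' : ∫ g, (star g ⬝ᵥ (Aᴴ * M * A) *ᵥ g).re ∂(cnStd κ) = (Aᴴ * M * A).trace.re := by
    rw [← e1]; exact integral_re i1
  have e2' : ∫ g, ((star c ᵥ* M ᵥ* A) ⬝ᵥ g).re ∂(cnStd κ) = 0 := by
    rw [← Complex.zero_re, ← e2]; exact integral_re i2
  have e3' : ∫ g, (star (Aᴴ *ᵥ M *ᵥ c) ⬝ᵥ g).re ∂(cnStd κ) = 0 := by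
    rw [← Complex.zero_re, ← e3]; exact integral_re i3
  have j1 := i1.re
  have j2 := i2.re
  have j3 := i3.re
  simp only [RCLike.re_to_complex] at j1 j2 j3
  have j12 := j1.add j2
  have j123 := j12.add j3
  simp only [Pi.add_def] at j12 j123
  rw [integral_add j123 (integrable_const _), integral_add j12 j3, integral_add j1 j2, e1', e2', e3', Matrix.mul_assoc, trace_mul_comm, Matrix.mul_assoc]
  simp

/-- In this `ℝ≥0∞` form, second moments can be averaged successively over noise, fading and data
without integrability side conditions. -/
lemma lintegral_qf_affine {M : Matrix ι ι ℂ} (hM : M.PosSemidef) (A : Matrix ι κ ℂ) (c : ι → ℂ) :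
    ∫⁻ g, ENNReal.ofReal (qf M (A *ᵥ g + c)) ∂(cnStd κ) =
      ENNReal.ofReal ((M * (A * Aᴴ)).trace.re + qf M c) := by
  obtain ⟨h1, h2⟩ := hasIntegral_qf_affine M A c
  rw [← h2, ofReal_integral_eq_lintegral_ofReal h1 (ae_of_all _ fun _ => qf_nonneg hM _)]

/-- Treats the scalar fading as a vector with one coordinate, so that the vector formulas cover it.
-/
lemma cn_eq_map_cnStd {v : ℝ} (hv : 0 ≤ v) :
    cn v = (cnStd Unit).map fun g => (Real.sqrt v : ℂ) * g () := by
  rw [cn_eq_map hv, ← (measurePreserving_eval_cnStd ()).map_eq,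
    Measure.map_map (by fun_prop) (by fun_prop)]
  rfl

lemma trace_mul_vecMulVec_star (M : Matrix ι ι ℂ) (d : ι → ℂ) :
    (M * vecMulVec d (star d)).trace = star d ⬝ᵥ M *ᵥ d := by
  rw [mul_vecMulVec, trace_vecMulVec, dotProduct_comm]

lemma lintegral_qf_cn {M : Matrix ι ι ℂ} (hM : M.PosSemidef) {v : ℝ} (hv : 0 ≤ v) (d c : ι → ℂ) :
    ∫⁻ s, ENNReal.ofReal (qf M (s • d + c)) ∂(cn v) = ENNReal.ofReal (v * qf M d + qf M c) := by
  rw [cn_eq_map_cnStd hv, lintegral_map (by fun_prop) (by fun_prop)]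
  have h := lintegral_qf_affine hM (Matrix.of fun i (_ : Unit) => (Real.sqrt v : ℂ) * d i) c
  have e1 : ∀ g : Unit → ℂ, (Matrix.of fun i (_ : Unit) => (Real.sqrt v : ℂ) * d i) *ᵥ g =
      ((Real.sqrt v : ℂ) * g ()) • d := by
    intro g; ext i; simp [mulVec, dotProduct]; ring
  have e2 : (Matrix.of fun i (_ : Unit) => (Real.sqrt v : ℂ) * d i) *
      (Matrix.of fun i (_ : Unit) => (Real.sqrt v : ℂ) * d i)ᴴ = (v : ℂ) • vecMulVec d (star d) := by
    ext i j
    have : (Real.sqrt v : ℂ) * Real.sqrt v = v := by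
      rw [← Complex.ofReal_mul, Real.mul_self_sqrt hv]
    simp [mul_apply, vecMulVec, ← this]
    ring
  simp_rw [e1] at h
  rw [h, e2, Matrix.mul_smul, trace_smul, trace_mul_vecMulVec_star, smul_eq_mul, Complex.re_ofReal_mul]
  rfl

end
end RankOneChannel
namespace RankOneChannel
noncomputable section
set_option linter.unusedSectionVars false

/-! ### Gaussian densities with covariance `1 + K Kᴴ` -/

variable {ι κ : Type*} [Fintype ι] [Fintype κ] [DecidableEq ι] [DecidableEq κ]

/-- The covariance `1 + K Kᴴ` of `K g + z` for independent standard Gaussian `g`, `z`. -/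
def cov (K : Matrix ι κ ℂ) : Matrix ι ι ℂ := 1 + K * Kᴴ

/-- `log det (1 + K Kᴴ)`. -/
def logDet (K : Matrix ι κ ℂ) : ℝ := Real.log (cov K).det.re

/-- The density of `CN(0, 1 + K Kᴴ)`. -/
def gdens (K : Matrix ι κ ℂ) (v : ι → ℂ) : ℝ :=
  (Real.pi ^ Fintype.card ι)⁻¹ * ((cov K).det.re)⁻¹ * Real.exp (-qf (cov K)⁻¹ v)

lemma cov_posDef (K : Matrix ι κ ℂ) : (cov K).PosDef :=
  PosDef.one.add_posSemidef (posSemidef_self_mul_conjTranspose K)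

lemma cov_inv_posSemidef (K : Matrix ι κ ℂ) : (cov K)⁻¹.PosSemidef := (cov_posDef K).inv.posSemidef

/-- Replacing `K` by `K W` with `W` unitary changes neither `K Kᴴ` nor the law of `K g`. Statements
about `cov K` therefore reduce to the case where `Kᴴ K` is diagonal, also for rectangular `K`. -/
lemma exists_diagonalization (K : Matrix ι κ ℂ) :
    ∃ (W : Matrix κ κ ℂ) (d : κ → ℝ), W * Wᴴ = 1 ∧ (∀ i, 0 ≤ d i) ∧
      (K * W)ᴴ * (K * W) = diagonal fun i => (d i : ℂ) := by
  have hp := posSemidef_conjTranspose_mul_self K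
  have hh := hp.isHermitian
  set W : Matrix κ κ ℂ := (hh.eigenvectorUnitary : Matrix κ κ ℂ)
  have hW1 : W * Wᴴ = 1 := Unitary.mul_star_self_of_mem hh.eigenvectorUnitary.2
  have hW2 : Wᴴ * W = 1 := Unitary.star_mul_self_of_mem hh.eigenvectorUnitary.2
  refine ⟨W, hh.eigenvalues, hW1, hp.eigenvalues_nonneg, ?_⟩
  have h := hh.spectral_theorem
  rw [Unitary.conjStarAlgAut_apply] at h
  rw [conjTranspose_mul, Matrix.mul_assoc, ← Matrix.mul_assoc Kᴴ]
  change Kᴴ * K = W * _ * Wᴴ at h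
  conv_lhs => rw [h]
  calc _ = (Wᴴ * W) * diagonal (RCLike.ofReal ∘ hh.eigenvalues) * (Wᴴ * W) := by
        simp only [Matrix.mul_assoc]
    _ = _ := by rw [hW2, Matrix.one_mul, Matrix.mul_one]; rfl

lemma cov_mul_unitary (K : Matrix ι κ ℂ) {W : Matrix κ κ ℂ} (hW : W * Wᴴ = 1) :
    cov (K * W) = cov K := by
  rw [cov, cov, conjTranspose_mul, Matrix.mul_assoc, ← Matrix.mul_assoc W, hW, Matrix.one_mul]

lemma det_cov_of_diagonal {K : Matrix ι κ ℂ} {d : κ → ℝ}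
    (hK : Kᴴ * K = diagonal fun i => (d i : ℂ)) : (cov K).det.re = ∏ i, (1 + d i) := by
  rw [cov, det_one_add_mul_comm, hK, ← diagonal_one, diagonal_add, det_diagonal]
  have : (∏ i, ((1 : ℂ) + (d i : ℂ))) = ((∏ i, (1 + d i) : ℝ) : ℂ) := by push_cast; rfl
  rw [this, Complex.ofReal_re]

/-- Woodbury's identity: `(1 + K Kᴴ)⁻¹ = 1 - K E Kᴴ` with `E = (1 + Kᴴ K)⁻¹`, which is diagonal
here. -/
lemma qf_cov_inv_of_diagonal {K : Matrix ι κ ℂ} {d : κ → ℝ} (hd : ∀ i, 0 ≤ d i)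
    (hK : Kᴴ * K = diagonal fun i => (d i : ℂ)) (v : ι → ℂ) :
    qf (cov K)⁻¹ v = sqNorm v - ∑ i, ‖(Kᴴ *ᵥ v) i‖ ^ 2 / (1 + d i) := by
  have hd' : ∀ i, (1 + d i : ℂ) ≠ 0 := fun i => by
    have := hd i
    exact_mod_cast (by positivity : (1 + d i : ℝ) ≠ 0)
  set E : Matrix κ κ ℂ := diagonal fun i => (1 + d i : ℂ)⁻¹
  have hE : E + Kᴴ * K * E = 1 := by
    rw [hK, diagonal_mul_diagonal, diagonal_add, ← diagonal_one]
    congr 1; ext i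
    have := hd' i
    field_simp
  have hinv : (cov K)⁻¹ = 1 - K * E * Kᴴ := by
    refine inv_eq_right_inv ?_
    calc cov K * (1 - K * E * Kᴴ) = 1 + K * (1 - (E + Kᴴ * K * E)) * Kᴴ := by
          rw [cov]
          simp only [Matrix.mul_sub, Matrix.add_mul, Matrix.mul_add, Matrix.mul_one,
            Matrix.one_mul, Matrix.sub_mul, Matrix.mul_assoc]
          abel
      _ = 1 := by rw [hE]; simp
  have h2 : qf (K * E * Kᴴ) v = ∑ i, ‖(Kᴴ *ᵥ v) i‖ ^ 2 / (1 + d i) := by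
    have := qf_conjTranspose_mul_mul E Kᴴ v
    rw [conjTranspose_conjTranspose] at this
    rw [this, qf]
    simp only [dotProduct, E, mulVec_diagonal, Complex.re_sum, Pi.star_apply]
    refine Finset.sum_congr rfl fun i _ => ?_
    have : star ((Kᴴ *ᵥ v) i) * ((1 + d i : ℂ)⁻¹ * (Kᴴ *ᵥ v) i) =
        ((‖(Kᴴ *ᵥ v) i‖ ^ 2 / (1 + d i) : ℝ) : ℂ) := by
      push_cast
      rw [← Complex.conj_mul', RCLike.star_def]
      ring
    rw [this, Complex.ofReal_re]
  rw [hinv, ← h2, ← qf_one]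
  simp only [qf, sub_mulVec, dotProduct_sub, Complex.sub_re]

lemma one_le_det_cov (K : Matrix ι κ ℂ) : 1 ≤ (cov K).det.re := by
  obtain ⟨W, d, hW, hd, hK⟩ := exists_diagonalization K
  rw [← cov_mul_unitary K hW, det_cov_of_diagonal hK]
  exact Finset.one_le_prod fun i _ => by linarith [hd i]

lemma det_cov_pos (K : Matrix ι κ ℂ) : 0 < (cov K).det.re := one_pos.trans_le (one_le_det_cov K)

lemma qf_cov_inv_nonneg (K : Matrix ι κ ℂ) (v : ι → ℂ) : 0 ≤ qf (cov K)⁻¹ v :=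
  qf_nonneg (cov_inv_posSemidef K) v

lemma qf_cov_inv_le (K : Matrix ι κ ℂ) (v : ι → ℂ) : qf (cov K)⁻¹ v ≤ sqNorm v := by
  obtain ⟨W, d, hW, hd, hK⟩ := exists_diagonalization K
  rw [← cov_mul_unitary K hW, qf_cov_inv_of_diagonal hd hK]
  have : 0 ≤ ∑ i, ‖((K * W)ᴴ *ᵥ v) i‖ ^ 2 / (1 + d i) :=
    Finset.sum_nonneg fun i _ => by have := hd i; positivity
  linarith

lemma logDet_nonneg (K : Matrix ι κ ℂ) : 0 ≤ logDet K := Real.log_nonneg (one_le_det_cov K)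

/-- Apply `log (1 + d) ≤ d` to each eigenvalue. This crude bound gives integrability of log
determinants and, later, boundedness of the disturbance penalty. -/
lemma logDet_le (K : Matrix ι κ ℂ) : logDet K ≤ (K * Kᴴ).trace.re := by
  obtain ⟨W, d, hW, hd, hK⟩ := exists_diagonalization K
  have h1 : (K * Kᴴ).trace.re = ∑ i, d i := by
    have : (K * W) * (K * W)ᴴ = K * Kᴴ := by
      rw [conjTranspose_mul, Matrix.mul_assoc, ← Matrix.mul_assoc W, hW, Matrix.one_mul]
    rw [← this, trace_mul_comm, hK, trace_diagonal]
    simp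
  rw [logDet, ← cov_mul_unitary K hW, det_cov_of_diagonal hK, h1, Real.log_prod]
  · refine Finset.sum_le_sum fun i _ => ?_
    have := Real.log_le_sub_one_of_pos (show 0 < 1 + d i by linarith [hd i])
    linarith
  · intro i _
    have := hd i
    positivity

lemma gdens_pos (K : Matrix ι κ ℂ) (v : ι → ℂ) : 0 < gdens K v := by
  have := det_cov_pos K
  unfold gdens; positivity

lemma log_gdens (K : Matrix ι κ ℂ) (v : ι → ℂ) :
    Real.log (gdens K v) =
      -(Fintype.card ι * Real.log Real.pi) - logDet K - qf (cov K)⁻¹ v := by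
  have h := det_cov_pos K
  have hpi := Real.pi_pos
  rw [gdens, Real.log_mul (by positivity) (by positivity), Real.log_mul (by positivity)
    (by positivity), Real.log_exp, Real.log_inv, Real.log_inv, Real.log_pow, logDet]
  ring

/-- Averaging a standard Gaussian density over Gaussian translations. -/
lemma lintegral_stdDens_sub_mulVec (K : Matrix ι κ ℂ) (v : ι → ℂ) :
    ∫⁻ g, ENNReal.ofReal (stdDens (v - K *ᵥ g)) ∂(cnStd κ) = ENNReal.ofReal (gdens K v) := by
  obtain ⟨W, d, hW, hd, hK⟩ := exists_diagonalization K
  have hm : Measurable fun g : κ → ℂ => ENNReal.ofReal (stdDens (v - K *ᵥ g)) := by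
    have : Continuous fun g : κ → ℂ => stdDens (v - K *ᵥ g) :=
      continuous_stdDens.comp (continuous_const.sub
        (Continuous.matrix_mulVec continuous_const continuous_id))
    exact this.measurable.ennreal_ofReal
  conv_lhs => rw [← cnStd_map_mulVec hW, lintegral_map hm (measurable_mulVec W)]
  -- Expanding `‖v - K W g‖²`, the quadratic part in `g` is diagonal, so the exponent separates over
  -- coordinates.
  have h : ∀ g : κ → ℂ, stdDens (v - K *ᵥ W *ᵥ g) = stdDens v *
      Real.exp (∑ i, (-d i * ‖g i‖ ^ 2 + 2 * (inner ℝ (((K * W)ᴴ *ᵥ v) i) (g i) : ℝ))) := by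
    intro g
    rw [stdDens, stdDens, mul_assoc, ← Real.exp_add]
    congr 2
    have e1 : sqNorm (v - K *ᵥ W *ᵥ g) = sqNorm v - 2 * (star ((K * W)ᴴ *ᵥ v) ⬝ᵥ g).re +
        (star g ⬝ᵥ ((K * W)ᴴ * (K * W)) *ᵥ g).re := by
      have e : (star ((K * W) *ᵥ g) ⬝ᵥ v).re = (star v ⬝ᵥ ((K * W) *ᵥ g)).re := by
        rw [star_dotProduct, ← Complex.conj_re]; rfl
      have e' : star g ⬝ᵥ ((K * W)ᴴ * (K * W)) *ᵥ g =
          star ((K * W) *ᵥ g) ⬝ᵥ ((K * W) *ᵥ g) := by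
        rw [star_mulVec, ← dotProduct_mulVec, mulVec_mulVec]
      rw [mulVec_mulVec, sqNorm_eq, sqNorm_eq, star_sub, sub_dotProduct, dotProduct_sub,
        dotProduct_sub, star_mulVec (K * W)ᴴ, conjTranspose_conjTranspose, ← dotProduct_mulVec, e']
      simp only [Complex.sub_re, e]
      ring
    rw [e1, hK, Finset.sum_add_distrib, ← Finset.mul_sum]
    have e2 : (star ((K * W)ᴴ *ᵥ v) ⬝ᵥ g).re =
        ∑ i, (inner ℝ (((K * W)ᴴ *ᵥ v) i) (g i) : ℝ) := by
      simp only [dotProduct, Complex.re_sum, inner_eq_re, Pi.star_apply]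
    have e3 : (star g ⬝ᵥ (diagonal fun i => (d i : ℂ)) *ᵥ g).re = ∑ i, d i * ‖g i‖ ^ 2 := by
      simp only [dotProduct, mulVec_diagonal, Complex.re_sum, Pi.star_apply]
      refine Finset.sum_congr rfl fun i _ => ?_
      have : star (g i) * ((d i : ℂ) * g i) = ((d i * ‖g i‖ ^ 2 : ℝ) : ℂ) := by
        push_cast
        rw [← Complex.conj_mul', RCLike.star_def]
        ring
      rw [this, Complex.ofReal_re]
    rw [e2, e3]
    simp only [neg_mul, Finset.sum_neg_distrib]
    ring
  simp_rw [h, ENNReal.ofReal_mul (stdDens_pos v).le]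
  rw [lintegral_const_mul' _ _ ENNReal.ofReal_ne_top, lintegral_exp_cnStd hd,
    ← ENNReal.ofReal_mul (stdDens_pos v).le]
  congr 1
  rw [gdens, ← cov_mul_unitary K hW, det_cov_of_diagonal hK, qf_cov_inv_of_diagonal hd hK,
    stdDens, neg_sub, sub_eq_add_neg, Real.exp_add]
  ring

section Continuity
variable {X : Type*} [TopologicalSpace X] {K : X → Matrix ι κ ℂ} {v : X → ι → ℂ}

lemma continuous_cov (hK : Continuous K) : Continuous fun x => cov (K x) :=
  continuous_const.add (hK.matrix_mul hK.matrix_conjTranspose)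

lemma continuous_det_cov (hK : Continuous K) : Continuous fun x => (cov (K x)).det.re :=
  Complex.continuous_re.comp (continuous_cov hK).matrix_det

lemma continuous_logDet (hK : Continuous K) : Continuous fun x => logDet (K x) :=
  (continuous_det_cov hK).log fun x => (det_cov_pos (K x)).ne'

lemma continuous_cov_inv (hK : Continuous K) : Continuous fun x => (cov (K x))⁻¹ := by
  simp_rw [inv_def, Ring.inverse_eq_inv']
  exact ((continuous_cov hK).matrix_det.inv₀ fun x => (cov_posDef (K x)).det_pos.ne').smul
    (continuous_cov hK).matrix_adjugate

lemma continuous_qf_cov_inv (hK : Continuous K) (hv : Continuous v) :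
    Continuous fun x => qf (cov (K x))⁻¹ (v x) :=
  Complex.continuous_re.comp (continuous_dotProduct_mulVec (continuous_cov_inv hK) hv.star hv)

lemma continuous_gdens (hK : Continuous K) (hv : Continuous v) :
    Continuous fun x => gdens (K x) (v x) :=
  (continuous_const.mul ((continuous_det_cov hK).inv₀ fun x => (det_cov_pos (K x)).ne')).mul
    (continuous_qf_cov_inv hK hv).neg.rexp

end Continuity

lemma gdens_le (K : Matrix ι κ ℂ) (v : ι → ℂ) : gdens K v ≤ (Real.pi ^ Fintype.card ι)⁻¹ := by
  have hpi := Real.pi_pos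
  have h1 : ((cov K).det.re)⁻¹ ≤ 1 := inv_le_one_of_one_le₀ (one_le_det_cov K)
  have h2 : Real.exp (-qf (cov K)⁻¹ v) ≤ 1 :=
    Real.exp_le_one_iff.2 (neg_nonpos.2 (qf_cov_inv_nonneg K v))
  rw [gdens, mul_assoc]
  refine mul_le_of_le_one_right (by positivity) (mul_le_one₀ h1 (Real.exp_pos _).le h2)

/-- The Hermitian form of the inverse covariance has mean equal to the dimension. -/
lemma lintegral_qf_cov_inv (K : Matrix ι κ ℂ) :
    ∫⁻ g, ∫⁻ z, ENNReal.ofReal (qf (cov K)⁻¹ (K *ᵥ g + z)) ∂(cnStd ι) ∂(cnStd κ) =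
      Fintype.card ι := by
  have hM := cov_inv_posSemidef K
  have h1 : ∀ g : κ → ℂ, ∫⁻ z, ENNReal.ofReal (qf (cov K)⁻¹ (K *ᵥ g + z)) ∂(cnStd ι) =
      ENNReal.ofReal ((cov K)⁻¹.trace.re) + ENNReal.ofReal (qf (cov K)⁻¹ (K *ᵥ g)) := by
    intro g
    have h := lintegral_qf_affine hM (1 : Matrix ι ι ℂ) (K *ᵥ g)
    simp only [one_mulVec, conjTranspose_one, Matrix.mul_one] at h
    simp_rw [add_comm (K *ᵥ g)]
    rw [h, ENNReal.ofReal_add _ (qf_nonneg hM _)]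
    exact (Complex.le_def.1 hM.trace_nonneg).1
  have h2 := lintegral_qf_affine hM K 0
  simp only [add_zero] at h2
  have h3 : qf (cov K)⁻¹ 0 = 0 := by simp [qf]
  have hdet : IsUnit (cov K).det := (cov_posDef K).det_pos.ne'.isUnit
  have h4 : (cov K)⁻¹.trace.re + ((cov K)⁻¹ * (K * Kᴴ)).trace.re = Fintype.card ι := by
    rw [← Complex.add_re, ← trace_add]
    have : (cov K)⁻¹ + (cov K)⁻¹ * (K * Kᴴ) = (cov K)⁻¹ * cov K := by
      rw [cov, Matrix.mul_add, Matrix.mul_one]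
    rw [this, nonsing_inv_mul _ hdet, trace_one]
    simp
  have h5 : 0 ≤ ((cov K)⁻¹ * (K * Kᴴ)).trace.re := by
    have := (hM.conjTranspose_mul_mul_same K).trace_nonneg
    rw [Matrix.mul_assoc, trace_mul_comm, Matrix.mul_assoc] at this
    exact (Complex.le_def.1 this).1
  simp_rw [h1]
  rw [lintegral_add_left measurable_const, lintegral_const, measure_univ, mul_one, h2, h3, add_zero,
    ← ENNReal.ofReal_add (Complex.le_def.1 hM.trace_nonneg).1 h5, h4, ENNReal.ofReal_natCast]

end
end RankOneChannel
namespace RankOneChannel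
noncomputable section

/-! ### Transition density and output density of the channel -/

lemma exists_sqNorm_mulVec_le {ι κ : Type*} [Fintype ι] [Fintype κ] (A : Matrix ι κ ℂ) :
    ∃ C : ℝ, 0 ≤ C ∧ ∀ x, sqNorm (A *ᵥ x) ≤ C * sqNorm x := by
  refine ⟨∑ i, ∑ j, ‖A i j‖ ^ 2, by positivity, fun x => ?_⟩
  rw [sqNorm, Finset.sum_mul]
  refine Finset.sum_le_sum fun i _ => ?_
  calc ‖(A *ᵥ x) i‖ ^ 2 ≤ (∑ j, ‖A i j‖ * ‖x j‖) ^ 2 := by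
        gcongr
        simp only [mulVec, dotProduct]
        exact (norm_sum_le _ _).trans (Finset.sum_le_sum fun j _ => norm_mul_le _ _)
    _ ≤ _ := Finset.sum_mul_sq_le_sq_mul_sq _ _ _

lemma lintegral_add_cnStd {ι : Type*} [Fintype ι] (c : ι → ℂ) {h : (ι → ℂ) → ℝ≥0∞}
    (hh : Measurable h) :
    ∫⁻ z, h (c + z) ∂(cnStd ι) = ∫⁻ y, ENNReal.ofReal (stdDens (y - c)) * h y := by
  have hm : Measurable fun v : ι → ℂ => ENNReal.ofReal (stdDens v) :=
    continuous_stdDens.measurable.ennreal_ofReal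
  rw [cnStd_eq, lintegral_withDensity_eq_lintegral_mul _ hm (by fun_prop)]
  have := lintegral_add_left_eq_self (μ := (volume : Measure (ι → ℂ)))
    (fun y => ENNReal.ofReal (stdDens (y - c)) * h y) c
  rw [← this]
  simp

variable {N : ℕ} (F G : Matrix (Fin N) (Fin N) ℂ) (σ : ℝ)

/-- The column `σ G x`. -/
def fadeCol (x : Fin N → ℂ) : Matrix (Fin N) Unit ℂ := Matrix.of fun i _ => (σ : ℂ) * (G *ᵥ x) i

/-- The transition density of the channel. -/
def trans (x y : Fin N → ℂ) : ℝ := gdens (fadeCol G σ x) (y - F *ᵥ x)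

/-- The output density for the input law `μ`. -/
def outDens (μ : Measure (Fin N → ℂ)) (y : Fin N → ℂ) : ℝ≥0∞ :=
  ∫⁻ x, ENNReal.ofReal (trans F G σ x y) ∂μ

variable {F G σ}

lemma fadeCol_mulVec (x : Fin N → ℂ) (g : Unit → ℂ) :
    fadeCol G σ x *ᵥ g = ((σ : ℂ) * g ()) • (G *ᵥ x) := by
  ext i; simp [fadeCol, mulVec, dotProduct]; ring

lemma trace_fadeCol (x : Fin N → ℂ) :
    (fadeCol G σ x * (fadeCol G σ x)ᴴ).trace.re = σ ^ 2 * sqNorm (G *ᵥ x) := by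
  have : (fadeCol G σ x * (fadeCol G σ x)ᴴ).trace = ((σ ^ 2 * sqNorm (G *ᵥ x) : ℝ) : ℂ) := by
    simp only [trace, diag_apply, mul_apply, fadeCol, conjTranspose_apply, of_apply]
    push_cast [sqNorm]
    rw [Finset.mul_sum]
    refine Finset.sum_congr rfl fun i _ => ?_
    rw [← Complex.conj_mul']
    simp
    ring
  rw [this, Complex.ofReal_re]

/-- Exchanging the factors reduces the determinant to a `1 × 1` matrix. Because the fading is one
scalar, its penalty is a single logarithm of the power. -/
lemma logDet_fadeCol (x : Fin N → ℂ) :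
    logDet (fadeCol G σ x) = Real.log (1 + σ ^ 2 * sqNorm (G *ᵥ x)) := by
  have h := trace_fadeCol (G := G) (σ := σ) x
  rw [trace_mul_comm] at h
  rw [logDet, cov, det_one_add_mul_comm, det_unique]
  simp only [trace, Finset.univ_unique, Finset.sum_singleton, diag_apply] at h
  rw [Matrix.add_apply, one_apply_eq, Complex.add_re, Complex.one_re]
  rw [← h]

lemma continuous_fadeCol : Continuous fun x : Fin N → ℂ => fadeCol G σ x := by
  unfold fadeCol
  refine continuous_matrix fun i _ => ?_
  have : Continuous fun x : Fin N → ℂ => G *ᵥ x :=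
    Continuous.matrix_mulVec continuous_const continuous_id
  simp only [of_apply]
  fun_prop

lemma continuous_trans : Continuous fun p : (Fin N → ℂ) × (Fin N → ℂ) => trans F G σ p.1 p.2 :=
  continuous_gdens (continuous_fadeCol.comp continuous_fst)
    (continuous_snd.sub (Continuous.matrix_mulVec continuous_const continuous_fst))

lemma measurable_trans : Measurable fun p : (Fin N → ℂ) × (Fin N → ℂ) => trans F G σ p.1 p.2 :=
  continuous_trans.measurable

lemma measurable_trans_left (y : Fin N → ℂ) : Measurable fun x => trans F G σ x y :=
  (continuous_trans.comp (continuous_id.prodMk continuous_const)).measurable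

lemma trans_pos (x y : Fin N → ℂ) : 0 < trans F G σ x y := gdens_pos _ _

lemma measurable_channel : Measurable fun p : (Fin N → ℂ) × ℂ × (Fin N → ℂ) =>
    (F + p.2.1 • G) *ᵥ p.1 + p.2.2 := by
  refine Continuous.measurable (Continuous.add (Continuous.matrix_mulVec ?_ continuous_fst)
    (by fun_prop))
  exact continuous_const.add ((continuous_fst.comp continuous_snd).smul continuous_const)

lemma lintegral_jointLaw (μ : Measure (Fin N → ℂ)) [SFinite μ]
    {h : (Fin N → ℂ) × (Fin N → ℂ) → ℝ≥0∞} (hh : Measurable h) :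
    ∫⁻ p, h p ∂(jointLaw F G σ μ) =
      ∫⁻ x, ∫⁻ s, ∫⁻ z, h (x, (F + s • G) *ᵥ x + z) ∂(cnStd (Fin N)) ∂(cn (σ ^ 2)) ∂μ := by
  have hm : Measurable fun p : (Fin N → ℂ) × ℂ × (Fin N → ℂ) =>
      (p.1, (F + p.2.1 • G) *ᵥ p.1 + p.2.2) := measurable_fst.prodMk measurable_channel
  have hm2 : Measurable fun p : (Fin N → ℂ) × ℂ × (Fin N → ℂ) =>
      h (p.1, (F + p.2.1 • G) *ᵥ p.1 + p.2.2) := hh.comp hm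
  rw [jointLaw, lintegral_map hh hm, lintegral_prod _ hm2.aemeasurable]
  refine lintegral_congr fun x => ?_
  rw [lintegral_prod _ (by fun_prop)]

instance isProbabilityMeasure_jointLaw (μ : Measure (Fin N → ℂ)) [IsProbabilityMeasure μ] :
    IsProbabilityMeasure (jointLaw F G σ μ) :=
  Measure.isProbabilityMeasure_map (measurable_fst.prodMk measurable_channel).aemeasurable

/-- Given `x`, the random fading translates the noise by a Gaussian multiple of the fixed vector `G
x`; averaging over it yields the covariance `I + σ² (G x)(G x)ᴴ`. -/
lemma lintegral_trans_eq (hσ : 0 < σ) (x y : Fin N → ℂ) :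
    ∫⁻ s, ENNReal.ofReal (stdDens (y - (F + s • G) *ᵥ x)) ∂(cn (σ ^ 2)) =
      ENNReal.ofReal (trans F G σ x y) := by
  have hm : Measurable fun s : ℂ => ENNReal.ofReal (stdDens (y - (F + s • G) *ᵥ x)) := by
    refine (continuous_stdDens.comp (continuous_const.sub
      (Continuous.matrix_mulVec ?_ continuous_const))).measurable.ennreal_ofReal
    fun_prop
  rw [trans, ← lintegral_stdDens_sub_mulVec, cn_eq_map_cnStd (sq_nonneg σ),
    lintegral_map hm (by fun_prop)]
  refine lintegral_congr fun g => ?_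
  rw [fadeCol_mulVec, Real.sqrt_sq hσ.le, add_mulVec, smul_mulVec, sub_sub]

lemma jointLaw_eq (hσ : 0 < σ) (μ : Measure (Fin N → ℂ)) [SFinite μ] :
    jointLaw F G σ μ = (μ.prod volume).withDensity
      fun p => ENNReal.ofReal (trans F G σ p.1 p.2) := by
  refine Measure.ext_of_lintegral _ fun h hh => ?_
  have hd : Measurable fun p : (Fin N → ℂ) × (Fin N → ℂ) =>
    ENNReal.ofReal (trans F G σ p.1 p.2) := measurable_trans.ennreal_ofReal
  rw [lintegral_jointLaw μ hh, lintegral_withDensity_eq_lintegral_mul _ hd hh,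
    lintegral_prod _ (hd.mul hh).aemeasurable]
  refine lintegral_congr fun x => ?_
  have hx : Measurable fun y => h (x, y) := by fun_prop
  simp_rw [fun s => lintegral_add_cnStd ((F + s • G) *ᵥ x) hx]
  rw [lintegral_lintegral_swap]
  · refine lintegral_congr fun y => ?_
    rw [lintegral_mul_const, lintegral_trans_eq hσ]
    · rfl
    · refine (continuous_stdDens.comp (continuous_const.sub
        (Continuous.matrix_mulVec ?_ continuous_const))).measurable.ennreal_ofReal
      fun_prop
  · refine Measurable.aemeasurable ?_
    refine Measurable.mul ?_ (hx.comp measurable_snd)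
    refine (continuous_stdDens.comp (continuous_snd.sub
        (Continuous.matrix_mulVec ?_ continuous_const))).measurable.ennreal_ofReal
    fun_prop

lemma measurable_outDens (μ : Measure (Fin N → ℂ)) [SFinite μ] :
    Measurable (outDens F G σ μ) :=
  Measurable.lintegral_prod_left' (f := fun p : (Fin N → ℂ) × (Fin N → ℂ) =>
    ENNReal.ofReal (trans F G σ p.1 p.2)) measurable_trans.ennreal_ofReal

lemma jointLaw_fst (μ : Measure (Fin N → ℂ)) [IsProbabilityMeasure μ] :
    (jointLaw F G σ μ).fst = μ := by
  have hm : Measurable fun p : (Fin N → ℂ) × ℂ × (Fin N → ℂ) =>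
      (p.1, (F + p.2.1 • G) *ᵥ p.1 + p.2.2) := measurable_fst.prodMk measurable_channel
  rw [Measure.fst, jointLaw, Measure.map_map measurable_fst hm]
  change Measure.map Prod.fst _ = μ
  rw [← Measure.fst, Measure.fst_prod]

lemma jointLaw_snd (hσ : 0 < σ) (μ : Measure (Fin N → ℂ)) [IsProbabilityMeasure μ] :
    (jointLaw F G σ μ).snd = volume.withDensity (outDens F G σ μ) := by
  refine Measure.ext_of_lintegral _ fun h hh => ?_
  have hd : Measurable fun p : (Fin N → ℂ) × (Fin N → ℂ) =>
    ENNReal.ofReal (trans F G σ p.1 p.2) := measurable_trans.ennreal_ofReal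
  have hh2 : Measurable fun p : (Fin N → ℂ) × (Fin N → ℂ) => h p.2 := hh.comp measurable_snd
  rw [Measure.snd, lintegral_map hh measurable_snd, jointLaw_eq hσ,
    lintegral_withDensity_eq_lintegral_mul _ hd hh2, lintegral_withDensity_eq_lintegral_mul _
    (measurable_outDens μ) hh, lintegral_prod_symm _ (hd.mul hh2).aemeasurable]
  refine lintegral_congr fun y => ?_
  simp only [Pi.mul_apply]
  exact lintegral_mul_const (h y) (measurable_trans_left y).ennreal_ofReal

lemma outDens_le (μ : Measure (Fin N → ℂ)) [IsProbabilityMeasure μ] (y : Fin N → ℂ) :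
    outDens F G σ μ y ≤ ENNReal.ofReal (Real.pi ^ N)⁻¹ := by
  calc outDens F G σ μ y ≤ ∫⁻ _, ENNReal.ofReal (Real.pi ^ N)⁻¹ ∂μ :=
        lintegral_mono fun x => ENNReal.ofReal_le_ofReal <| by
          simpa [trans] using gdens_le (fadeCol G σ x) (y - F *ᵥ x)
    _ = _ := by simp

/-- From `‖y - F x‖² ≤ 2‖y‖² + 2‖F x‖²` and `logDet_le`. The bound is a function of `y` times a
function of `x`, so it survives averaging over `x`. -/
lemma trans_ge (x y : Fin N → ℂ) :
    (Real.pi ^ N)⁻¹ * Real.exp (-2 * sqNorm y) *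
      Real.exp (-(σ ^ 2 * sqNorm (G *ᵥ x) + 2 * sqNorm (F *ᵥ x))) ≤ trans F G σ x y := by
  have hpi := Real.pi_pos
  rw [← Real.log_le_log_iff (by positivity) (trans_pos x y), trans, log_gdens, mul_assoc,
    Real.log_mul (by positivity) (by positivity), ← Real.exp_add, Real.log_exp, Real.log_inv,
    Real.log_pow]
  have h1 := logDet_le (fadeCol G σ x)
  rw [trace_fadeCol] at h1
  have h2 := qf_cov_inv_le (fadeCol G σ x) (y - F *ᵥ x)
  have h3 := sqNorm_add_le y (-(F *ᵥ x))
  rw [← sub_eq_add_neg] at h3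
  have h4 : sqNorm (-(F *ᵥ x)) = sqNorm (F *ᵥ x) := by simp [sqNorm]
  simp only [Fintype.card_fin]
  linarith

/-- The constant contains the mean of a positive bounded function of `x`, so it is positive for
every input law. Together with `outDens_le` it makes the log output density at most quadratic in
`y`, hence integrable at finite power. -/
lemma exists_outDens_ge (μ : Measure (Fin N → ℂ)) [IsProbabilityMeasure μ] :
    ∃ c : ℝ, 0 < c ∧ ∀ y, ENNReal.ofReal (c * Real.exp (-2 * sqNorm y)) ≤ outDens F G σ μ y := by
  have hpi := Real.pi_pos
  set f : (Fin N → ℂ) → ℝ≥0∞ := fun x => ENNReal.ofReal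
    (Real.exp (-(σ ^ 2 * sqNorm (G *ᵥ x) + 2 * sqNorm (F *ᵥ x)))) with hf
  have hfm : Measurable f := by rw [hf]; fun_prop
  have h0 : ∫⁻ x, f x ∂μ ≠ 0 := by
    rw [Ne, lintegral_eq_zero_iff hfm]
    intro h
    have : ∀ᵐ x ∂μ, False := h.mono fun x hx => by
      have : 0 < f x := ENNReal.ofReal_pos.2 (Real.exp_pos _)
      exact this.ne' hx
    simp at this
    exact IsProbabilityMeasure.ne_zero μ this
  have h1 : ∫⁻ x, f x ∂μ ≠ ⊤ := by
    refine ne_top_of_le_ne_top ENNReal.one_ne_top ?_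
    calc ∫⁻ x, f x ∂μ ≤ ∫⁻ _, 1 ∂μ := lintegral_mono fun x => by
          rw [hf, ENNReal.ofReal_le_one, Real.exp_le_one_iff]
          have := sqNorm_nonneg (G *ᵥ x)
          have := sqNorm_nonneg (F *ᵥ x)
          have : 0 ≤ σ ^ 2 * sqNorm (G *ᵥ x) := by positivity
          linarith
      _ = 1 := by simp
  refine ⟨(Real.pi ^ N)⁻¹ * (∫⁻ x, f x ∂μ).toReal,
    mul_pos (by positivity) (ENNReal.toReal_pos h0 h1), fun y => ?_⟩
  have : (Real.pi ^ N)⁻¹ * (∫⁻ x, f x ∂μ).toReal * Real.exp (-2 * sqNorm y) =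
      (Real.pi ^ N)⁻¹ * Real.exp (-2 * sqNorm y) * (∫⁻ x, f x ∂μ).toReal := by ring
  rw [this, ENNReal.ofReal_mul (by positivity), ENNReal.ofReal_toReal h1, outDens,
    ← lintegral_const_mul _ hfm]
  refine lintegral_mono fun x => ?_
  rw [hf, ← ENNReal.ofReal_mul (by positivity)]
  exact ENNReal.ofReal_le_ofReal (trans_ge x y)

lemma outDens_pos (μ : Measure (Fin N → ℂ)) [IsProbabilityMeasure μ] (y : Fin N → ℂ) :
    0 < outDens F G σ μ y := by
  obtain ⟨c, hc, h⟩ := exists_outDens_ge (F := F) (G := G) (σ := σ) μ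
  exact (ENNReal.ofReal_pos.2 (by positivity)).trans_le (h y)

lemma outDens_ne_top (μ : Measure (Fin N → ℂ)) [IsProbabilityMeasure μ] (y : Fin N → ℂ) :
    outDens F G σ μ y ≠ ⊤ := ne_top_of_le_ne_top ENNReal.ofReal_ne_top (outDens_le μ y)

lemma gam_one (x : Fin N → ℂ) :
    gam F G σ 1 x = N + sqNorm (F *ᵥ x) + σ ^ 2 * sqNorm (G *ᵥ x) := by
  have h1 : ∀ A : Matrix (Fin N) (Fin N) ℂ, star x ⬝ᵥ (Aᴴ * A) *ᵥ x = (sqNorm (A *ᵥ x) : ℂ) := by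
    intro A
    rw [← star_dotProduct_self, star_mulVec, ← dotProduct_mulVec, mulVec_mulVec]
  rw [gam, Matrix.mul_one, Matrix.mul_one, add_mulVec, smul_mulVec, dotProduct_add,
    dotProduct_smul, h1, h1, trace_one]
  simp only [Complex.add_re, smul_eq_mul, Complex.re_ofReal_mul, Complex.ofReal_re,
    Fintype.card_fin, Complex.natCast_re]
  ring

lemma gam_one_pos (hN : 0 < N) (x : Fin N → ℂ) : 0 < gam F G σ 1 x := by
  rw [gam_one]
  have := sqNorm_nonneg (F *ᵥ x)
  have := sqNorm_nonneg (G *ᵥ x)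
  have : (0 : ℝ) < N := by exact_mod_cast hN
  positivity

/-- Identifies `γ(I, x)` as the conditional output power, which explains its role in the duality
bound. -/
lemma lintegral_sqNorm_output (x : Fin N → ℂ) :
    ∫⁻ s, ∫⁻ z, ENNReal.ofReal (sqNorm ((F + s • G) *ᵥ x + z)) ∂(cnStd (Fin N)) ∂(cn (σ ^ 2)) =
      ENNReal.ofReal (gam F G σ 1 x) := by
  have h1 : ∀ s : ℂ, ∫⁻ z, ENNReal.ofReal (sqNorm ((F + s • G) *ᵥ x + z)) ∂(cnStd (Fin N)) =
      N + ENNReal.ofReal (sqNorm (s • (G *ᵥ x) + F *ᵥ x)) := by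
    intro s
    have h := lintegral_qf_affine (PosSemidef.one (n := Fin N) (R := ℂ)) (1 : Matrix (Fin N) (Fin N) ℂ)
      ((F + s • G) *ᵥ x)
    simp only [qf_one, one_mulVec, conjTranspose_one, Matrix.mul_one, trace_one] at h
    simp_rw [add_comm _ ((F + s • G) *ᵥ x)] at h
    rw [h, ENNReal.ofReal_add (by simp) (sqNorm_nonneg _), add_mulVec, smul_mulVec,
      add_comm (F *ᵥ x)]
    simp
  have h2 := lintegral_qf_cn (PosSemidef.one (n := Fin N) (R := ℂ)) (sq_nonneg σ) (G *ᵥ x)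
    (F *ᵥ x)
  simp only [qf_one] at h2
  have := sqNorm_nonneg (F *ᵥ x)
  have := sqNorm_nonneg (G *ᵥ x)
  simp_rw [h1]
  rw [lintegral_add_left measurable_const, lintegral_const, measure_univ, mul_one, h2, gam_one,
    ← ENNReal.ofReal_natCast, ← ENNReal.ofReal_add (by positivity) (by positivity)]
  congr 1; ring

lemma lintegral_qf_output (hσ : 0 < σ) (x : Fin N → ℂ) :
    ∫⁻ s, ∫⁻ z, ENNReal.ofReal (qf (cov (fadeCol G σ x))⁻¹ ((F + s • G) *ᵥ x + z - F *ᵥ x))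
      ∂(cnStd (Fin N)) ∂(cn (σ ^ 2)) = N := by
  have h := lintegral_qf_cov_inv (fadeCol G σ x)
  rw [Fintype.card_fin] at h
  rw [← h, cn_eq_map_cnStd (sq_nonneg σ), lintegral_map _ (by fun_prop)]
  · refine lintegral_congr fun g => lintegral_congr fun z => ?_
    rw [fadeCol_mulVec, Real.sqrt_sq hσ.le, add_mulVec, smul_mulVec]
    congr 2; abel
  · refine Measurable.lintegral_prod_right' (f := fun p : ℂ × (Fin N → ℂ) => ENNReal.ofReal
      (qf (cov (fadeCol G σ x))⁻¹ ((F + p.1 • G) *ᵥ x + p.2 - F *ᵥ x))) ?_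
    refine ((continuous_qf _).comp (Continuous.sub (Continuous.add (Continuous.matrix_mulVec ?_
      continuous_const) continuous_snd) continuous_const)).measurable.ennreal_ofReal
    fun_prop

end
end RankOneChannel
namespace RankOneChannel
noncomputable section
set_option linter.unusedSectionVars false

/-! ### Mutual information as a difference of mean log densities -/

lemma hasIntegral_of_lintegral {α : Type*} [MeasurableSpace α] {ν : Measure α} {f : α → ℝ}
    (hm : Measurable f) (h0 : ∀ x, 0 ≤ f x) {c : ℝ} (hc : 0 ≤ c)
    (h : ∫⁻ x, ENNReal.ofReal (f x) ∂ν = ENNReal.ofReal c) :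
    Integrable f ν ∧ ∫ x, f x ∂ν = c := by
  refine ⟨⟨hm.aestronglyMeasurable, ?_⟩, ?_⟩
  · rw [hasFiniteIntegral_iff_ofReal (ae_of_all _ h0), h]
    exact ENNReal.ofReal_lt_top
  · rw [integral_eq_lintegral_of_nonneg_ae (ae_of_all _ h0) hm.aestronglyMeasurable, h,
      ENNReal.toReal_ofReal hc]

/-- Gibbs' inequality: a function whose exponential has mean at most one has nonpositive mean. -/
lemma integral_nonpos_of_lintegral_exp_le_one {α : Type*} [MeasurableSpace α] {ν : Measure α}
    [IsProbabilityMeasure ν] {g : α → ℝ} (hg : Integrable g ν)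
    (h : ∫⁻ x, ENNReal.ofReal (Real.exp (g x)) ∂ν ≤ 1) : ∫ x, g x ∂ν ≤ 0 := by
  have hi : Integrable (fun x => Real.exp (g x)) ν := by
    refine ⟨Real.continuous_exp.comp_aestronglyMeasurable hg.1, ?_⟩
    rw [hasFiniteIntegral_iff_ofReal (ae_of_all _ fun _ => (Real.exp_pos _).le)]
    exact h.trans_lt ENNReal.one_lt_top
  have h1 : ∫ x, Real.exp (g x) ∂ν ≤ 1 := by
    rw [integral_eq_lintegral_of_nonneg_ae (ae_of_all _ fun _ => (Real.exp_pos _).le) hi.1]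
    exact ENNReal.toReal_le_of_le_ofReal zero_le_one (by simpa using h)
  have h2 : ∫ x, g x ∂ν ≤ ∫ x, (Real.exp (g x) - 1) ∂ν :=
    integral_mono hg (hi.sub (integrable_const _)) fun x => by
      have := Real.add_one_le_exp (g x); simp only; linarith
  rw [integral_sub hi (integrable_const _)] at h2
  simp at h2
  linarith

variable {N : ℕ} {F G : Matrix (Fin N) (Fin N) ℂ} {σ : ℝ} {μ : Measure (Fin N → ℂ)}

lemma integrable_sqNorm_mulVec {Ω : Type*} [MeasurableSpace Ω] {ν : Measure Ω}
    {X : Ω → Fin N → ℂ} (hX : Measurable X) (h : Integrable (fun ω => sqNorm (X ω)) ν)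
    (A : Matrix (Fin N) (Fin N) ℂ) : Integrable (fun ω => sqNorm (A *ᵥ X ω)) ν := by
  obtain ⟨C, hC, hA⟩ := exists_sqNorm_mulVec_le A
  refine (h.const_mul C).mono' (Measurable.aestronglyMeasurable (by fun_prop))
    (ae_of_all _ fun ω => ?_)
  rw [Real.norm_of_nonneg (sqNorm_nonneg _)]
  exact hA _

lemma measurable_qf_trans :
    Measurable fun p : (Fin N → ℂ) × (Fin N → ℂ) =>
      qf (cov (fadeCol G σ p.1))⁻¹ (p.2 - F *ᵥ p.1) :=
  (continuous_qf_cov_inv (continuous_fadeCol.comp continuous_fst)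
    (continuous_snd.sub (Continuous.matrix_mulVec continuous_const continuous_fst))).measurable

section Input
variable [IsProbabilityMeasure μ] (h2 : Integrable sqNorm μ)
include h2

lemma integrable_gam_one : Integrable (gam F G σ 1) μ := by
  have h : gam F G σ 1 = fun x => N + sqNorm (F *ᵥ x) + σ ^ 2 * sqNorm (G *ᵥ x) :=
    funext gam_one
  rw [h]
  exact ((integrable_const _).add (integrable_sqNorm_mulVec measurable_id h2 F)).add
    ((integrable_sqNorm_mulVec measurable_id h2 G).const_mul _)

lemma hasIntegral_sqNorm_output : Integrable (fun p => sqNorm p.2) (jointLaw F G σ μ) ∧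
    ∫ p, sqNorm p.2 ∂(jointLaw F G σ μ) = ∫ x, gam F G σ 1 x ∂μ := by
  have h0 : ∀ x, 0 ≤ gam F G σ 1 x := fun x => by
    rw [gam_one]
    have := sqNorm_nonneg (F *ᵥ x)
    have := sqNorm_nonneg (G *ᵥ x)
    positivity
  refine hasIntegral_of_lintegral (by fun_prop) (fun p => sqNorm_nonneg _)
    (integral_nonneg h0) ?_
  rw [lintegral_jointLaw μ (by fun_prop)]
  simp_rw [lintegral_sqNorm_output]
  rw [ofReal_integral_eq_lintegral_ofReal (integrable_gam_one h2) (ae_of_all _ h0)]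

lemma integrable_log_fading :
    Integrable (fun x => Real.log (1 + σ ^ 2 * sqNorm (G *ᵥ x))) μ := by
  refine ((integrable_sqNorm_mulVec measurable_id h2 G).const_mul (σ ^ 2)).mono'
    (Measurable.aestronglyMeasurable (by fun_prop)) (ae_of_all _ fun x => ?_)
  have h1 : 0 ≤ σ ^ 2 * sqNorm (G *ᵥ x) := mul_nonneg (sq_nonneg _) (sqNorm_nonneg _)
  rw [Real.norm_of_nonneg (Real.log_nonneg (by linarith))]
  have := Real.log_le_sub_one_of_pos (show 0 < 1 + σ ^ 2 * sqNorm (G *ᵥ x) by linarith)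
  simp only [id]
  linarith

omit h2 in
lemma measurePreserving_fst_jointLaw :
    MeasurePreserving Prod.fst (jointLaw F G σ μ) μ :=
  ⟨measurable_fst, jointLaw_fst μ⟩

omit h2 in
lemma hasIntegral_qf_output (hσ : 0 < σ) :
    Integrable (fun p => qf (cov (fadeCol G σ p.1))⁻¹ (p.2 - F *ᵥ p.1)) (jointLaw F G σ μ) ∧
    ∫ p, qf (cov (fadeCol G σ p.1))⁻¹ (p.2 - F *ᵥ p.1) ∂(jointLaw F G σ μ) = N := by
  refine hasIntegral_of_lintegral measurable_qf_trans (fun p => qf_cov_inv_nonneg _ _)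
    (Nat.cast_nonneg _) ?_
  rw [lintegral_jointLaw μ measurable_qf_trans.ennreal_ofReal]
  simp only [lintegral_qf_output hσ]
  simp

/-- The conditional entropy of the output given the input. -/
lemma hasIntegral_log_trans (hσ : 0 < σ) :
    Integrable (fun p => Real.log (trans F G σ p.1 p.2)) (jointLaw F G σ μ) ∧
    ∫ p, Real.log (trans F G σ p.1 p.2) ∂(jointLaw F G σ μ) =
      -(N * Real.log Real.pi) - (∫ x, Real.log (1 + σ ^ 2 * sqNorm (G *ᵥ x)) ∂μ) - N := by
  obtain ⟨i1, e1⟩ := hasIntegral_qf_output (F := F) (G := G) (μ := μ) hσ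
  have hm : Measurable fun x => Real.log (1 + σ ^ 2 * sqNorm (G *ᵥ x)) := by fun_prop
  have mp := measurePreserving_fst_jointLaw (F := F) (G := G) (σ := σ) (μ := μ)
  have i2 : Integrable (fun p : (Fin N → ℂ) × (Fin N → ℂ) =>
      Real.log (1 + σ ^ 2 * sqNorm (G *ᵥ p.1))) (jointLaw F G σ μ) :=
    mp.integrable_comp_of_integrable (integrable_log_fading h2)
  have e2 : ∫ p : (Fin N → ℂ) × (Fin N → ℂ),
      Real.log (1 + σ ^ 2 * sqNorm (G *ᵥ p.1)) ∂(jointLaw F G σ μ) =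
      ∫ x, Real.log (1 + σ ^ 2 * sqNorm (G *ᵥ x)) ∂μ := by
    have := integral_map (μ := jointLaw F G σ μ) (φ := Prod.fst) measurable_fst.aemeasurable
      hm.aestronglyMeasurable
    rw [mp.map_eq] at this
    exact this.symm
  have h : ∀ p : (Fin N → ℂ) × (Fin N → ℂ), Real.log (trans F G σ p.1 p.2) =
      -(N * Real.log Real.pi) - Real.log (1 + σ ^ 2 * sqNorm (G *ᵥ p.1)) -
        qf (cov (fadeCol G σ p.1))⁻¹ (p.2 - F *ᵥ p.1) := fun p => by
    rw [trans, log_gdens, logDet_fadeCol, Fintype.card_fin]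
  simp_rw [h]
  have i3 := (integrable_const (μ := jointLaw F G σ μ) (-(N * Real.log Real.pi))).sub i2
  simp only [Pi.sub_def] at i3
  refine ⟨i3.sub i1, ?_⟩
  rw [integral_sub i3 i1, integral_sub (integrable_const _) i2, e1, e2]
  simp

/-- The output log density is integrable. -/
lemma integrable_log_outDens :
    Integrable (fun p => Real.log (outDens F G σ μ p.2).toReal) (jointLaw F G σ μ) := by
  obtain ⟨c, hc, hlow⟩ := exists_outDens_ge (F := F) (G := G) (σ := σ) μ
  have hpi := Real.pi_pos
  refine (((hasIntegral_sqNorm_output (F := F) (G := G) (σ := σ) h2).1.const_mul 2).add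
    (integrable_const (|Real.log c| + |Real.log (Real.pi ^ N)⁻¹|))).mono'
    ((measurable_outDens μ).comp measurable_snd).ennreal_toReal.log.aestronglyMeasurable
    (ae_of_all _ fun p => ?_)
  have h1 : c * Real.exp (-2 * sqNorm p.2) ≤ (outDens F G σ μ p.2).toReal :=
    (ENNReal.ofReal_le_iff_le_toReal (outDens_ne_top μ _)).1 (hlow p.2)
  have h3 : (outDens F G σ μ p.2).toReal ≤ (Real.pi ^ N)⁻¹ :=
    ENNReal.toReal_le_of_le_ofReal (by positivity) (outDens_le μ _)
  have hpos : 0 < (outDens F G σ μ p.2).toReal := lt_of_lt_of_le (by positivity) h1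
  have h4 := Real.log_le_log (by positivity) h1
  have h5 := Real.log_le_log hpos h3
  rw [Real.log_mul hc.ne' (Real.exp_pos _).ne', Real.log_exp] at h4
  have := sqNorm_nonneg p.2
  simp only [Pi.add_apply, Real.norm_eq_abs]
  rw [abs_le]
  constructor
  · have := neg_abs_le (Real.log c)
    have := abs_nonneg (Real.log (Real.pi ^ N)⁻¹)
    linarith
  · have := le_abs_self (Real.log (Real.pi ^ N)⁻¹)
    have := abs_nonneg (Real.log c)
    linarith

/-- Mutual information is the mean of the information density. -/
theorem mutualInfo_eq (hσ : 0 < σ) :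
    mutualInfo F G σ μ = ENNReal.ofReal
      ((∫ p, Real.log (trans F G σ p.1 p.2) ∂(jointLaw F G σ μ)) -
        ∫ p, Real.log (outDens F G σ μ p.2).toReal ∂(jointLaw F G σ μ)) := by
  set J := jointLaw F G σ μ with hJ
  set ν := J.fst.prod J.snd with hν
  set D : (Fin N → ℂ) × (Fin N → ℂ) → ℝ≥0∞ := fun p =>
    ENNReal.ofReal (trans F G σ p.1 p.2) / outDens F G σ μ p.2 with hD
  have hpm : Measurable (outDens F G σ μ) := measurable_outDens μ
  have hpm2 : Measurable fun p : (Fin N → ℂ) × (Fin N → ℂ) => outDens F G σ μ p.2 :=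
    hpm.comp measurable_snd
  have hDm : Measurable D := measurable_trans.ennreal_ofReal.div hpm2
  have : SFinite ((volume : Measure (Fin N → ℂ)).withDensity (outDens F G σ μ)) := by
    infer_instance
  have hν' : ν = (μ.prod volume).withDensity fun p => outDens F G σ μ p.2 := by
    rw [hν, hJ, jointLaw_fst, jointLaw_snd hσ, prod_withDensity_right hpm]
  -- The joint law and the product of its marginals both have densities with respect to `μ ⊗
  -- volume`, so their quotient is the Radon–Nikodym derivative. Division is safe as the output
  -- density is positive and finite everywhere.
  have hJ' : J = ν.withDensity D := by
    rw [hν', ← withDensity_mul _ hpm2 hDm, hJ, jointLaw_eq hσ]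
    congr 1
    ext p
    exact (ENNReal.mul_div_cancel (outDens_pos μ _).ne' (outDens_ne_top μ _)).symm
  have hac : J ≪ ν := hJ' ▸ withDensity_absolutelyContinuous _ _
  have hllr : llr J ν =ᵐ[J] fun p => Real.log (trans F G σ p.1 p.2) -
      Real.log (outDens F G σ μ p.2).toReal := by
    have h1 : J.rnDeriv ν =ᵐ[ν] D := by
      conv_lhs => rw [hJ']
      exact Measure.rnDeriv_withDensity ν hDm
    filter_upwards [hac.ae_le h1] with p hp
    have hpos := ENNReal.toReal_pos (outDens_pos (F := F) (G := G) (σ := σ) μ p.2).ne'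
      (outDens_ne_top μ _)
    rw [llr, hp, hD, ENNReal.toReal_div, ENNReal.toReal_ofReal (trans_pos _ _).le,
      Real.log_div (trans_pos _ _).ne' hpos.ne']
  have hi := (hasIntegral_log_trans (F := F) (G := G) h2 hσ).1.sub
    (integrable_log_outDens (F := F) (G := G) (σ := σ) h2)
  have hi' : Integrable (llr J ν) J := hi.congr hllr.symm
  rw [mutualInfo, klDiv_of_ac_of_integrable hac hi', integral_congr_ae hllr,
    integral_sub (hasIntegral_log_trans h2 hσ).1 (integrable_log_outDens h2)]
  -- The mass correction in `klDiv` cancels, both measures being probabilities.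
  simp [hJ, ν]

/-- Gibbs' inequality for `log r` minus the information density. After exponentiation the transition
density cancels, and `∫ p(y) (∫ r(x, y) dμ(x)) dy ≤ 1` remains. -/
lemma integral_log_metric_le (hσ : 0 < σ) {r : (Fin N → ℂ) × (Fin N → ℂ) → ℝ}
    (hr : Measurable r) (hrpos : ∀ p, 0 < r p) (hr1 : ∀ y, ∫⁻ x, ENNReal.ofReal (r (x, y)) ∂μ ≤ 1)
    (hri : Integrable (fun p => Real.log (r p)) (jointLaw F G σ μ)) :
    ∫ p, Real.log (r p) ∂(jointLaw F G σ μ) ≤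
      (∫ p, Real.log (trans F G σ p.1 p.2) ∂(jointLaw F G σ μ)) -
        ∫ p, Real.log (outDens F G σ μ p.2).toReal ∂(jointLaw F G σ μ) := by
  have hpi := integrable_log_outDens (F := F) (G := G) (σ := σ) h2
  have hti := (hasIntegral_log_trans (F := F) (G := G) h2 hσ).1
  have h := integral_nonpos_of_lintegral_exp_le_one (hri.sub (hti.sub hpi)) ?_
  · have e1 := integral_sub hri (hti.sub hpi)
    have e2 := integral_sub hti hpi
    simp only [Pi.sub_apply] at h e1 e2
    rw [e1, e2] at h
    linarith
  · have hpm2 : Measurable fun p : (Fin N → ℂ) × (Fin N → ℂ) => outDens F G σ μ p.2 :=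
      (measurable_outDens μ).comp measurable_snd
    have hm : Measurable fun p : (Fin N → ℂ) × (Fin N → ℂ) => ENNReal.ofReal
        (Real.exp (Real.log (r p) - (Real.log (trans F G σ p.1 p.2) -
          Real.log (outDens F G σ μ p.2).toReal))) :=
      (hr.log.sub (measurable_trans.log.sub hpm2.ennreal_toReal.log)).exp.ennreal_ofReal
    have hd : Measurable fun p : (Fin N → ℂ) × (Fin N → ℂ) =>
      ENNReal.ofReal (trans F G σ p.1 p.2) := measurable_trans.ennreal_ofReal
    calc _ = ∫⁻ p, ENNReal.ofReal (r p) * outDens F G σ μ p.2 ∂(μ.prod volume) := by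
          rw [jointLaw_eq hσ]
          simp only [Pi.sub_apply]
          rw [lintegral_withDensity_eq_lintegral_mul _ hd hm]
          refine lintegral_congr fun p => ?_
          have hpos := ENNReal.toReal_pos (outDens_pos (F := F) (G := G) (σ := σ) μ p.2).ne'
            (outDens_ne_top μ _)
          have ht := trans_pos (F := F) (G := G) (σ := σ) p.1 p.2
          simp only [Pi.mul_apply]
          rw [← ENNReal.ofReal_mul ht.le, Real.exp_sub, Real.exp_sub, Real.exp_log (hrpos p),
            Real.exp_log hpos, Real.exp_log ht]
          conv_rhs => rw [← ENNReal.ofReal_toReal (outDens_ne_top (F := F) (G := G) (σ := σ) μ p.2),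
            ← ENNReal.ofReal_mul (hrpos p).le]
          congr 1
          field_simp
      _ = ∫⁻ y, (∫⁻ x, ENNReal.ofReal (r (x, y)) ∂μ) * outDens F G σ μ y := by
          have hm3 : Measurable fun p => ENNReal.ofReal (r p) * outDens F G σ μ p.2 :=
            hr.ennreal_ofReal.mul hpm2
          rw [lintegral_prod_symm _ hm3.aemeasurable]
          refine lintegral_congr fun y => ?_
          have hy : Measurable fun x => ENNReal.ofReal (r (x, y)) :=
            (hr.comp measurable_prodMk_right).ennreal_ofReal
          simp only
          rw [lintegral_mul_const _ hy]
      _ ≤ ∫⁻ y, outDens F G σ μ y := lintegral_mono fun y => mul_le_of_le_one_left' (hr1 y)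
      _ = (jointLaw F G σ μ).snd Set.univ := by
          rw [jointLaw_snd hσ, withDensity_apply _ MeasurableSet.univ, setLIntegral_univ]
      _ = 1 := by simp
      _ ≤ 1 := le_rfl

/-- The constant metric `r = 1` shows that the difference is nonnegative, so the truncation in
`ENNReal.ofReal` is harmless. -/
lemma mutualInfo_coe_eq (hσ : 0 < σ) :
    (mutualInfo F G σ μ : EReal) =
      (((∫ p, Real.log (trans F G σ p.1 p.2) ∂(jointLaw F G σ μ)) -
        ∫ p, Real.log (outDens F G σ μ p.2).toReal ∂(jointLaw F G σ μ) : ℝ) : EReal) := by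
  have h := integral_log_metric_le (F := F) (G := G) h2 hσ (r := fun _ => 1) measurable_const
    (fun _ => one_pos) (fun _ => by simp) (by simp)
  simp only [Real.log_one, integral_zero] at h
  rw [mutualInfo_eq h2 hσ, EReal.coe_ennreal_ofReal, max_eq_left h]

/-- Lower bound of the mutual information by a decoding metric (Donsker–Varadhan). -/
theorem le_mutualInfo_of_metric (hσ : 0 < σ) {r : (Fin N → ℂ) × (Fin N → ℂ) → ℝ}
    (hr : Measurable r) (hrpos : ∀ p, 0 < r p) (hr1 : ∀ y, ∫⁻ x, ENNReal.ofReal (r (x, y)) ∂μ ≤ 1)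
    (hri : Integrable (fun p => Real.log (r p)) (jointLaw F G σ μ)) :
    ((∫ p, Real.log (r p) ∂(jointLaw F G σ μ) : ℝ) : EReal) ≤ mutualInfo F G σ μ := by
  rw [mutualInfo_coe_eq h2 hσ]
  exact EReal.coe_le_coe_iff.2 (integral_log_metric_le h2 hσ hr hrpos hr1 hri)

/-- Upper bound of the mutual information by an auxiliary output density. -/
theorem mutualInfo_le_of_density (hσ : 0 < σ) {q : (Fin N → ℂ) → ℝ} (hq : Measurable q)
    (hqpos : ∀ᵐ y, 0 < q y) (hq1 : ∫⁻ y, ENNReal.ofReal (q y) ≤ 1)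
    (hqi : Integrable (fun p => Real.log (q p.2)) (jointLaw F G σ μ)) :
    (mutualInfo F G σ μ : EReal) ≤
      (((∫ p, Real.log (trans F G σ p.1 p.2) ∂(jointLaw F G σ μ)) -
        ∫ p, Real.log (q p.2) ∂(jointLaw F G σ μ) : ℝ) : EReal) := by
  rw [mutualInfo_coe_eq h2 hσ]
  refine EReal.coe_le_coe_iff.2 ?_
  have hpi := integrable_log_outDens (F := F) (G := G) (σ := σ) h2
  have h := integral_nonpos_of_lintegral_exp_le_one (hqi.sub hpi) ?_
  · simp only [Pi.sub_apply] at h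
    rw [integral_sub hqi hpi] at h
    linarith
  · have hm : Measurable fun y => ENNReal.ofReal
        (Real.exp (Real.log (q y) - Real.log (outDens F G σ μ y).toReal)) :=
      (hq.log.sub (measurable_outDens μ).ennreal_toReal.log).exp.ennreal_ofReal
    calc _ = ∫⁻ y, ENNReal.ofReal
          (Real.exp (Real.log (q y) - Real.log (outDens F G σ μ y).toReal))
          ∂(jointLaw F G σ μ).snd := by
          rw [Measure.snd, lintegral_map hm measurable_snd]; rfl
      _ = ∫⁻ y, ENNReal.ofReal (q y) := by
          rw [jointLaw_snd hσ, lintegral_withDensity_eq_lintegral_mul _ (measurable_outDens μ) hm]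
          refine lintegral_congr_ae (hqpos.mono fun y hy => ?_)
          have hpos := ENNReal.toReal_pos (outDens_pos (F := F) (G := G) (σ := σ) μ y).ne'
            (outDens_ne_top μ _)
          simp only [Pi.mul_apply]
          rw [Real.exp_sub, Real.exp_log hy, Real.exp_log hpos, ENNReal.ofReal_div_of_pos hpos,
            ENNReal.ofReal_toReal (outDens_ne_top μ _)]
          exact ENNReal.mul_div_cancel (outDens_pos μ _).ne' (outDens_ne_top μ _)
      _ ≤ 1 := hq1

end Input

end
end RankOneChannel
namespace RankOneChannel
noncomputable section

/-! ### The duality bound -/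

lemma lintegral_Ioi_exp_neg_mul {S a : ℝ} (hS : 0 < S) :
    ∫⁻ t in Set.Ioi a, ENNReal.ofReal (Real.exp (-t * S)) =
      ENNReal.ofReal (S⁻¹ * Real.exp (-(a * S))) := by
  have hS' : -S < 0 := by linarith
  have h1 := integral_exp_mul_Ioi hS' a
  have hi := integrableOn_exp_mul_Ioi hS' a
  have h2 : ∀ t : ℝ, Real.exp (-t * S) = Real.exp (-S * t) := fun t => by congr 1; ring
  simp_rw [h2]
  rw [← ofReal_integral_eq_lintegral_ofReal hi (ae_of_all _ fun _ => (Real.exp_pos _).le), h1]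
  congr 1
  rw [neg_div_neg_eq, div_eq_inv_mul]
  congr 2; ring

lemma lintegral_Ioi_inv_pow {a : ℝ} (ha : 0 < a) {n : ℕ} (hn : 2 ≤ n) :
    ∫⁻ t in Set.Ioi a, ENNReal.ofReal ((Real.pi / t) ^ n) =
      ENNReal.ofReal (Real.pi ^ n * (a⁻¹ ^ (n - 1) / (n - 1))) := by
  have hn' : (2 : ℝ) ≤ n := by exact_mod_cast hn
  have hlt : -(n : ℝ) < -1 := by linarith
  have hpi := Real.pi_pos
  have h1 := integral_Ioi_rpow_of_lt hlt ha
  have hi := (integrableOn_Ioi_rpow_of_lt hlt ha).const_mul (Real.pi ^ n)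
  have h2 : ∫⁻ t in Set.Ioi a, ENNReal.ofReal ((Real.pi / t) ^ n) =
      ∫⁻ t in Set.Ioi a, ENNReal.ofReal (Real.pi ^ n * t ^ (-(n : ℝ))) := by
    refine setLIntegral_congr_fun measurableSet_Ioi fun t ht => ?_
    have ht' : 0 < t := ha.trans ht
    rw [Real.rpow_neg ht'.le, Real.rpow_natCast, div_pow, div_eq_mul_inv]
  rw [h2, ← ofReal_integral_eq_lintegral_ofReal hi, integral_const_mul, h1]
  · congr 2
    have e : a ^ (-(n : ℝ) + 1) = a⁻¹ ^ (n - 1) := by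
      rw [show -(n : ℝ) + 1 = -((n - 1 : ℕ) : ℝ) by rw [Nat.cast_sub (by omega)]; push_cast; ring,
        Real.rpow_neg ha.le, Real.rpow_natCast, inv_pow]
    rw [e, show -(n : ℝ) + 1 = -((n : ℝ) - 1) by ring, neg_div_neg_eq]
  · rw [EventuallyLE, ae_restrict_iff' measurableSet_Ioi]
    exact ae_of_all _ fun t ht => by
      have ht' : 0 < t := ha.trans ht
      simp only [Pi.zero_apply]; positivity

variable {N : ℕ}

lemma sqNorm_pos {ι : Type*} [Fintype ι] {y : ι → ℂ} (hy : y ≠ 0) : 0 < sqNorm y := by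
  refine (sqNorm_nonneg y).lt_of_ne' fun h => hy ?_
  ext i
  have := (Finset.sum_eq_zero_iff_of_nonneg fun i _ => by positivity).1 h i (Finset.mem_univ i)
  simpa using this

lemma ae_sqNorm_pos (hN : 0 < N) : ∀ᵐ y : Fin N → ℂ, 0 < sqNorm y := by
  have : Nonempty (Fin N) := ⟨⟨0, hN⟩⟩
  have h : ∀ᵐ y : Fin N → ℂ, y ≠ 0 := by
    rw [ae_iff]; simp
  exact h.mono fun y hy => sqNorm_pos hy

/-- Since `S⁻¹ exp (-a S) = ∫_{t > a} exp (-t S) dt`, Tonelli reduces the integral to that of `(π /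
t)^N` over `t > a`, which converges because `N ≥ 2`. This replaces polar coordinates. -/
lemma lintegral_inv_sqNorm_mul_exp (hN : 2 ≤ N) {a : ℝ} (ha : 0 < a) :
    ∫⁻ y : Fin N → ℂ, ENNReal.ofReal ((sqNorm y)⁻¹ * Real.exp (-(a * sqNorm y))) =
      ENNReal.ofReal (Real.pi ^ N * (a⁻¹ ^ (N - 1) / (N - 1))) := by
  rw [← lintegral_Ioi_inv_pow ha hN]
  calc _ = ∫⁻ y : Fin N → ℂ, ∫⁻ t in Set.Ioi a, ENNReal.ofReal (Real.exp (-t * sqNorm y)) :=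
        lintegral_congr_ae ((ae_sqNorm_pos (by omega)).mono fun y hy =>
          (lintegral_Ioi_exp_neg_mul hy).symm)
    _ = ∫⁻ t in Set.Ioi a, ∫⁻ y : Fin N → ℂ, ENNReal.ofReal (Real.exp (-t * sqNorm y)) := by
        refine lintegral_lintegral_swap (Measurable.aemeasurable ?_)
        unfold Function.uncurry
        fun_prop
    _ = _ := by
        refine setLIntegral_congr_fun measurableSet_Ioi fun t ht => ?_
        rw [lintegral_exp_neg_mul_sqNorm (ha.trans ht), Fintype.card_fin]

variable {F G : Matrix (Fin N) (Fin N) ℂ} {σ : ℝ} {μ : Measure (Fin N → ℂ)}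
  [IsProbabilityMeasure μ]

lemma ae_sqNorm_output_pos (hN : 0 < N) (hσ : 0 < σ) :
    ∀ᵐ p ∂(jointLaw F G σ μ), 0 < sqNorm p.2 := by
  have h : ∀ᵐ y ∂(jointLaw F G σ μ).snd, 0 < sqNorm y := by
    rw [jointLaw_snd hσ]
    exact (withDensity_absolutelyContinuous _ _).ae_le (ae_sqNorm_pos hN)
  exact ae_of_ae_map measurable_snd.aemeasurable h

/-- The output density is bounded and `‖y‖⁻²` is locally integrable in real dimension `2N ≥ 4`. It
is needed to control `log ‖y‖²` near the origin. -/
lemma integrable_inv_sqNorm_output (hN : 2 ≤ N) (hσ : 0 < σ) :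
    Integrable (fun p => (sqNorm p.2)⁻¹) (jointLaw F G σ μ) := by
  refine ⟨Measurable.aestronglyMeasurable (by fun_prop), ?_⟩
  rw [hasFiniteIntegral_iff_ofReal (ae_of_all _ fun p => inv_nonneg.2 (sqNorm_nonneg _))]
  have hm : Measurable fun y : Fin N → ℂ => ENNReal.ofReal (sqNorm y)⁻¹ := by fun_prop
  have e : ∫⁻ p, ENNReal.ofReal (sqNorm p.2)⁻¹ ∂(jointLaw F G σ μ) =
      ∫⁻ y, ENNReal.ofReal (sqNorm y)⁻¹ ∂(jointLaw F G σ μ).snd := by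
    rw [Measure.snd, lintegral_map hm measurable_snd]
  rw [e]
  calc _ ≤ ∫⁻ y, (1 + ENNReal.ofReal (Real.exp 1 * ((sqNorm y)⁻¹ * Real.exp (-(1 * sqNorm y)))))
        ∂(jointLaw F G σ μ).snd := by
        refine lintegral_mono fun y => ?_
        have h0 := sqNorm_nonneg y
        rw [← ENNReal.ofReal_one, ← ENNReal.ofReal_add zero_le_one (by positivity)]
        refine ENNReal.ofReal_le_ofReal ?_
        rcases le_total (sqNorm y) 1 with h1 | h1
        · have : 1 ≤ Real.exp 1 * Real.exp (-(1 * sqNorm y)) := by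
            rw [← Real.exp_add]; exact Real.one_le_exp (by linarith)
          nlinarith [mul_le_mul_of_nonneg_left this (inv_nonneg.2 h0)]
        · have : (sqNorm y)⁻¹ ≤ 1 := inv_le_one_of_one_le₀ h1
          have : 0 ≤ Real.exp 1 * ((sqNorm y)⁻¹ * Real.exp (-(1 * sqNorm y))) := by positivity
          linarith
    _ = 1 + ∫⁻ y, outDens F G σ μ y *
        ENNReal.ofReal (Real.exp 1 * ((sqNorm y)⁻¹ * Real.exp (-(1 * sqNorm y)))) := by
        rw [lintegral_add_left measurable_const, lintegral_const, measure_univ, mul_one,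
          jointLaw_snd hσ, lintegral_withDensity_eq_lintegral_mul _ (measurable_outDens μ)
          (by fun_prop)]
        rfl
    _ ≤ 1 + ∫⁻ y : Fin N → ℂ, ENNReal.ofReal (Real.pi ^ N)⁻¹ *
        (ENNReal.ofReal (Real.exp 1) *
          ENNReal.ofReal ((sqNorm y)⁻¹ * Real.exp (-(1 * sqNorm y)))) := by
        gcongr with y
        · exact outDens_le μ y
        · rw [ENNReal.ofReal_mul (Real.exp_pos 1).le]
    _ < ⊤ := by
        rw [lintegral_const_mul _ (by fun_prop), lintegral_const_mul _ (by fun_prop),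
          lintegral_inv_sqNorm_mul_exp hN one_pos]
        finiteness

lemma integrable_log_sqNorm_output (h2 : Integrable sqNorm μ) (hN : 2 ≤ N) (hσ : 0 < σ) :
    Integrable (fun p => Real.log (sqNorm p.2)) (jointLaw F G σ μ) := by
  refine ((integrable_inv_sqNorm_output hN hσ).add
    (hasIntegral_sqNorm_output (F := F) (G := G) (σ := σ) h2).1).mono'
    (Measurable.aestronglyMeasurable (by fun_prop)) ?_
  filter_upwards [ae_sqNorm_output_pos (F := F) (G := G) (μ := μ) (by omega : 0 < N) hσ] with p hp
  have h1 := Real.log_le_sub_one_of_pos hp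
  have h3 := Real.log_le_sub_one_of_pos (inv_pos.2 hp)
  rw [Real.log_inv] at h3
  have := inv_pos.2 hp
  simp only [Pi.add_apply, Real.norm_eq_abs]
  rw [abs_le]
  constructor <;> linarith

/-- Dividing by the conditional mean makes the ratio have mean one. The inequality `log t ≤ t - 1`
for this ratio then gives `E log ‖y‖² ≤ E log γ(x)`. -/
lemma hasIntegral_sqNorm_div_gam (hN : 0 < N) :
    Integrable (fun p => sqNorm p.2 / gam F G σ 1 p.1) (jointLaw F G σ μ) ∧
      ∫ p, sqNorm p.2 / gam F G σ 1 p.1 ∂(jointLaw F G σ μ) = 1 := by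
  have hg : Measurable (gam F G σ 1) := by
    have h : gam F G σ 1 = fun x => N + sqNorm (F *ᵥ x) + σ ^ 2 * sqNorm (G *ᵥ x) :=
      funext gam_one
    rw [h]; fun_prop
  have hm : Measurable fun p : (Fin N → ℂ) × (Fin N → ℂ) => sqNorm p.2 / gam F G σ 1 p.1 :=
    (measurable_sqNorm.comp measurable_snd).div (hg.comp measurable_fst)
  refine hasIntegral_of_lintegral hm
    (fun p => div_nonneg (sqNorm_nonneg _) (gam_one_pos hN _).le) zero_le_one ?_
  rw [lintegral_jointLaw μ hm.ennreal_ofReal]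
  have h : ∀ x, ∫⁻ s, ∫⁻ z, ENNReal.ofReal (sqNorm ((F + s • G) *ᵥ x + z) / gam F G σ 1 x)
      ∂(cnStd (Fin N)) ∂(cn (σ ^ 2)) = 1 := by
    intro x
    have hx := gam_one_pos (F := F) (G := G) (σ := σ) hN x
    simp_rw [ENNReal.ofReal_div_of_pos hx, div_eq_mul_inv]
    simp_rw [fun s : ℂ => lintegral_mul_const' (μ := cnStd (Fin N)) (ENNReal.ofReal (gam F G σ 1 x))⁻¹
      (fun z => ENNReal.ofReal (sqNorm ((F + s • G) *ᵥ x + z)))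
      (ENNReal.inv_ne_top.2 (ENNReal.ofReal_pos.2 hx).ne')]
    rw [lintegral_mul_const' _ _ (ENNReal.inv_ne_top.2 (ENNReal.ofReal_pos.2 hx).ne'),
      lintegral_sqNorm_output]
    exact ENNReal.mul_inv_cancel (ENNReal.ofReal_pos.2 hx).ne' ENNReal.ofReal_ne_top
  simp only [h]
  simp

/-- The duality bound for a general input law of finite power. -/
theorem mutualInfo_le_duality (h2 : Integrable sqNorm μ) (hN : 2 ≤ N) (hσ : 0 < σ) {M : ℝ}
    (hM : ∀ᵐ x ∂μ, Real.log (gam F G σ 1 x / (1 + σ ^ 2 * sqNorm (G *ᵥ x))) ≤ M) :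
    (mutualInfo F G σ μ : EReal) ≤
      ((((N : ℝ) - 1) * Real.log ((∫ x, gam F G σ 1 x ∂μ) / ((N : ℝ) - 1)) +
        Real.log (1 / ((N : ℝ) - 1)) - 1 + M : ℝ) : EReal) := by
  have hN0 : 0 < N := by omega
  have hN1 : (0 : ℝ) < (N : ℝ) - 1 := by
    have : (2 : ℝ) ≤ N := by exact_mod_cast hN
    linarith
  have hpi := Real.pi_pos
  set m := ∫ x, gam F G σ 1 x ∂μ with hm
  have hgi := integrable_gam_one (F := F) (G := G) (σ := σ) h2
  have hg1 : ∀ x, 1 ≤ gam F G σ 1 x := fun x => by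
    rw [gam_one]
    have := sqNorm_nonneg (F *ᵥ x)
    have := sqNorm_nonneg (G *ᵥ x)
    have : (1 : ℝ) ≤ N := by linarith
    have : 0 ≤ σ ^ 2 * sqNorm (G *ᵥ x) := by positivity
    linarith
  have hmpos : 0 < m := by
    have : ∫ _, (1 : ℝ) ∂μ ≤ m := integral_mono (integrable_const _) hgi hg1
    simp at this
    linarith
  -- The auxiliary density is the case `α = N - 1` of `‖y‖^(2(α - N)) exp (-‖y‖²/β)`. This `β` gives
  -- `‖y‖²/β` the mean `N - 1`; against the `N` of the conditional entropy it leaves the `-1` of the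
  -- bound.
  set β := m / ((N : ℝ) - 1) with hβ
  have hβpos : 0 < β := div_pos hmpos hN1
  set cst := ((N : ℝ) - 1) / (Real.pi ^ N * β ^ (N - 1)) with hcst
  have hcpos : 0 < cst := by positivity
  have hlogc : Real.log cst = Real.log ((N : ℝ) - 1) - N * Real.log Real.pi -
      ((N : ℝ) - 1) * Real.log β := by
    rw [hcst, Real.log_div hN1.ne' (by positivity), Real.log_mul (by positivity) (by positivity),
      Real.log_pow, Real.log_pow, Nat.cast_sub (by omega)]
    push_cast; ring
  set q : (Fin N → ℂ) → ℝ := fun y =>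
    cst * ((sqNorm y)⁻¹ * Real.exp (-(β⁻¹ * sqNorm y))) with hq
  have hqm : Measurable q := by rw [hq]; fun_prop
  have hlogq : ∀ y, 0 < sqNorm y → Real.log (q y) =
      Real.log cst - Real.log (sqNorm y) - β⁻¹ * sqNorm y := fun y hy => by
    rw [hq]
    simp only
    rw [Real.log_mul hcpos.ne' (by positivity), Real.log_mul (by positivity) (by positivity),
      Real.log_inv, Real.log_exp]
    ring
  have hae := ae_sqNorm_output_pos (F := F) (G := G) (μ := μ) hN0 hσ
  obtain ⟨iS, eS⟩ := hasIntegral_sqNorm_output (F := F) (G := G) (σ := σ) h2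
  have il := integrable_log_sqNorm_output (F := F) (G := G) (σ := σ) h2 hN hσ
  obtain ⟨iR, eR⟩ := hasIntegral_sqNorm_div_gam (F := F) (G := G) (σ := σ) (μ := μ) hN0
  have mp := measurePreserving_fst_jointLaw (F := F) (G := G) (σ := σ) (μ := μ)
  have iγ : Integrable (fun x => Real.log (gam F G σ 1 x)) μ := by
    refine hgi.mono' (hgi.1.aemeasurable.log.aestronglyMeasurable) (ae_of_all _ fun x => ?_)
    rw [Real.norm_of_nonneg (Real.log_nonneg (hg1 x))]
    have := Real.log_le_sub_one_of_pos (one_pos.trans_le (hg1 x))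
    linarith
  have iγ' : Integrable (fun p : (Fin N → ℂ) × (Fin N → ℂ) => Real.log (gam F G σ 1 p.1))
      (jointLaw F G σ μ) := mp.integrable_comp_of_integrable iγ
  have eγ : ∫ p : (Fin N → ℂ) × (Fin N → ℂ), Real.log (gam F G σ 1 p.1) ∂(jointLaw F G σ μ) =
      ∫ x, Real.log (gam F G σ 1 x) ∂μ := by
    have := integral_map (μ := jointLaw F G σ μ) (φ := Prod.fst) measurable_fst.aemeasurable
      (f := fun x => Real.log (gam F G σ 1 x)) (by rw [mp.map_eq]; exact iγ.1)
    rw [mp.map_eq] at this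
    exact this.symm
  have hqi : Integrable (fun p => Real.log (q p.2)) (jointLaw F G σ μ) :=
    (((integrable_const (Real.log cst)).sub il).sub (iS.const_mul β⁻¹)).congr
      (hae.mono fun p hp => (hlogq _ hp).symm)
  have hq1 : ∫⁻ y, ENNReal.ofReal (q y) ≤ 1 := by
    simp_rw [hq, ENNReal.ofReal_mul hcpos.le]
    rw [lintegral_const_mul' _ _ ENNReal.ofReal_ne_top,
      lintegral_inv_sqNorm_mul_exp hN (inv_pos.2 hβpos), ← ENNReal.ofReal_mul hcpos.le, inv_inv]
    refine le_of_eq ?_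
    rw [← ENNReal.ofReal_one]
    congr 1
    rw [hcst]
    field_simp
  refine (mutualInfo_le_of_density h2 hσ hqm
    ((ae_sqNorm_pos hN0).mono fun y hy => by rw [hq]; positivity) hq1 hqi).trans
    (EReal.coe_le_coe_iff.2 ?_)
  -- Pointwise, `log ‖y‖² ≤ log γ(x) + ‖y‖²/γ(x) - 1`, and the last two terms cancel in the mean.
  have hlow : Real.log cst - (∫ x, Real.log (gam F G σ 1 x) ∂μ) - ((N : ℝ) - 1) ≤
      ∫ p, Real.log (q p.2) ∂(jointLaw F G σ μ) := by
    have i1 := (integrable_const (μ := jointLaw F G σ μ) (Real.log cst + 1)).sub iγ'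
    simp only [Pi.sub_def] at i1
    have i2 := i1.sub iR
    simp only [Pi.sub_def] at i2
    have i3 := iS.const_mul β⁻¹
    have e : ∫ p, (Real.log cst + 1 - Real.log (gam F G σ 1 p.1) -
        sqNorm p.2 / gam F G σ 1 p.1 - β⁻¹ * sqNorm p.2) ∂(jointLaw F G σ μ) =
        Real.log cst - (∫ x, Real.log (gam F G σ 1 x) ∂μ) - ((N : ℝ) - 1) := by
      rw [integral_sub i2 i3, integral_sub i1 iR, integral_sub (integrable_const _) iγ', eγ, eR,
        integral_const_mul, eS, ← hm, hβ]
      have : (m / ((N : ℝ) - 1))⁻¹ * m = (N : ℝ) - 1 := by field_simp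
      rw [this]
      simp
      ring
    rw [← e]
    refine integral_mono_ae (i2.sub i3) hqi (hae.mono fun p hp => ?_)
    have hgp := one_pos.trans_le (hg1 p.1)
    have h3 := Real.log_le_sub_one_of_pos (div_pos hp hgp)
    rw [Real.log_div hp.ne' hgp.ne'] at h3
    beta_reduce
    rw [hlogq _ hp]
    linarith
  -- Here the fading penalty absorbs the singular factor: only the logarithm of their ratio remains,
  -- bounded by `M`.
  have hMint : (∫ x, Real.log (gam F G σ 1 x) ∂μ) -
      (∫ x, Real.log (1 + σ ^ 2 * sqNorm (G *ᵥ x)) ∂μ) ≤ M := by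
    have i4 := integrable_log_fading (G := G) (σ := σ) h2
    rw [← integral_sub iγ i4]
    have : ∫ _, M ∂μ = M := by simp
    rw [← this]
    refine integral_mono_ae (iγ.sub i4) (integrable_const _) (hM.mono fun x hx => ?_)
    have h3 : 0 ≤ σ ^ 2 * sqNorm (G *ᵥ x) := mul_nonneg (sq_nonneg _) (sqNorm_nonneg _)
    rw [Real.log_div (one_pos.trans_le (hg1 x)).ne' (by positivity)] at hx
    exact hx
  rw [(hasIntegral_log_trans h2 hσ).2, one_div, Real.log_inv]
  rw [hlogc] at hlow
  linarith

end
end RankOneChannel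
namespace RankOneChannel
noncomputable section

/-! ### Capacity bounds from duality -/

variable {N : ℕ} {F G : Matrix (Fin N) (Fin N) ℂ} {σ : ℝ} {μ : Measure (Fin N → ℂ)}

lemma IsInput.integrable {P : ℝ} (h : IsInput P μ) : Integrable sqNorm μ := by
  refine ⟨by fun_prop, ?_⟩
  rw [hasFiniteIntegral_iff_ofReal (ae_of_all _ sqNorm_nonneg)]
  exact h.2.trans_lt ENNReal.ofReal_lt_top

lemma IsInput.integral_le {P : ℝ} (hP : 0 ≤ P) (h : IsInput P μ) : ∫ x, sqNorm x ∂μ ≤ P := by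
  rw [integral_eq_lintegral_of_nonneg_ae (ae_of_all _ sqNorm_nonneg) (by fun_prop)]
  exact ENNReal.toReal_le_of_le_ofReal hP h.2

/-- The second-moment matrix `E[x xᴴ]` of an input law. -/
def inputCov (μ : Measure (Fin N → ℂ)) : Matrix (Fin N) (Fin N) ℂ :=
  Matrix.of fun i j => ∫ x, x i * star (x j) ∂μ

lemma norm_sq_le_sqNorm (x : Fin N → ℂ) (i : Fin N) : ‖x i‖ ^ 2 ≤ sqNorm x :=
  Finset.single_le_sum (f := fun i => ‖x i‖ ^ 2) (fun _ _ => by positivity) (Finset.mem_univ i)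

lemma integrable_mul_star (h2 : Integrable sqNorm μ) (i j : Fin N) :
    Integrable (fun x => x i * star (x j)) μ := by
  refine h2.mono' (Measurable.aestronglyMeasurable (by fun_prop)) (ae_of_all _ fun x => ?_)
  have h1 := norm_sq_le_sqNorm x i
  have h3 := norm_sq_le_sqNorm x j
  rw [norm_mul, norm_star]
  nlinarith [sq_nonneg (‖x i‖ - ‖x j‖)]

lemma inputCov_form (h2 : Integrable sqNorm μ) (v : Fin N → ℂ) :
    star v ⬝ᵥ inputCov μ *ᵥ v = ((∫ x, ‖star v ⬝ᵥ x‖ ^ 2 ∂μ : ℝ) : ℂ) := by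
  have e : ∀ x : Fin N → ℂ, ((‖star v ⬝ᵥ x‖ ^ 2 : ℝ) : ℂ) =
      ∑ i, ∑ j, star (v i) * v j * (x i * star (x j)) := by
    intro x
    push_cast
    rw [← Complex.mul_conj']
    simp only [dotProduct, map_sum, Finset.sum_mul_sum, Pi.star_apply, map_mul, RCLike.star_def,
      Complex.conj_conj]
    exact Finset.sum_congr rfl fun i _ => Finset.sum_congr rfl fun j _ => by ring
  rw [← integral_complex_ofReal]
  simp_rw [e]
  rw [integral_finsetSum _ fun i _ => integrable_finsetSum _ fun j _ =>
    (integrable_mul_star h2 i j).const_mul (star (v i) * v j)]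
  simp only [dotProduct, mulVec, Finset.mul_sum, Pi.star_apply]
  refine Finset.sum_congr rfl fun i _ => ?_
  rw [integral_finsetSum _ fun j _ => (integrable_mul_star h2 i j).const_mul (star (v i) * v j)]
  refine Finset.sum_congr rfl fun j _ => ?_
  rw [integral_const_mul, inputCov, of_apply]
  ring

lemma inputCov_posSemidef (h2 : Integrable sqNorm μ) : (inputCov μ).PosSemidef := by
  refine PosSemidef.of_dotProduct_mulVec_nonneg ?_ fun v => ?_
  · ext i j
    rw [conjTranspose_apply, inputCov, of_apply, of_apply, RCLike.star_def, ← integral_conj]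
    refine integral_congr_ae (ae_of_all _ fun x => ?_)
    simp [mul_comm]
  · rw [inputCov_form h2]
    exact_mod_cast integral_nonneg fun _ => by positivity

lemma trace_mul_inputCov_mul (h2 : Integrable sqNorm μ) (A : Matrix (Fin N) (Fin N) ℂ) :
    (A * inputCov μ * Aᴴ).trace.re = ∫ x, sqNorm (A *ᵥ x) ∂μ := by
  have e : ∀ i, (A * inputCov μ * Aᴴ) i i = ((∫ x, ‖(A *ᵥ x) i‖ ^ 2 ∂μ : ℝ) : ℂ) := by
    intro i
    have h := inputCov_form h2 (star (A i))
    rw [star_star] at h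
    change _ = ((∫ x, ‖(A *ᵥ x) i‖ ^ 2 ∂μ : ℝ) : ℂ) at h
    rw [← h, Matrix.mul_assoc, mul_apply]
    rfl
  have hint : ∀ i, Integrable (fun x => ‖(A *ᵥ x) i‖ ^ 2) μ := fun i => by
    refine (integrable_sqNorm_mulVec measurable_id h2 A).mono'
      (Measurable.aestronglyMeasurable ?_) (ae_of_all _ fun x => ?_)
    · exact ((measurable_pi_apply i).comp (measurable_mulVec A)).norm.pow_const 2
    · rw [Real.norm_of_nonneg (by positivity)]
      exact norm_sq_le_sqNorm _ i
  simp only [trace, diag_apply, e, sqNorm]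
  rw [integral_finsetSum _ fun i _ => hint i, ← Complex.ofReal_sum, Complex.ofReal_re]

lemma meanGam_one (Q : Matrix (Fin N) (Fin N) ℂ) :
    meanGam F G σ 1 Q = N + (F * Q * Fᴴ).trace.re + σ ^ 2 * (G * Q * Gᴴ).trace.re := by
  rw [meanGam, Matrix.one_mul, trace_add, trace_add, trace_one, trace_smul]
  simp only [Complex.add_re, smul_eq_mul, Complex.re_ofReal_mul, Fintype.card_fin,
    Complex.natCast_re]

/-- The duality bound sees the input law only through its second moments, so a supremum over laws
becomes one over covariances. -/
lemma meanGam_inputCov [IsProbabilityMeasure μ] (h2 : Integrable sqNorm μ) :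
    meanGam F G σ 1 (inputCov μ) = ∫ x, gam F G σ 1 x ∂μ := by
  have i1 := integrable_sqNorm_mulVec measurable_id h2 F
  have i2 := (integrable_sqNorm_mulVec measurable_id h2 G).const_mul (σ ^ 2)
  have i3 := (integrable_const (μ := μ) (N : ℝ)).add i1
  simp only [Pi.add_def, id] at i1 i2 i3
  rw [meanGam_one, trace_mul_inputCov_mul h2, trace_mul_inputCov_mul h2]
  simp_rw [gam_one]
  rw [integral_add i3 i2, integral_add (integrable_const _) i1, integral_const_mul]
  simp

lemma inputCov_mem_covSet {P : ℝ} (hP : 0 ≤ P) (h : IsInput P μ) : inputCov μ ∈ covSet N P := by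
  refine ⟨inputCov_posSemidef h.integrable, ?_⟩
  have := trace_mul_inputCov_mul h.integrable 1
  simp only [Matrix.one_mul, conjTranspose_one, Matrix.mul_one, one_mulVec] at this
  rw [this]
  exact h.integral_le hP

/-- The constant in the closed form of the duality bound. -/
def ratioBound (F G : Matrix (Fin N) (Fin N) ℂ) (σ : ℝ) : ℝ :=
  max (N : ℝ) (lambdaMax (1 + (((σ ^ 2)⁻¹ : ℝ) : ℂ) • ((Gᴴ * G)⁻¹ * (Fᴴ * F))))

/-- The spectrum is finite, so the supremum defining `lambdaMax` is bounded and exceeds each real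
eigenvalue. -/
lemma le_lambdaMax {A : Matrix (Fin N) (Fin N) ℂ} {t : ℝ} {v : Fin N → ℂ} (hv : v ≠ 0)
    (h : A *ᵥ v = (t : ℂ) • v) : t ≤ lambdaMax A := by
  refine le_csSup ?_ ?_
  · have hf : (spectrum ℂ A).Finite := Matrix.finite_spectrum A
    exact (hf.preimage Complex.ofReal_injective.injOn).bddAbove
  · rw [Set.mem_ofPred_eq, spectrum.mem_iff]
    intro hu
    refine hv (Matrix.eq_zero_of_mulVec_eq_zero ((isUnit_iff_isUnit_det _).1 hu).ne_zero ?_)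
    rw [sub_mulVec, h, Algebra.algebraMap_eq_smul_one, smul_mulVec, one_mulVec, sub_self]

lemma sqNorm_mulVec_unitary {W : Matrix (Fin N) (Fin N) ℂ} (hW : Wᴴ * W = 1) (v : Fin N → ℂ) :
    sqNorm (W *ᵥ v) = sqNorm v := by
  rw [← qf_one (W *ᵥ v), ← qf_conjTranspose_mul_mul, Matrix.mul_one, hW, qf_one]

/-- With `T = F G⁻¹`, `‖F x‖² = ‖T (G x)‖²` is diagonal in an eigenbasis of `Tᴴ T`. The matrix `(Gᴴ
G)⁻¹ Fᴴ F` need not be Hermitian, but it equals `G⁻¹ (Tᴴ T) G`, so `G⁻¹` carries eigenvectors of `Tᴴ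
T` to eigenvectors of it. -/
lemma sqNorm_mulVec_le_lambdaMax (hG : IsUnit G.det) (hσ : 0 < σ) (x : Fin N → ℂ) :
    sqNorm (F *ᵥ x) + σ ^ 2 * sqNorm (G *ᵥ x) ≤
      lambdaMax (1 + (((σ ^ 2)⁻¹ : ℝ) : ℂ) • ((Gᴴ * G)⁻¹ * (Fᴴ * F))) *
        (σ ^ 2 * sqNorm (G *ᵥ x)) := by
  set L := lambdaMax (1 + (((σ ^ 2)⁻¹ : ℝ) : ℂ) • ((Gᴴ * G)⁻¹ * (Fᴴ * F)))
  obtain ⟨W, d, hW, hd, hT⟩ := exists_diagonalization (F * G⁻¹)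
  have hW' : Wᴴ * W = 1 := mul_eq_one_comm.1 hW
  have hGG : G⁻¹ * G = 1 := nonsing_inv_mul _ hG
  have hGG' : G * G⁻¹ = 1 := mul_nonsing_inv _ hG
  have hL : ∀ i, 1 + (σ ^ 2)⁻¹ * d i ≤ L := by
    intro i
    have hcol : (F * G⁻¹)ᴴ * (F * G⁻¹) * W = W * diagonal fun i => (d i : ℂ) := by
      rw [← hT]
      calc _ = (W * Wᴴ) * ((F * G⁻¹)ᴴ * (F * G⁻¹) * W) := by rw [hW, Matrix.one_mul]
        _ = _ := by simp only [conjTranspose_mul, Matrix.mul_assoc]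
    set w : Fin N → ℂ := W *ᵥ Pi.single i 1 with hw
    have hw0 : w ≠ 0 := by
      intro h0
      have h1 := sqNorm_mulVec_unitary hW' (Pi.single i (1 : ℂ))
      rw [← hw, h0, sqNorm_zero] at h1
      have h3 : ‖(Pi.single i (1 : ℂ) : Fin N → ℂ) i‖ ^ 2 ≤ sqNorm (Pi.single i (1 : ℂ)) :=
        norm_sq_le_sqNorm _ i
      rw [← h1] at h3
      simp at h3
      linarith
    have hev : ((F * G⁻¹)ᴴ * (F * G⁻¹)) *ᵥ w = (d i : ℂ) • w := by
      rw [hw, mulVec_mulVec, hcol, ← mulVec_mulVec]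
      have : (diagonal fun i => (d i : ℂ)) *ᵥ Pi.single i 1 = (d i : ℂ) • Pi.single i 1 := by
        ext j
        by_cases h : j = i
        · subst h; simp [mulVec_diagonal]
        · simp [mulVec_diagonal, h]
      rw [this, mulVec_smul]
    refine le_lambdaMax (v := G⁻¹ *ᵥ w) ?_ ?_
    · intro h0
      have : G *ᵥ G⁻¹ *ᵥ w = 0 := by rw [h0, mulVec_zero]
      rw [mulVec_mulVec, hGG', one_mulVec] at this
      exact hw0 this
    · have hkey : ((Gᴴ * G)⁻¹ * (Fᴴ * F)) *ᵥ G⁻¹ *ᵥ w = (d i : ℂ) • G⁻¹ *ᵥ w := by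
        clear_value w
        rw [← mulVec_smul, ← hev, Matrix.mul_inv_rev, conjTranspose_mul,
          conjTranspose_nonsing_inv]
        simp only [← mulVec_mulVec]
      rw [add_mulVec, one_mulVec, smul_mulVec, hkey]
      push_cast
      module
  have hx : F *ᵥ x = (F * G⁻¹ * W) *ᵥ (Wᴴ *ᵥ (G *ᵥ x)) := by
    simp only [mulVec_mulVec]
    congr 1
    calc F = F * (G⁻¹ * ((W * Wᴴ) * G)) := by rw [hW, Matrix.one_mul, hGG, Matrix.mul_one]
      _ = _ := by simp only [Matrix.mul_assoc]
  set u := Wᴴ *ᵥ (G *ᵥ x) with hu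
  have hu2 : sqNorm u = sqNorm (G *ᵥ x) :=
    sqNorm_mulVec_unitary (by rw [conjTranspose_conjTranspose, hW]) _
  have hFx : sqNorm (F *ᵥ x) = ∑ i, d i * ‖u i‖ ^ 2 := by
    rw [hx, ← qf_one, ← qf_conjTranspose_mul_mul, Matrix.mul_one, hT, qf]
    simp only [dotProduct, mulVec_diagonal, Complex.re_sum, Pi.star_apply]
    refine Finset.sum_congr rfl fun i _ => ?_
    have : star (u i) * ((d i : ℂ) * u i) = ((d i * ‖u i‖ ^ 2 : ℝ) : ℂ) := by
      push_cast
      rw [← Complex.conj_mul', RCLike.star_def]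
      ring
    rw [this, Complex.ofReal_re]
  rw [hFx, ← hu2, sqNorm, Finset.mul_sum, Finset.mul_sum, ← Finset.sum_add_distrib]
  refine Finset.sum_le_sum fun i _ => ?_
  have h1 := mul_le_mul_of_nonneg_right (hL i) (show 0 ≤ σ ^ 2 * ‖u i‖ ^ 2 by positivity)
  have h3 : (1 + (σ ^ 2)⁻¹ * d i) * (σ ^ 2 * ‖u i‖ ^ 2) = d i * ‖u i‖ ^ 2 + σ ^ 2 * ‖u i‖ ^ 2 := by
    field_simp
    ring
  rw [h3] at h1
  exact h1

/-- The ratio has the form `(N + a)/(1 + b)` with `a ≤ λ b`, which is at most `max N λ`. -/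
lemma gam_div_le_ratioBound (hG : IsUnit G.det) (hσ : 0 < σ) (x : Fin N → ℂ) :
    gam F G σ 1 x / (1 + σ ^ 2 * sqNorm (G *ᵥ x)) ≤ ratioBound F G σ := by
  have h1 := sqNorm_mulVec_le_lambdaMax (F := F) hG hσ x
  have h3 : 0 ≤ σ ^ 2 * sqNorm (G *ᵥ x) := mul_nonneg (sq_nonneg _) (sqNorm_nonneg _)
  have h4 : (N : ℝ) ≤ ratioBound F G σ := le_max_left _ _
  have h5 := mul_le_mul_of_nonneg_right (le_max_right (N : ℝ) (lambdaMax
    (1 + (((σ ^ 2)⁻¹ : ℝ) : ℂ) • ((Gᴴ * G)⁻¹ * (Fᴴ * F))))) h3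
  change _ ≤ ratioBound F G σ * _ at h5
  rw [div_le_iff₀ (by positivity), gam_one]
  linarith

lemma log_gam_div_le (hN : 0 < N) (hG : IsUnit G.det) (hσ : 0 < σ) (x : Fin N → ℂ) :
    Real.log (gam F G σ 1 x / (1 + σ ^ 2 * sqNorm (G *ᵥ x))) ≤ Real.log (ratioBound F G σ) := by
  have h3 : 0 ≤ σ ^ 2 * sqNorm (G *ᵥ x) := mul_nonneg (sq_nonneg _) (sqNorm_nonneg _)
  exact Real.log_le_log (div_pos (gam_one_pos hN x) (by positivity)) (gam_div_le_ratioBound hG hσ x)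

/-- The supremum in the duality bound for `α = N - 1`, `S = 1`. -/
def ballSup (F G : Matrix (Fin N) (Fin N) ℂ) (σ r : ℝ) : ℝ :=
  sSup ((fun x => Real.log (gam F G σ 1 x / (1 + σ ^ 2 * sqNorm (G *ᵥ x)))) ''
    {x | sqNorm x ≤ r ^ 2})

lemma le_ballSup (hN : 0 < N) (hG : IsUnit G.det) (hσ : 0 < σ) {r : ℝ} {x : Fin N → ℂ}
    (hx : sqNorm x ≤ r ^ 2) :
    Real.log (gam F G σ 1 x / (1 + σ ^ 2 * sqNorm (G *ᵥ x))) ≤ ballSup F G σ r := by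
  refine le_csSup ⟨Real.log (ratioBound F G σ), ?_⟩ (Set.mem_image_of_mem _ hx)
  rintro _ ⟨y, _, rfl⟩
  exact log_gam_div_le hN hG hσ y

lemma ballSup_le (hN : 0 < N) (hG : IsUnit G.det) (hσ : 0 < σ) (r : ℝ) :
    ballSup F G σ r ≤ Real.log (ratioBound F G σ) := by
  refine csSup_le ⟨_, Set.mem_image_of_mem _ (show sqNorm (0 : Fin N → ℂ) ≤ r ^ 2 by
    rw [sqNorm_zero]; positivity)⟩ ?_
  rintro _ ⟨y, _, rfl⟩
  exact log_gam_div_le hN hG hσ y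

/-- The point `x = 0` lies in every ball and contributes `log N ≥ 0`, which makes lower bounds
uniform in `r`. -/
lemma ballSup_nonneg (hN : 0 < N) (hG : IsUnit G.det) (hσ : 0 < σ) (r : ℝ) :
    0 ≤ ballSup F G σ r := by
  refine le_trans ?_ (le_ballSup hN hG hσ (x := 0) (r := r) (by rw [sqNorm_zero]; positivity))
  rw [gam_one]
  simp only [mulVec_zero, sqNorm_zero, mul_zero, add_zero, div_one]
  exact Real.log_natCast_nonneg N

/-- At `α = N - 1` the power of `γ` is `1`, the Gamma quotient is `1/(N - 1)` and `α - N = -1`; at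
`S = I` the determinant term vanishes. -/
lemma dualityBound_eq (hN : 2 ≤ N) (r : ℝ) (Q : Matrix (Fin N) (Fin N) ℂ) :
    dualityBound F G σ r ((N : ℝ) - 1) 1 Q =
      ((N : ℝ) - 1) * Real.log (meanGam F G σ 1 Q / ((N : ℝ) - 1)) +
        Real.log (1 / ((N : ℝ) - 1)) - 1 + ballSup F G σ r := by
  have hN1 : (0 : ℝ) < (N : ℝ) - 1 := by
    have : (2 : ℝ) ≤ N := by exact_mod_cast hN
    linarith
  have hΓ : Real.Gamma ((N : ℝ) - 1) / Real.Gamma N = 1 / ((N : ℝ) - 1) := by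
    have h := Real.Gamma_add_one hN1.ne'
    rw [sub_add_cancel] at h
    rw [h]
    have := (Real.Gamma_pos_of_pos hN1).ne'
    field_simp
  rw [dualityBound, hΓ, det_one, Complex.one_re, Real.log_one]
  have e : (N : ℝ) - ((N : ℝ) - 1) = 1 := by ring
  simp only [e, Real.rpow_one]
  rw [ballSup]
  ring

lemma closedBound_eq (Q : Matrix (Fin N) (Fin N) ℂ) :
    closedBound F G σ Q =
      ((N : ℝ) - 1) * Real.log (meanGam F G σ 1 Q / ((N : ℝ) - 1)) +
        Real.log (1 / ((N : ℝ) - 1)) - 1 + Real.log (ratioBound F G σ) := by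
  rw [closedBound, ratioBound, one_div_mul_eq_div]

theorem dualityBound_le_closedBound (hN : 2 ≤ N) (hG : IsUnit G.det) (hσ : 0 < σ) (r : ℝ)
    (Q : Matrix (Fin N) (Fin N) ℂ) :
    dualityBound F G σ r ((N : ℝ) - 1) 1 Q ≤ closedBound F G σ Q := by
  rw [dualityBound_eq hN, closedBound_eq]
  have := ballSup_le (F := F) (by omega : 0 < N) hG hσ r
  linarith

/-- Passing through `EReal.toENNReal` needs a nonnegative bound; in the applications the zero input,
whose information is nonnegative, supplies this. -/
lemma coe_iSup_le {ι : Sort*} {f : ι → ℝ≥0∞} {b : EReal} (hb : 0 ≤ b)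
    (h : ∀ i, (f i : EReal) ≤ b) : ((⨆ i, f i : ℝ≥0∞) : EReal) ≤ b := by
  rw [← EReal.coe_toENNReal hb, EReal.coe_ennreal_le_coe_ennreal_iff]
  refine iSup_le fun i => ?_
  rw [← EReal.coe_ennreal_le_coe_ennreal_iff, EReal.coe_toENNReal hb]
  exact h i

lemma isInput_dirac_zero {P : ℝ} : IsInput P (Measure.dirac (0 : Fin N → ℂ)) :=
  ⟨inferInstance, by simp⟩

theorem peakCapacity_le (hN : 2 ≤ N) (hG : IsUnit G.det) (hσ : 0 < σ) {P : ℝ} (hP : 0 < P)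
    (r : ℝ) : (peakCapacity F G σ P r : EReal) ≤
      ⨆ Q : covSet N P, ((dualityBound F G σ r ((N : ℝ) - 1) 1 Q.1 : ℝ) : EReal) := by
  have h : ∀ μ : {μ : Measure (Fin N → ℂ) // IsInput P μ ∧ ∀ᵐ x ∂μ, sqNorm x ≤ r ^ 2},
      (mutualInfo F G σ μ.1 : EReal) ≤
        ⨆ Q : covSet N P, ((dualityBound F G σ r ((N : ℝ) - 1) 1 Q.1 : ℝ) : EReal) := by
    rintro ⟨μ, hμ, hr⟩
    have := hμ.1
    refine le_trans ?_ (le_iSup _ ⟨inputCov μ, inputCov_mem_covSet hP.le hμ⟩)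
    rw [dualityBound_eq hN, meanGam_inputCov hμ.integrable]
    exact mutualInfo_le_duality hμ.integrable hN hσ
      (hr.mono fun x hx => le_ballSup (by omega) hG hσ hx)
  refine coe_iSup_le (le_trans (EReal.coe_ennreal_nonneg _) (h ⟨Measure.dirac 0,
    isInput_dirac_zero, ?_⟩)) h
  rw [ae_dirac_eq]
  simpa using sq_nonneg r

theorem capacity_le (hN : 2 ≤ N) (hG : IsUnit G.det) (hσ : 0 < σ) {P : ℝ} (hP : 0 < P) :
    (capacity F G σ P : EReal) ≤ ⨆ Q : covSet N P, ((closedBound F G σ Q.1 : ℝ) : EReal) := by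
  have h : ∀ μ : {μ : Measure (Fin N → ℂ) // IsInput P μ}, (mutualInfo F G σ μ.1 : EReal) ≤
      ⨆ Q : covSet N P, ((closedBound F G σ Q.1 : ℝ) : EReal) := by
    rintro ⟨μ, hμ⟩
    have := hμ.1
    refine le_trans ?_ (le_iSup _ ⟨inputCov μ, inputCov_mem_covSet hP.le hμ⟩)
    rw [closedBound_eq, meanGam_inputCov hμ.integrable]
    exact mutualInfo_le_duality hμ.integrable hN hσ
      (ae_of_all _ fun x => log_gam_div_le (by omega) hG hσ x)
  exact coe_iSup_le (le_trans (EReal.coe_ennreal_nonneg _) (h ⟨Measure.dirac 0,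
    isInput_dirac_zero⟩)) h

end
end RankOneChannel
namespace RankOneChannel
noncomputable section

/-! ### Gaussian inputs -/

lemma sqrt_mul_conjTranspose_sqrt {ι : Type*} [Fintype ι] [DecidableEq ι] {Q : Matrix ι ι ℂ}
    (hQ : Q.PosSemidef) : CFC.sqrt Q * (CFC.sqrt Q)ᴴ = Q := by
  have h := (nonneg_iff_posSemidef.1 (CFC.sqrt_nonneg Q)).isHermitian
  rw [h.eq, CFC.sqrt_mul_sqrt_self Q (nonneg_iff_posSemidef.2 hQ)]

lemma re_trace_nonneg {ι : Type*} [Fintype ι] {Q : Matrix ι ι ℂ} (hQ : Q.PosSemidef) :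
    0 ≤ Q.trace.re := (Complex.le_def.1 hQ.trace_nonneg).1

lemma re_trace_mul_conjTranspose {ι κ : Type*} [Fintype ι] [Fintype κ] (K : Matrix ι κ ℂ) :
    (K * Kᴴ).trace.re = ∑ i, sqNorm (K i) := by
  simp only [trace, Complex.re_sum, diag_apply, mul_apply, conjTranspose_apply, sqNorm]
  refine Finset.sum_congr rfl fun i _ => Finset.sum_congr rfl fun j _ => ?_
  rw [RCLike.star_def, Complex.mul_conj']
  norm_cast

lemma hasIntegral_sqNorm_affine {ι κ : Type*} [Fintype ι] [Fintype κ] (A : Matrix ι κ ℂ)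
    (c : ι → ℂ) : Integrable (fun g => sqNorm (A *ᵥ g + c)) (cnStd κ) ∧
      ∫ g, sqNorm (A *ᵥ g + c) ∂(cnStd κ) = (A * Aᴴ).trace.re + sqNorm c := by
  classical
  have h := hasIntegral_qf_affine 1 A c
  simpa only [qf_one, Matrix.one_mul] using h

lemma integrable_norm_sq_cn {v : ℝ} (hv : 0 ≤ v) : Integrable (fun s => ‖s‖ ^ 2) (cn v) := by
  rw [cn_eq_map_cnStd hv, integrable_map_measure (by fun_prop)
    (Measurable.aemeasurable (by fun_prop))]
  refine ((integrable_norm_sq_cnStd ()).const_mul v).congr (ae_of_all _ fun g => ?_)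
  simp [mul_pow, Real.sq_sqrt hv]

lemma integrable_logDet_affine {ι κ : Type*} [Fintype ι] [Fintype κ] [DecidableEq ι]
    [DecidableEq κ] (A B : Matrix ι κ ℂ) {v : ℝ} (hv : 0 ≤ v) :
    Integrable (fun s : ℂ => logDet (A + s • B)) (cn v) := by
  have hc : Continuous fun s : ℂ => logDet (A + s • B) :=
    continuous_logDet (continuous_const.add (continuous_id.smul continuous_const))
  refine ((integrable_const (2 * (A * Aᴴ).trace.re)).add ((integrable_norm_sq_cn hv).mul_const
    (2 * (B * Bᴴ).trace.re))).mono' hc.aestronglyMeasurable (ae_of_all _ fun s => ?_)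
  rw [Real.norm_of_nonneg (logDet_nonneg _)]
  refine (logDet_le _).trans ?_
  simp only [re_trace_mul_conjTranspose, Finset.mul_sum, Pi.add_apply, ← Finset.sum_add_distrib]
  refine Finset.sum_le_sum fun i _ => ?_
  have h := sqNorm_add_le (A i) (s • B i)
  rw [sqNorm_smul] at h
  have e : (A + s • B) i = A i + s • B i := rfl
  rw [e]
  linarith

lemma lintegral_mulVec_add {ι κ : Type*} [Fintype ι] [Fintype κ] [DecidableEq ι]
    [DecidableEq κ] (K : Matrix ι κ ℂ) {h : (ι → ℂ) → ℝ≥0∞} (hh : Measurable h) :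
    ∫⁻ g, ∫⁻ z, h (K *ᵥ g + z) ∂(cnStd ι) ∂(cnStd κ) =
      ∫⁻ y, ENNReal.ofReal (gdens K y) * h y := by
  have hc : Continuous fun p : (κ → ℂ) × (ι → ℂ) => stdDens (p.2 - K *ᵥ p.1) :=
    continuous_stdDens.comp (continuous_snd.sub (Continuous.matrix_mulVec continuous_const
      continuous_fst))
  simp_rw [fun g => lintegral_add_cnStd (K *ᵥ g) hh]
  rw [lintegral_lintegral_swap]
  · refine lintegral_congr fun y => ?_
    have hy : Measurable fun g => ENNReal.ofReal (stdDens (y - K *ᵥ g)) :=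
      (hc.comp (continuous_id.prodMk continuous_const)).measurable.ennreal_ofReal
    rw [lintegral_mul_const _ hy, lintegral_stdDens_sub_mulVec]
  · exact (hc.measurable.ennreal_ofReal.mul (hh.comp measurable_snd)).aemeasurable

variable {N : ℕ} {F G : Matrix (Fin N) (Fin N) ℂ} {σ : ℝ}

lemma isInput_map_affine {κ : Type*} [Fintype κ] (A : Matrix (Fin N) κ ℂ) (c : Fin N → ℂ) {P : ℝ}
    (h : (A * Aᴴ).trace.re + sqNorm c ≤ P) :
    IsInput P ((cnStd κ).map fun g => A *ᵥ g + c) := by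
  have hm : Measurable fun g => A *ᵥ g + c := (measurable_mulVec A).add_const c
  refine ⟨Measure.isProbabilityMeasure_map hm.aemeasurable, ?_⟩
  obtain ⟨h1, h2⟩ := hasIntegral_sqNorm_affine A c
  rw [lintegral_map (by fun_prop) hm, ← ofReal_integral_eq_lintegral_ofReal h1
    (ae_of_all _ fun _ => sqNorm_nonneg _), h2]
  exact ENNReal.ofReal_le_ofReal h

lemma measurePreserving_jointLaw {Ω : Type*} [MeasurableSpace Ω] (ρ : Measure Ω)
    [IsProbabilityMeasure ρ] {X : Ω → Fin N → ℂ} (hX : Measurable X) :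
    MeasurePreserving (fun q : Ω × ℂ × (Fin N → ℂ) =>
        (X q.1, (F + q.2.1 • G) *ᵥ X q.1 + q.2.2))
      (ρ.prod ((cn (σ ^ 2)).prod (cnStd (Fin N)))) (jointLaw F G σ (ρ.map X)) := by
  have hm : Measurable fun p : (Fin N → ℂ) × ℂ × (Fin N → ℂ) =>
      (p.1, (F + p.2.1 • G) *ᵥ p.1 + p.2.2) := measurable_fst.prodMk measurable_channel
  have hX' : Measurable (Prod.map X (id : ℂ × (Fin N → ℂ) → _)) := hX.prodMap measurable_id
  refine ⟨hm.comp hX', ?_⟩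
  have : IsProbabilityMeasure (ρ.map X) := Measure.isProbabilityMeasure_map hX.aemeasurable
  have e : (ρ.map X).prod ((cn (σ ^ 2)).prod (cnStd (Fin N))) =
      (ρ.prod ((cn (σ ^ 2)).prod (cnStd (Fin N)))).map (Prod.map X id) := by
    rw [← Measure.map_prod_map _ _ hX measurable_id, Measure.map_id]
  rw [jointLaw, e, Measure.map_map hm hX']
  rfl

lemma gaussianRate_eq {Q : Matrix (Fin N) (Fin N) ℂ} (hQ : Q.PosSemidef) :
    gaussianRate F G σ Q = (∫ s, logDet ((F + s • G) * CFC.sqrt Q) ∂(cn (σ ^ 2))) -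
      Real.log (1 + σ ^ 2 * (G * Q * Gᴴ).trace.re) := by
  rw [gaussianRate]
  congr 1
  refine integral_congr_ae (ae_of_all _ fun s => ?_)
  simp only [logDet, cov, conjTranspose_mul]
  conv_lhs => rw [← sqrt_mul_conjTranspose_sqrt hQ]
  simp only [Matrix.mul_assoc]

/-- `R_G(Q) ≤ I(x; y)` for the input `x ∼ CN(0, Q)`. -/
theorem gaussianRate_le_mutualInfo (hσ : 0 < σ) {Q : Matrix (Fin N) (Fin N) ℂ}
    (hQ : Q.PosSemidef) :
    ((gaussianRate F G σ Q : ℝ) : EReal) ≤ mutualInfo F G σ (cnVec Q) := by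
  set S := CFC.sqrt Q with hS
  have hSS : S * Sᴴ = Q := sqrt_mul_conjTranspose_sqrt hQ
  have hSm : Measurable fun g => S *ᵥ g := measurable_mulVec S
  have h2 : Integrable sqNorm (cnVec Q) := by
    have := (isInput_map_affine S 0 (P := (S * Sᴴ).trace.re + sqNorm (0 : Fin N → ℂ))
      le_rfl).integrable
    rw [cnVec]
    simpa only [add_zero] using this
  set ν := (cn (σ ^ 2)).prod (cnStd (Fin N))
  set Ω := (cnStd (Fin N)).prod ν
  set J := jointLaw F G σ (cnVec Q)
  have mp : MeasurePreserving (fun q : (Fin N → ℂ) × ℂ × (Fin N → ℂ) =>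
      (S *ᵥ q.1, (F + q.2.1 • G) *ᵥ S *ᵥ q.1 + q.2.2)) Ω J :=
    measurePreserving_jointLaw (cnStd (Fin N)) hSm
  set K : ℂ → Matrix (Fin N) (Fin N) ℂ := fun s => (F + s • G) * S with hK
  have hKc : Continuous K := by
    rw [hK]
    exact Continuous.matrix_mul (by fun_prop) continuous_const
  set Y : (Fin N → ℂ) × ℂ × (Fin N → ℂ) → Fin N → ℂ := fun q => K q.2.1 *ᵥ q.1 + q.2.2 with hY
  have hYc : Continuous Y := by
    refine Continuous.add (Continuous.matrix_mulVec ?_ continuous_fst) (by fun_prop)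
    exact hKc.comp (continuous_fst.comp continuous_snd)
  have hYeq : ∀ q : (Fin N → ℂ) × ℂ × (Fin N → ℂ),
      (F + q.2.1 • G) *ᵥ S *ᵥ q.1 + q.2.2 = Y q := fun q => by rw [hY, hK, mulVec_mulVec]
  -- Given `s`, the output is `K s` applied to a standard Gaussian plus noise, with density `gdens
  -- (K s)`. Tonelli puts `s` outermost.
  have hlint : ∀ h : ℂ → (Fin N → ℂ) → ℝ≥0∞, Measurable (Function.uncurry h) →
      ∫⁻ q, h q.2.1 (Y q) ∂Ω = ∫⁻ s, (∫⁻ y, ENNReal.ofReal (gdens (K s) y) * h s y)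
        ∂(cn (σ ^ 2)) := by
    intro h hh
    have hm : Measurable fun q : (Fin N → ℂ) × ℂ × (Fin N → ℂ) => h q.2.1 (Y q) :=
      hh.comp ((measurable_fst.comp measurable_snd).prodMk hYc.measurable)
    rw [lintegral_prod _ hm.aemeasurable]
    have e : ∀ g, ∫⁻ q : ℂ × (Fin N → ℂ), h q.1 (K q.1 *ᵥ g + q.2) ∂ν =
        ∫⁻ s, ∫⁻ z, h s (K s *ᵥ g + z) ∂(cnStd (Fin N)) ∂(cn (σ ^ 2)) := fun g =>
      lintegral_prod _ (hm.comp measurable_prodMk_left).aemeasurable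
    simp only [hY]
    simp_rw [e]
    rw [lintegral_lintegral_swap]
    · refine lintegral_congr fun s => ?_
      exact lintegral_mulVec_add (K s) (hh.comp measurable_prodMk_left)
    · have hm' : Measurable fun p : ((Fin N → ℂ) × ℂ) × (Fin N → ℂ) =>
          h p.1.2 (K p.1.2 *ᵥ p.1.1 + p.2) := hm.comp (by fun_prop :
            Measurable fun p : ((Fin N → ℂ) × ℂ) × (Fin N → ℂ) => (p.1.1, p.1.2, p.2))
      exact hm'.lintegral_prod_right'.aemeasurable
  have hqfm : Continuous fun q : (Fin N → ℂ) × ℂ × (Fin N → ℂ) => qf (cov (K q.2.1))⁻¹ (Y q) :=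
    continuous_qf_cov_inv (hKc.comp (continuous_fst.comp continuous_snd)) hYc
  obtain ⟨iq, eq⟩ : Integrable (fun q : (Fin N → ℂ) × ℂ × (Fin N → ℂ) =>
      qf (cov (K q.2.1))⁻¹ (Y q)) Ω ∧ ∫ q, qf (cov (K q.2.1))⁻¹ (Y q) ∂Ω = N := by
    refine hasIntegral_of_lintegral hqfm.measurable (fun q => qf_cov_inv_nonneg _ _)
      (Nat.cast_nonneg _) ?_
    have hm : Measurable (Function.uncurry fun s y => ENNReal.ofReal (qf (cov (K s))⁻¹ y)) :=
      (continuous_qf_cov_inv (hKc.comp continuous_fst) continuous_snd).measurable.ennreal_ofReal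
    rw [hlint (fun s y => ENNReal.ofReal (qf (cov (K s))⁻¹ y)) hm]
    have e : ∀ s, ∫⁻ y, ENNReal.ofReal (gdens (K s) y) * ENNReal.ofReal (qf (cov (K s))⁻¹ y) =
        N := by
      intro s
      rw [← lintegral_mulVec_add (K s) (h := fun y => ENNReal.ofReal (qf (cov (K s))⁻¹ y))
        (by fun_prop), lintegral_qf_cov_inv, Fintype.card_fin]
    simp_rw [e]
    simp
  have mp2 : MeasurePreserving (fun q : (Fin N → ℂ) × ℂ × (Fin N → ℂ) => q.2.1) Ω (cn (σ ^ 2)) :=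
    measurePreserving_fst.comp measurePreserving_snd
  have iD0 : Integrable (fun s => logDet (K s)) (cn (σ ^ 2)) := by
    have := integrable_logDet_affine (F * S) (G * S) (sq_nonneg σ)
    simpa only [hK, Matrix.add_mul, Matrix.smul_mul] using this
  have iD : Integrable (fun q : (Fin N → ℂ) × ℂ × (Fin N → ℂ) => logDet (K q.2.1)) Ω :=
    mp2.integrable_comp_of_integrable iD0
  have eD : ∫ q, logDet (K q.2.1) ∂Ω = ∫ s, logDet (K s) ∂(cn (σ ^ 2)) := by
    have := integral_map (μ := Ω) mp2.measurable.aemeasurable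
      (continuous_logDet hKc).aestronglyMeasurable
    rw [mp2.map_eq] at this
    exact this.symm
  have iP0 := integrable_log_outDens (F := F) (G := G) (σ := σ) h2
  have iP : Integrable (fun q => Real.log (outDens F G σ (cnVec Q) (Y q)).toReal) Ω := by
    have := mp.integrable_comp_of_integrable iP0
    simp only [Function.comp_def, hYeq] at this
    exact this
  have eP : ∫ q, Real.log (outDens F G σ (cnVec Q) (Y q)).toReal ∂Ω =
      ∫ p, Real.log (outDens F G σ (cnVec Q) p.2).toReal ∂J := by
    have := integral_map (μ := Ω) mp.measurable.aemeasurable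
      (by rw [mp.map_eq]; exact iP0.aestronglyMeasurable)
    rw [mp.map_eq] at this
    simp only [hYeq] at this
    exact this.symm
  have hlog : ∀ q : (Fin N → ℂ) × ℂ × (Fin N → ℂ), Real.log (gdens (K q.2.1) (Y q)) =
      -(N * Real.log Real.pi) - logDet (K q.2.1) - qf (cov (K q.2.1))⁻¹ (Y q) := fun q => by
    rw [log_gdens, Fintype.card_fin]
  have iC := (integrable_const (μ := Ω) (-(N * Real.log Real.pi))).sub iD
  have iG : Integrable (fun q => Real.log (gdens (K q.2.1) (Y q))) Ω := by
    simp_rw [hlog]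
    exact iC.sub iq
  have eG : ∫ q, Real.log (gdens (K q.2.1) (Y q)) ∂Ω =
      -(N * Real.log Real.pi) - (∫ s, logDet (K s) ∂(cn (σ ^ 2))) - N := by
    simp_rw [hlog]
    simp only [Pi.sub_def] at iC
    rw [integral_sub iC iq, integral_sub (integrable_const _) iD, eD, eq]
    simp
  have hmP : Measurable (outDens F G σ (cnVec Q)) := measurable_outDens _
  -- Compares the marginal output density with the one conditional on `s`: conditioning does not
  -- increase entropy, so `h(y) ≥ h(y|s)`.
  have hgibbs := integral_nonpos_of_lintegral_exp_le_one (iP.sub iG) <| by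
    have hm : Measurable (Function.uncurry fun s y => ENNReal.ofReal (Real.exp
        (Real.log (outDens F G σ (cnVec Q) y).toReal - Real.log (gdens (K s) y)))) :=
      ((hmP.comp measurable_snd).ennreal_toReal.log.sub
        (continuous_gdens (hKc.comp continuous_fst)
          continuous_snd).measurable.log).exp.ennreal_ofReal
    have e1 := hlint (fun s y => ENNReal.ofReal (Real.exp
        (Real.log (outDens F G σ (cnVec Q) y).toReal - Real.log (gdens (K s) y)))) hm
    simp only [Pi.sub_apply]
    rw [e1]
    have e2 : ∀ s y, ENNReal.ofReal (gdens (K s) y) * ENNReal.ofReal (Real.exp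
        (Real.log (outDens F G σ (cnVec Q) y).toReal - Real.log (gdens (K s) y))) =
        outDens F G σ (cnVec Q) y := by
      intro s y
      have hpos := ENNReal.toReal_pos (outDens_pos (F := F) (G := G) (σ := σ) (cnVec Q) y).ne'
        (outDens_ne_top _ _)
      have hg := gdens_pos (K s) y
      rw [← ENNReal.ofReal_mul hg.le, Real.exp_sub, Real.exp_log hpos, Real.exp_log hg,
        mul_div_cancel₀ _ hg.ne', ENNReal.ofReal_toReal (outDens_ne_top _ _)]
    simp_rw [e2]
    have e3 : ∫⁻ y, outDens F G σ (cnVec Q) y = 1 := by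
      have : J.snd Set.univ = 1 := by simp
      rwa [jointLaw_snd hσ, withDensity_apply _ MeasurableSet.univ, setLIntegral_univ] at this
    rw [e3]
    simp
  have e4 := integral_sub iP iG
  simp only [Pi.sub_apply] at hgibbs e4
  rw [e4, eP, eG] at hgibbs
  -- Jensen's inequality by the tangent line of `log` at the mean `m`.
  have hjen : ∫ x, Real.log (1 + σ ^ 2 * sqNorm (G *ᵥ x)) ∂(cnVec Q) ≤
      Real.log (1 + σ ^ 2 * (G * Q * Gᴴ).trace.re) := by
    have hGQ : 0 ≤ (G * Q * Gᴴ).trace.re := re_trace_nonneg (hQ.mul_mul_conjTranspose_same G)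
    set m := 1 + σ ^ 2 * (G * Q * Gᴴ).trace.re with hm
    have hmpos : 0 < m := by positivity
    have i1 := integrable_log_fading (G := G) (σ := σ) h2
    have i2 := integrable_sqNorm_mulVec measurable_id h2 G
    simp only [id] at i2
    have e5 : ∫ x, sqNorm (G *ᵥ x) ∂(cnVec Q) = (G * Q * Gᴴ).trace.re := by
      have h3 := (hasIntegral_sqNorm_affine (G * S) 0).2
      simp only [add_zero, sqNorm_zero, ← mulVec_mulVec] at h3
      rw [cnVec, integral_map hSm.aemeasurable (by fun_prop), h3, conjTranspose_mul,
        Matrix.mul_assoc, ← Matrix.mul_assoc S, hSS, Matrix.mul_assoc]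
    have i3 := (i2.const_mul (σ ^ 2 / m)).add (integrable_const (Real.log m + 1 / m - 1))
    calc _ ≤ ∫ x, (σ ^ 2 / m * sqNorm (G *ᵥ x) + (Real.log m + 1 / m - 1)) ∂(cnVec Q) := by
          refine integral_mono i1 i3 fun x => ?_
          have h3 : 0 ≤ σ ^ 2 * sqNorm (G *ᵥ x) := mul_nonneg (sq_nonneg _) (sqNorm_nonneg _)
          have h4 : 0 < 1 + σ ^ 2 * sqNorm (G *ᵥ x) := by positivity
          have h5 := Real.log_le_sub_one_of_pos (div_pos h4 hmpos)
          rw [Real.log_div h4.ne' hmpos.ne', add_div, mul_div_right_comm] at h5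
          beta_reduce
          linarith
      _ = Real.log m := by
          rw [integral_add (i2.const_mul _) (integrable_const _), integral_const_mul, e5]
          simp only [integral_const, probReal_univ, one_smul]
          have : σ ^ 2 / m * (G * Q * Gᴴ).trace.re + 1 / m = 1 := by
            rw [div_mul_eq_mul_div, ← add_div, add_comm, ← hm, div_self hmpos.ne']
          linarith
  rw [mutualInfo_coe_eq h2 hσ, EReal.coe_le_coe_iff, gaussianRate_eq hQ,
    (hasIntegral_log_trans h2 hσ).2]
  linarith

lemma cnVec_isInput {P : ℝ} {Q : Matrix (Fin N) (Fin N) ℂ} (hQ : Q ∈ covSet N P) :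
    IsInput P (cnVec Q) := by
  have := isInput_map_affine (CFC.sqrt Q) 0 (P := P) (by
    rw [sqrt_mul_conjTranspose_sqrt hQ.1, sqNorm_zero, add_zero]; exact hQ.2)
  rw [cnVec]
  simpa only [add_zero] using this

lemma mutualInfo_le_capacity {P : ℝ} {μ : Measure (Fin N → ℂ)} (h : IsInput P μ) :
    mutualInfo F G σ μ ≤ capacity F G σ P :=
  le_iSup (fun μ : {μ : Measure (Fin N → ℂ) // IsInput P μ} => mutualInfo F G σ μ.1) ⟨μ, h⟩

end
end RankOneChannel
namespace RankOneChannel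
noncomputable section

/-! ### Pilot-based subspace alignment -/

lemma star_mulVec_dotProduct_mulVec {m p q : Type*} [Fintype m] [Fintype p] [Fintype q]
    (A : Matrix m p ℂ) (B : Matrix m q ℂ) (a : p → ℂ) (b : q → ℂ) :
    star (A *ᵥ a) ⬝ᵥ (B *ᵥ b) = star a ⬝ᵥ (Aᴴ * B) *ᵥ b := by
  rw [star_mulVec, ← dotProduct_mulVec, mulVec_mulVec]

lemma sqNorm_orthogonal_add {m k d : Type*} [Fintype m] [Fintype k] [Fintype d] [DecidableEq k]
    [DecidableEq d] {U : Matrix m k ℂ} {W : Matrix m d ℂ} (hU : Uᴴ * U = 1) (hW : Wᴴ * W = 1)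
    (hUW : Uᴴ * W = 0) (u : k → ℂ) (w : d → ℂ) :
    sqNorm (W *ᵥ w + U *ᵥ u) = sqNorm w + sqNorm u := by
  have hWU : Wᴴ * U = 0 := by
    have := congrArg conjTranspose hUW
    simpa [conjTranspose_mul] using this
  have h : (sqNorm (W *ᵥ w + U *ᵥ u) : ℂ) = sqNorm w + sqNorm u := by
    rw [← star_dotProduct_self, star_add, add_dotProduct, dotProduct_add, dotProduct_add,
      star_mulVec_dotProduct_mulVec, star_mulVec_dotProduct_mulVec,
      star_mulVec_dotProduct_mulVec, star_mulVec_dotProduct_mulVec, hU, hW, hUW, hWU]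
    simp [star_dotProduct_self]
  exact_mod_cast h

lemma charFunDual_cn {v : ℝ} (hv : 0 ≤ v) {L : StrongDual ℝ ℂ} {a : ℂ}
    (ha : ∀ z, L z = (star a * z).re) :
    charFunDual (cn v) L = Complex.exp (-(v * ‖a‖ ^ 2 / 4 : ℝ)) := by
  rw [charFunDual_apply, ← charFun_cn hv]
  simp_rw [ha]

lemma charFunDual_cnStd {ι : Type*} [Fintype ι] {L : StrongDual ℝ (ι → ℂ)} {t : ι → ℂ}
    (ht : ∀ z, L z = (star t ⬝ᵥ z).re) :
    charFunDual (cnStd ι) L = Complex.exp (-(sqNorm t / 4 : ℝ)) := by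
  rw [charFunDual_apply, ← charFun_cnStd]
  simp_rw [ht]

/-- The estimate of a Gaussian `s` from `s b + Wᴴ z`, its error, and the projection `Uᴴ z` are
independent. -/
lemma map_estimate {N k d : ℕ} {U : Matrix (Fin N) (Fin k) ℂ} {W : Matrix (Fin N) (Fin d) ℂ}
    (hU : Uᴴ * U = 1) (hW : Wᴴ * W = 1) (hUW : Uᴴ * W = 0) (b : Fin d → ℂ) {σ e : ℝ} (hσ : 0 < σ)
    (he : e = (sqNorm b + (σ ^ 2)⁻¹)⁻¹) :
    MeasurePreserving (fun q : ℂ × (Fin N → ℂ) =>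
        (((e : ℂ) * (star b ⬝ᵥ (q.1 • b + Wᴴ *ᵥ q.2)),
          q.1 - (e : ℂ) * (star b ⬝ᵥ (q.1 • b + Wᴴ *ᵥ q.2)), Uᴴ *ᵥ q.2) :
          ℂ × ℂ × (Fin k → ℂ)))
      ((cn (σ ^ 2)).prod (cnStd (Fin N)))
      ((cn (σ ^ 2 - e)).prod ((cn e).prod (cnStd (Fin k)))) := by
  have hB := sqNorm_nonneg b
  set B := sqNorm b
  set w := (σ ^ 2)⁻¹ with hw
  have hwpos : 0 < w := by positivity
  have hσw : σ ^ 2 * w = 1 := mul_inv_cancel₀ (by positivity)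
  have heB : e * (B + w) = 1 := by rw [he]; exact inv_mul_cancel₀ (by positivity)
  have hepos : 0 < e := by rw [he]; positivity
  -- The right-hand side is the variance of the estimate `e bᴴ (s b + Wᴴ z)`, from its signal and
  -- noise parts.
  have hv : σ ^ 2 - e = e ^ 2 * (σ ^ 2 * B ^ 2 + B) := by
    linear_combination (-(e * B + 1) * σ ^ 2 + e * B * σ^2 - e * B * σ ^ 2) * heB +
      (e ^ 2 * B + e + 0) * hσw
  have hv0 : 0 ≤ σ ^ 2 - e := by rw [hv]; positivity
  have hf : Continuous (fun q : ℂ × (Fin N → ℂ) =>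
        (((e : ℂ) * (star b ⬝ᵥ (q.1 • b + Wᴴ *ᵥ q.2)),
          q.1 - (e : ℂ) * (star b ⬝ᵥ (q.1 • b + Wᴴ *ᵥ q.2)), Uᴴ *ᵥ q.2) :
          ℂ × ℂ × (Fin k → ℂ))) := by
    have h1 : Continuous fun q : ℂ × (Fin N → ℂ) => star b ⬝ᵥ (q.1 • b + Wᴴ *ᵥ q.2) :=
      Continuous.dotProduct continuous_const ((continuous_fst.smul continuous_const).add
        (Continuous.matrix_mulVec continuous_const continuous_snd))
    have h2 : Continuous fun q : ℂ × (Fin N → ℂ) => Uᴴ *ᵥ q.2 :=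
      Continuous.matrix_mulVec continuous_const continuous_snd
    fun_prop
  refine ⟨hf.measurable, ?_⟩
  have := Measure.isProbabilityMeasure_map (μ := (cn (σ ^ 2)).prod (cnStd (Fin N)))
    hf.measurable.aemeasurable
  refine Measure.ext_of_charFunDual (funext fun L => ?_)
  rw [charFunDual_prod, charFunDual_prod]
  obtain ⟨α, hα⟩ := exists_eq_re_mul (L ∘SL ContinuousLinearMap.inl ℝ ℂ (ℂ × (Fin k → ℂ)))
  obtain ⟨γ, hγ⟩ := exists_eq_re_mul ((L ∘SL ContinuousLinearMap.inr ℝ ℂ (ℂ × (Fin k → ℂ))) ∘SL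
    ContinuousLinearMap.inl ℝ ℂ (Fin k → ℂ))
  obtain ⟨t, ht⟩ := exists_eq_re_dotProduct
    ((L ∘SL ContinuousLinearMap.inr ℝ ℂ (ℂ × (Fin k → ℂ))) ∘SL
    ContinuousLinearMap.inr ℝ ℂ (Fin k → ℂ))
  rw [charFunDual_cn hv0 hα, charFunDual_cn hepos.le hγ, charFunDual_cnStd ht]
  have hL : ∀ x : ℂ × ℂ × (Fin k → ℂ),
      L x = (star α * x.1).re + (star γ * x.2.1).re + (star t ⬝ᵥ x.2.2).re := by
    intro x
    rw [← hα, ← hγ, ← ht]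
    simp only [ContinuousLinearMap.comp_apply, ContinuousLinearMap.inl_apply,
      ContinuousLinearMap.inr_apply, ← map_add]
    simp
  rw [charFunDual_apply, integral_map hf.measurable.aemeasurable (by fun_prop)]
  -- `a'` and `t'` are the coefficients of `s` and `z` when a functional `(α, γ, t)` is pulled back.
  -- The relation `1 - e B = e w` gives the weight of `γ`.
  set a' : ℂ := (e * B : ℝ) * α + (e * w : ℝ) * γ with ha'
  set t' : Fin N → ℂ := W *ᵥ (((e : ℂ) * (α - γ)) • b) + U *ᵥ t with ht'
  have hsplit : ∀ q : ℂ × (Fin N → ℂ), L ((e : ℂ) * (star b ⬝ᵥ (q.1 • b + Wᴴ *ᵥ q.2)),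
      q.1 - (e : ℂ) * (star b ⬝ᵥ (q.1 • b + Wᴴ *ᵥ q.2)), Uᴴ *ᵥ q.2) =
      (star a' * q.1).re + (star t' ⬝ᵥ q.2).re := by
    intro q
    rw [hL, ← Complex.add_re, ← Complex.add_re, ← Complex.add_re]
    congr 1
    have e1 : star t' ⬝ᵥ q.2 = ((e : ℂ) * star (α - γ)) * (star b ⬝ᵥ Wᴴ *ᵥ q.2) +
        star t ⬝ᵥ Uᴴ *ᵥ q.2 := by
      rw [ht', star_add, add_dotProduct, star_mulVec, star_mulVec, ← dotProduct_mulVec,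
        ← dotProduct_mulVec, star_smul, smul_dotProduct]
      simp
    have e2 : (e : ℂ) * B = 1 - e * w := by
      rw [eq_sub_iff_add_eq, ← mul_add]
      exact_mod_cast heB
    rw [e1, dotProduct_add, dotProduct_smul, star_dotProduct_self, ha']
    simp only [star_add, star_sub, star_mul', RCLike.star_def, Complex.conj_ofReal, smul_eq_mul]
    push_cast
    linear_combination (-(starRingEnd ℂ γ) * q.1) * e2
  simp_rw [hsplit]
  have h3 : ∀ q : ℂ × (Fin N → ℂ),
      Complex.exp ((((star a' * q.1).re + (star t' ⬝ᵥ q.2).re : ℝ) : ℂ) * Complex.I) =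
      Complex.exp (((star a' * q.1).re : ℝ) * Complex.I) *
        Complex.exp (((star t' ⬝ᵥ q.2).re : ℝ) * Complex.I) := by
    intro q
    rw [← Complex.exp_add]; push_cast; ring_nf
  simp_rw [h3]
  rw [integral_prod_mul (fun s : ℂ => Complex.exp (((star a' * s).re : ℝ) * Complex.I))
    (fun z => Complex.exp (((star t' ⬝ᵥ z).re : ℝ) * Complex.I)), charFun_cn (sq_nonneg σ),
    charFun_cnStd, ← Complex.exp_add, ← Complex.exp_add, ← Complex.exp_add]
  congr 1
  rw [ht', sqNorm_orthogonal_add hU hW hUW, sqNorm_smul, norm_mul, Complex.norm_real, mul_pow,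
    Real.norm_eq_abs, sq_abs]
  norm_cast
  -- The mixed terms in `α` and `γ` cancel because `σ² w = 1`. This is the orthogonality of the MMSE
  -- estimate and its error, which for jointly Gaussian variables is independence.
  have h4 : σ ^ 2 * ‖a'‖ ^ 2 + e ^ 2 * ‖α - γ‖ ^ 2 * B =
      (σ ^ 2 - e) * ‖α‖ ^ 2 + e * ‖γ‖ ^ 2 := by
    rw [hv, ha']
    simp only [← Complex.normSq_eq_norm_sq, Complex.normSq_apply, Complex.add_re, Complex.add_im,
      Complex.sub_re, Complex.sub_im, Complex.re_ofReal_mul, Complex.im_ofReal_mul]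
    linear_combination (e * (γ.re * γ.re + γ.im * γ.im)) * heB +
      (e ^ 2 * w * (γ.re * γ.re + γ.im * γ.im) +
        2 * e ^ 2 * B * (α.re * γ.re + α.im * γ.im)) * hσw
  linarith

lemma trace_mul_add_vecMulVec {κ : Type*} [Fintype κ] (M : Matrix κ κ ℂ) (c : κ → ℂ) :
    (M * vecMulVec c (star c)).trace.re = qf M c := by
  rw [trace_mul_vecMulVec_star, qf]

lemma re_trace_mul_nonneg {κ ι : Type*} [Fintype κ] [Fintype ι] {M : Matrix κ κ ℂ}
    (hM : M.PosSemidef) (B : Matrix κ ι ℂ) : 0 ≤ (M * (B * Bᴴ)).trace.re := by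
  have := re_trace_nonneg (hM.conjTranspose_mul_mul_same B)
  rwa [Matrix.mul_assoc, trace_mul_comm, Matrix.mul_assoc] at this

/-- Second moment of signal plus disturbance plus noise, for a whitened disturbance. -/
lemma lintegral_qf_signal {κ ι : Type*} [Fintype κ] [DecidableEq κ] [Fintype ι] [DecidableEq ι]
    {M : Matrix κ κ ℂ} (hM : M.PosSemidef) (K A : Matrix κ ι ℂ) (T : Matrix κ κ ℂ) (c : κ → ℂ)
    {e : ℝ} (he : 0 ≤ e)
    (hT : T * Tᴴ + (e : ℂ) • (A * Aᴴ + vecMulVec c (star c)) = 1) :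
    ∫⁻ g, ∫⁻ s, ∫⁻ n, ENNReal.ofReal (qf M (K *ᵥ g + (s • (A *ᵥ g + c) + T *ᵥ n)))
      ∂(cnStd κ) ∂(cn e) ∂(cnStd ι) = ENNReal.ofReal (M * cov K).trace.re := by
  have hA := re_trace_mul_nonneg hM A
  have hK := re_trace_mul_nonneg hM K
  have hTT := re_trace_mul_nonneg hM T
  have h1 : ∀ (g : ι → ℂ) (s : ℂ), ∫⁻ n, ENNReal.ofReal (qf M (K *ᵥ g + (s • (A *ᵥ g + c) + T *ᵥ n))) ∂(cnStd κ) =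
      ENNReal.ofReal (M * (T * Tᴴ)).trace.re +
        ENNReal.ofReal (qf M (s • (A *ᵥ g + c) + K *ᵥ g)) := by
    intro g s
    rw [← ENNReal.ofReal_add hTT (qf_nonneg hM _), ← lintegral_qf_affine hM]
    refine lintegral_congr fun n => ?_
    congr 2; abel
  have h2 : ∀ g : ι → ℂ, ∫⁻ s, (ENNReal.ofReal (M * (T * Tᴴ)).trace.re +
        ENNReal.ofReal (qf M (s • (A *ᵥ g + c) + K *ᵥ g))) ∂(cn e) =
      ENNReal.ofReal (M * (T * Tᴴ)).trace.re + (ENNReal.ofReal e *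
        ENNReal.ofReal (qf M (A *ᵥ g + c)) + ENNReal.ofReal (qf M (K *ᵥ g + 0))) := by
    intro g
    rw [lintegral_add_left measurable_const, lintegral_const, measure_univ, mul_one,
      lintegral_qf_cn hM he, ENNReal.ofReal_add (mul_nonneg he (qf_nonneg hM _)) (qf_nonneg hM _),
      ENNReal.ofReal_mul he, add_zero]
  simp_rw [h1, h2]
  rw [lintegral_add_left measurable_const, lintegral_const, measure_univ, mul_one,
    lintegral_add_left (by fun_prop), lintegral_const_mul _ (by fun_prop),
    lintegral_qf_affine hM, lintegral_qf_affine hM]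
  have h0 : qf M 0 = 0 := by simp [qf]
  rw [h0, add_zero, ← ENNReal.ofReal_mul he, ← ENNReal.ofReal_add
    (mul_nonneg he (add_nonneg hA (qf_nonneg hM c))) hK,
    ← ENNReal.ofReal_add hTT (add_nonneg (mul_nonneg he (add_nonneg hA
    (qf_nonneg hM c))) hK), cov, ← hT]
  congr 1
  rw [Matrix.mul_add, Matrix.mul_add, Matrix.mul_smul, Matrix.mul_add, trace_add, trace_add,
    trace_smul, trace_add, smul_eq_mul]
  simp only [Complex.add_re, Complex.re_ofReal_mul, trace_mul_add_vecMulVec]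
  ring

end
end RankOneChannel
namespace RankOneChannel
noncomputable section

/-! ### Projections, whitening and the decoding metric of the pilot scheme. -/

lemma eq_mul_of_range_le {m k p : ℕ} {U : Matrix (Fin m) (Fin k) ℂ}
    {M : Matrix (Fin m) (Fin p ⊕ Fin p) ℂ}
    (h : LinearMap.range U.mulVecLin ≤ LinearMap.range M.mulVecLin) :
    ∃ C : Matrix (Fin p ⊕ Fin p) (Fin k) ℂ, U = M * C := by
  have h1 : ∀ j, ∃ c, M *ᵥ c = U *ᵥ Pi.single j 1 := fun j => by
    obtain ⟨c, hc⟩ := h ⟨Pi.single j 1, rfl⟩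
    exact ⟨c, hc⟩
  choose c hc using h1
  refine ⟨Matrix.of fun i j => c j i, ?_⟩
  ext i j
  have := congrFun (hc j) i
  rw [mulVec_single_one] at this
  rw [show U i j = U.col j i from rfl, ← this]
  rfl

namespace PilotScheme

variable {N : ℕ} {F G : Matrix (Fin N) (Fin N) ℂ} {P σ : ℝ} (S : PilotScheme F G P)

lemma Uperp_orthogonal : (fromCols (F * S.V) (G * S.V))ᴴ * S.Uperp = 0 := by
  refine ext_of_mulVec_single fun j => ?_
  have h : S.Uperp.mulVecLin (Pi.single j 1) ∈
      LinearMap.ker ((fromCols (F * S.V) (G * S.V))ᴴ).mulVecLin := by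
    rw [← S.Uperp_range]; exact ⟨_, rfl⟩
  rw [LinearMap.mem_ker, mulVecLin_apply, mulVecLin_apply, mulVec_mulVec] at h
  rw [h, zero_mulVec]

lemma Uperp_mul_F : S.Uperpᴴ * (F * S.V) = 0 := by
  have h := S.Uperp_orthogonal
  rw [conjTranspose_fromCols_eq_fromRows_conjTranspose, fromRows_mul] at h
  have h1 : (F * S.V)ᴴ * S.Uperp = 0 := by
    ext i j; exact congrFun (congrFun h (Sum.inl i)) j
  have := congrArg conjTranspose h1
  simpa only [conjTranspose_mul, conjTranspose_conjTranspose, conjTranspose_zero] using this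

lemma Uperp_mul_G : S.Uperpᴴ * (G * S.V) = 0 := by
  have h := S.Uperp_orthogonal
  rw [conjTranspose_fromCols_eq_fromRows_conjTranspose, fromRows_mul] at h
  have h1 : (G * S.V)ᴴ * S.Uperp = 0 := by
    ext i j; exact congrFun (congrFun h (Sum.inr i)) j
  have := congrArg conjTranspose h1
  simpa only [conjTranspose_mul, conjTranspose_conjTranspose, conjTranspose_zero] using this

lemma U_mul_Uperp : S.Uᴴ * S.Uperp = 0 := by
  obtain ⟨C, hC⟩ := eq_mul_of_range_le S.U_range.le
  rw [hC, conjTranspose_mul, Matrix.mul_assoc, S.Uperp_orthogonal, Matrix.mul_zero]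

lemma errVar_pos (hσ : 0 < σ) : 0 < S.errVar σ := by
  have := sqNorm_nonneg (S.Uperpᴴ *ᵥ (G *ᵥ S.xp))
  unfold errVar; positivity

lemma errVar_le (hσ : 0 < σ) : S.errVar σ ≤ σ ^ 2 := by
  have := sqNorm_nonneg (S.Uperpᴴ *ᵥ (G *ᵥ S.xp))
  refine inv_le_of_inv_le₀ (by positivity) ?_
  linarith

lemma distCov_posDef (hσ : 0 < σ) : (S.distCov σ).PosDef := by
  refine PosDef.one.add_posSemidef ?_
  have h1 : (vecMulVec S.xp (star S.xp) + S.V * S.Qd * S.Vᴴ).PosSemidef :=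
    (posSemidef_vecMulVec_self_star S.xp).add (S.Qd_posSemidef.mul_mul_conjTranspose_same S.V)
  have h2 : (0 : ℂ) ≤ ((S.errVar σ : ℝ) : ℂ) := by exact_mod_cast (S.errVar_pos hσ).le
  exact ((h1.mul_mul_conjTranspose_same G).smul h2).conjTranspose_mul_mul_same S.U

/-- A square root of the inverse disturbance covariance. -/
def whitener (σ : ℝ) : Matrix (Fin S.k) (Fin S.k) ℂ := CFC.sqrt (S.distCov σ)⁻¹

lemma whitener_mul (hσ : 0 < σ) : S.whitener σ * S.whitener σ = (S.distCov σ)⁻¹ :=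
  CFC.sqrt_mul_sqrt_self _ (nonneg_iff_posSemidef.2 (S.distCov_posDef hσ).inv.posSemidef)

lemma whitener_conjTranspose : (S.whitener σ)ᴴ = S.whitener σ :=
  (nonneg_iff_posSemidef.1 (CFC.sqrt_nonneg (S.distCov σ)⁻¹)).isHermitian

lemma whitener_distCov (hσ : 0 < σ) :
    S.whitener σ * S.distCov σ * (S.whitener σ)ᴴ = 1 := by
  have hdet : IsUnit (S.distCov σ).det := (S.distCov_posDef hσ).det_pos.ne'.isUnit
  rw [whitener_conjTranspose]
  refine mul_eq_one_comm.1 ?_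
  rw [← Matrix.mul_assoc, whitener_mul S hσ, nonsing_inv_mul _ hdet]

/-- The whitened effective channel of the scheme. -/
def effChannel (σ : ℝ) (s : ℂ) : Matrix (Fin S.k) (Fin (N - 1)) ℂ :=
  S.whitener σ * S.Uᴴ * (F + s • G) * S.V

/-- Sylvester's determinant identity moves factors around, so that the non-Hermitian expression
becomes `logDet` of the whitened channel times a square root of `Qd`. -/
lemma rate_eq (hσ : 0 < σ) : S.rate σ =
    ∫ s, logDet (S.effChannel σ s * CFC.sqrt S.Qd) ∂(cn (σ ^ 2 - S.errVar σ)) := by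
  rw [rate]
  refine integral_congr_ae (ae_of_all _ fun s => ?_)
  simp only [logDet, cov]
  have e : S.Qd * S.Vᴴ * (F + s • G)ᴴ * S.U * (S.distCov σ)⁻¹ * S.Uᴴ * (F + s • G) * S.V =
      CFC.sqrt S.Qd * ((CFC.sqrt S.Qd)ᴴ * (S.effChannel σ s)ᴴ * S.effChannel σ s) := by
    conv_lhs => rw [← sqrt_mul_conjTranspose_sqrt S.Qd_posSemidef, ← S.whitener_mul hσ]
    simp only [effChannel, conjTranspose_mul, conjTranspose_conjTranspose, whitener_conjTranspose,
      Matrix.mul_assoc]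
  rw [e, det_one_add_mul_comm (CFC.sqrt S.Qd),
    det_one_add_mul_comm (S.effChannel σ s * CFC.sqrt S.Qd), conjTranspose_mul]
  simp only [Matrix.mul_assoc]

lemma continuous_effChannel : Continuous (S.effChannel σ) := by
  refine Continuous.matrix_mul (Continuous.matrix_mul continuous_const ?_) continuous_const
  fun_prop

lemma inputLaw_eq :
    S.inputLaw = (cnStd (Fin (N - 1))).map fun g => (S.V * CFC.sqrt S.Qd) *ᵥ g + S.xp := by
  rw [inputLaw, cnVec, Measure.map_map (by fun_prop) (measurable_mulVec _)]
  congr 1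
  ext g
  simp [mulVec_mulVec]

lemma inputLaw_isInput : IsInput P S.inputLaw := by
  rw [inputLaw_eq]
  refine isInput_map_affine _ _ ?_
  have h1 : (S.V * CFC.sqrt S.Qd * (S.V * CFC.sqrt S.Qd)ᴴ).trace = S.Qd.trace := by
    rw [trace_mul_comm, conjTranspose_mul, Matrix.mul_assoc, ← Matrix.mul_assoc S.Vᴴ,
      S.V_semiunitary, Matrix.one_mul, trace_mul_comm,
      sqrt_mul_conjTranspose_sqrt S.Qd_posSemidef]
  rw [h1, xp, sqNorm_smul, S.vp_unit, mul_one]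
  exact S.power

/-- The estimate of the fading coefficient from the output. -/
def estimate (σ : ℝ) (y : Fin N → ℂ) : ℂ :=
  (S.errVar σ : ℂ) * (star (S.Uperpᴴ *ᵥ (G *ᵥ S.xp)) ⬝ᵥ (S.Uperpᴴ *ᵥ (y - F *ᵥ S.xp)))

/-- The whitened in-space output after removal of the estimated pilot contribution. -/
def cleaned (σ : ℝ) (y : Fin N → ℂ) : Fin S.k → ℂ :=
  (S.whitener σ * S.Uᴴ) *ᵥ (y - (F + S.estimate σ y • G) *ᵥ S.xp)

lemma continuous_estimate : Continuous (S.estimate σ) :=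
  continuous_const.mul (Continuous.dotProduct continuous_const
    (Continuous.matrix_mulVec continuous_const (by fun_prop)))

lemma continuous_cleaned : Continuous (S.cleaned σ) := by
  refine Continuous.matrix_mulVec continuous_const (continuous_id.sub
    (Continuous.matrix_mulVec ?_ continuous_const))
  exact continuous_const.add (S.continuous_estimate.smul continuous_const)

/-- `Uperpᴴ` annihilates `F V` and `G V`, hence the data. Estimation sees only the pilot and noise,
whatever the data are. -/
lemma estimate_output (g : Fin (N - 1) → ℂ) (s : ℂ) (z : Fin N → ℂ) :
    S.estimate σ ((F + s • G) *ᵥ ((S.V * CFC.sqrt S.Qd) *ᵥ g + S.xp) + z) =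
      (S.errVar σ : ℂ) * (star (S.Uperpᴴ *ᵥ (G *ᵥ S.xp)) ⬝ᵥ
        (s • (S.Uperpᴴ *ᵥ (G *ᵥ S.xp)) + S.Uperpᴴ *ᵥ z)) := by
  have h : S.Uperpᴴ *ᵥ ((F + s • G) *ᵥ ((S.V * CFC.sqrt S.Qd) *ᵥ g + S.xp) + z - F *ᵥ S.xp) =
      s • (S.Uperpᴴ *ᵥ (G *ᵥ S.xp)) + S.Uperpᴴ *ᵥ z := by
    have h1 : S.Uperpᴴ *ᵥ ((F + s • G) *ᵥ ((S.V * CFC.sqrt S.Qd) *ᵥ g)) = 0 := by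
      rw [← mulVec_mulVec, mulVec_mulVec, mulVec_mulVec, Matrix.mul_assoc, Matrix.add_mul,
        Matrix.mul_add,
        S.Uperp_mul_F, Matrix.smul_mul, Matrix.mul_smul, S.Uperp_mul_G, smul_zero, add_zero,
        zero_mulVec]
    have h2 : (F + s • G) *ᵥ ((S.V * CFC.sqrt S.Qd) *ᵥ g + S.xp) + z - F *ᵥ S.xp =
        (F + s • G) *ᵥ ((S.V * CFC.sqrt S.Qd) *ᵥ g) + s • (G *ᵥ S.xp) + z := by
      rw [mulVec_add, add_mulVec F (s • G) S.xp, smul_mulVec]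
      abel
    rw [h2, mulVec_add, mulVec_add, h1, zero_add, mulVec_smul]
  rw [estimate, h]

/-- Writing `s = ŝ + (s - ŝ)` separates a useful signal through the known channel at `ŝ` from a
disturbance. The latter depends on the data, but only its second moment will be used. -/
lemma cleaned_output (g : Fin (N - 1) → ℂ) (s : ℂ) (z : Fin N → ℂ) {y : Fin N → ℂ}
    (hy : y = (F + s • G) *ᵥ ((S.V * CFC.sqrt S.Qd) *ᵥ g + S.xp) + z) :
    S.cleaned σ y = (S.effChannel σ (S.estimate σ y) * CFC.sqrt S.Qd) *ᵥ g +
      ((s - S.estimate σ y) • ((S.whitener σ * S.Uᴴ * G * S.V * CFC.sqrt S.Qd) *ᵥ g +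
        (S.whitener σ * S.Uᴴ * G) *ᵥ S.xp) + S.whitener σ *ᵥ (S.Uᴴ *ᵥ z)) := by
  have h : y - (F + S.estimate σ y • G) *ᵥ S.xp =
      (F + S.estimate σ y • G) *ᵥ ((S.V * CFC.sqrt S.Qd) *ᵥ g) +
        ((s - S.estimate σ y) • (G *ᵥ ((S.V * CFC.sqrt S.Qd) *ᵥ g) + G *ᵥ S.xp) + z) := by
    conv_lhs => enter [1]; rw [hy]
    generalize S.estimate σ y = t
    simp only [mulVec_add, add_mulVec, smul_mulVec]
    module
  rw [cleaned, h]
  generalize S.estimate σ y = t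
  simp only [mulVec_add, mulVec_smul, effChannel, mulVec_mulVec, Matrix.mul_assoc]

/-- The decoding metric of the scheme. -/
def metric (σ : ℝ) (p : (Fin N → ℂ) × (Fin N → ℂ)) : ℝ :=
  stdDens (S.cleaned σ p.2 - S.effChannel σ (S.estimate σ p.2) *ᵥ (S.Vᴴ *ᵥ (p.1 - S.xp))) /
    gdens (S.effChannel σ (S.estimate σ p.2) * CFC.sqrt S.Qd) (S.cleaned σ p.2)

lemma continuous_metric : Continuous (S.metric σ) := by
  have h1 : Continuous fun p : (Fin N → ℂ) × (Fin N → ℂ) => S.cleaned σ p.2 :=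
    S.continuous_cleaned.comp continuous_snd
  have h2 : Continuous fun p : (Fin N → ℂ) × (Fin N → ℂ) => S.effChannel σ (S.estimate σ p.2) :=
    S.continuous_effChannel.comp (S.continuous_estimate.comp continuous_snd)
  refine Continuous.div (continuous_stdDens.comp (h1.sub (Continuous.matrix_mulVec h2
    (Continuous.matrix_mulVec continuous_const (by fun_prop)))))
    (continuous_gdens (h2.matrix_mul continuous_const) h1) fun p => (gdens_pos _ _).ne'

lemma metric_pos (p : (Fin N → ℂ) × (Fin N → ℂ)) : 0 < S.metric σ p :=
  div_pos (stdDens_pos _) (gdens_pos _ _)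

lemma decode_input (g : Fin (N - 1) → ℂ) :
    S.Vᴴ *ᵥ ((S.V * CFC.sqrt S.Qd) *ᵥ g + S.xp - S.xp) = CFC.sqrt S.Qd *ᵥ g := by
  rw [add_sub_cancel_right, mulVec_mulVec, ← Matrix.mul_assoc, S.V_semiunitary, Matrix.one_mul]

/-- Averaging the numerator over Gaussian data gives exactly the denominator, for each fixed output.
-/
lemma lintegral_metric (y : Fin N → ℂ) :
    ∫⁻ x, ENNReal.ofReal (S.metric σ (x, y)) ∂S.inputLaw ≤ 1 := by
  have hm : Measurable fun x => ENNReal.ofReal (S.metric σ (x, y)) :=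
    (S.continuous_metric.comp (continuous_id.prodMk continuous_const)).measurable.ennreal_ofReal
  have hg := gdens_pos (S.effChannel σ (S.estimate σ y) * CFC.sqrt S.Qd) (S.cleaned σ y)
  rw [inputLaw_eq, lintegral_map hm ((measurable_mulVec _).add_const _)]
  simp only [metric, decode_input, mulVec_mulVec]
  simp_rw [ENNReal.ofReal_div_of_pos hg, div_eq_mul_inv]
  rw [lintegral_mul_const' _ _ (ENNReal.inv_ne_top.2 (ENNReal.ofReal_pos.2 hg).ne'),
    lintegral_stdDens_sub_mulVec, ENNReal.mul_inv_cancel (ENNReal.ofReal_pos.2 hg).ne'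
    ENNReal.ofReal_ne_top]

lemma log_metric_output (g : Fin (N - 1) → ℂ) {x : Fin N → ℂ} (y : Fin N → ℂ)
    (hx : x = (S.V * CFC.sqrt S.Qd) *ᵥ g + S.xp) :
    Real.log (S.metric σ (x, y)) =
      logDet (S.effChannel σ (S.estimate σ y) * CFC.sqrt S.Qd) +
        qf (cov (S.effChannel σ (S.estimate σ y) * CFC.sqrt S.Qd))⁻¹ (S.cleaned σ y) -
        sqNorm (S.cleaned σ y - (S.effChannel σ (S.estimate σ y) * CFC.sqrt S.Qd) *ᵥ g) := by
  have hpi := Real.pi_pos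
  rw [metric, Real.log_div (stdDens_pos _).ne' (gdens_pos _ _).ne', log_gdens, stdDens,
    Real.log_mul (by positivity) (by positivity), Real.log_inv, Real.log_pow, Real.log_exp]
  simp only
  rw [hx, decode_input, mulVec_mulVec]
  ring

/-- The rate of the scheme is a lower bound of its mutual information. -/
theorem rate_le_mutualInfo (hσ : 0 < σ) :
    ((S.rate σ : ℝ) : EReal) ≤ mutualInfo F G σ S.inputLaw := by
  have hin := S.inputLaw_isInput
  have := hin.1
  have he := S.errVar_pos hσ
  have hv : 0 ≤ σ ^ 2 - S.errVar σ := sub_nonneg.2 (S.errVar_le hσ)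
  set A := S.whitener σ * S.Uᴴ * G * S.V * CFC.sqrt S.Qd with hA
  set c := (S.whitener σ * S.Uᴴ * G) *ᵥ S.xp with hc
  set T := S.whitener σ with hT
  set e := S.errVar σ with he'
  set K : ℂ → Matrix (Fin S.k) (Fin (N - 1)) ℂ := fun s => S.effChannel σ s * CFC.sqrt S.Qd with hK
  have hKc : Continuous K := S.continuous_effChannel.matrix_mul continuous_const
  -- The whitener normalizes the covariance of the whole disturbance: noise plus error variance
  -- times the second moment of data and pilot seen through `G`.
  have hwhite : T * Tᴴ + (e : ℂ) • (A * Aᴴ + vecMulVec c (star c)) = 1 := by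
    rw [← S.whitener_distCov hσ, distCov, ← hT, ← he']
    have h1 : A * Aᴴ = T * S.Uᴴ * G * (S.V * S.Qd * S.Vᴴ) * Gᴴ * S.U * Tᴴ := by
      conv_rhs => rw [← sqrt_mul_conjTranspose_sqrt S.Qd_posSemidef]
      simp only [hA, conjTranspose_mul, conjTranspose_conjTranspose, Matrix.mul_assoc]
    have h2 : vecMulVec c (star c) =
        T * S.Uᴴ * G * vecMulVec S.xp (star S.xp) * Gᴴ * S.U * Tᴴ := by
      have h3 : Gᴴ * (S.U * Tᴴ) = (T * S.Uᴴ * G)ᴴ := by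
        simp only [conjTranspose_mul, conjTranspose_conjTranspose, Matrix.mul_assoc]
      rw [hc, star_mulVec, ← vecMulVec_mul, ← mul_vecMulVec, ← h3]
      simp only [Matrix.mul_assoc]
    rw [h1, h2]
    simp only [Matrix.mul_add, Matrix.add_mul, Matrix.mul_one, smul_add, Matrix.mul_smul,
      Matrix.smul_mul, Matrix.mul_assoc]
    abel
  set b := S.Uperpᴴ *ᵥ (G *ᵥ S.xp) with hb
  set ψ : ℂ × (Fin N → ℂ) → ℂ × ℂ × (Fin S.k → ℂ) := fun q =>
    ((e : ℂ) * (star b ⬝ᵥ (q.1 • b + S.Uperpᴴ *ᵥ q.2)),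
      q.1 - (e : ℂ) * (star b ⬝ᵥ (q.1 • b + S.Uperpᴴ *ᵥ q.2)), S.Uᴴ *ᵥ q.2) with hψ
  have mpψ : MeasurePreserving ψ ((cn (σ ^ 2)).prod (cnStd (Fin N)))
      ((cn (σ ^ 2 - e)).prod ((cn e).prod (cnStd (Fin S.k)))) :=
    map_estimate S.U_semiunitary S.Uperp_semiunitary S.U_mul_Uperp b hσ rfl
  set ρ := cnStd (Fin (N - 1))
  set ν := (cn (σ ^ 2)).prod (cnStd (Fin N))
  set ν' := (cn (σ ^ 2 - e)).prod ((cn e).prod (cnStd (Fin S.k)))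
  have mpΨ : MeasurePreserving (Prod.map id ψ) (ρ.prod ν) (ρ.prod ν') :=
    (MeasurePreserving.id ρ).prod mpψ
  set X : (Fin (N - 1) → ℂ) → Fin N → ℂ := fun g => (S.V * CFC.sqrt S.Qd) *ᵥ g + S.xp with hX
  have hXm : Measurable X := (measurable_mulVec _).add_const _
  have mpJ := measurePreserving_jointLaw (F := F) (G := G) (σ := σ) ρ hXm
  rw [← S.inputLaw_eq] at mpJ
  set dist : (Fin (N - 1) → ℂ) × ℂ × ℂ × (Fin S.k → ℂ) → Fin S.k → ℂ := fun q =>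
    q.2.2.1 • (A *ᵥ q.1 + c) + T *ᵥ q.2.2.2 with hdist
  set h : (Fin (N - 1) → ℂ) × ℂ × ℂ × (Fin S.k → ℂ) → ℝ := fun q =>
    logDet (K q.2.1) + qf (cov (K q.2.1))⁻¹ (K q.2.1 *ᵥ q.1 + dist q) - sqNorm (dist q) with hh
  have hdc : Continuous dist := by
    refine Continuous.add (Continuous.smul (continuous_fst.comp (continuous_snd.comp
      continuous_snd)) ((Continuous.matrix_mulVec
      continuous_const continuous_fst).add continuous_const)) (Continuous.matrix_mulVec
      continuous_const (continuous_snd.comp (continuous_snd.comp continuous_snd)))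
  -- The metric depends on the channel variables only through the data, the estimate, its error and
  -- `Uᴴ z`. These are independent, so means can be taken one variable at a time.
  have hlog : ∀ q, Real.log (S.metric σ (X q.1, (F + q.2.1 • G) *ᵥ X q.1 + q.2.2)) =
      h (Prod.map id ψ q) := by
    intro q
    rw [S.log_metric_output q.1 (x := X q.1) _ rfl,
      S.cleaned_output q.1 q.2.1 q.2.2 rfl, S.estimate_output]
    simp only [hh, hdist, Prod.map, hψ, id, hK, add_sub_cancel_left]
    rfl
  have hKq : Continuous fun q : (Fin (N - 1) → ℂ) × ℂ × ℂ × (Fin S.k → ℂ) => K q.2.1 :=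
    hKc.comp (by fun_prop)
  have hKdc : Continuous fun q : (Fin (N - 1) → ℂ) × ℂ × ℂ × (Fin S.k → ℂ) =>
      K q.2.1 *ᵥ q.1 + dist q := (hKq.matrix_mulVec continuous_fst).add hdc
  have hiter : ∀ f : (Fin (N - 1) → ℂ) × ℂ × ℂ × (Fin S.k → ℂ) → ℝ≥0∞, Measurable f →
      ∫⁻ q, f q ∂(ρ.prod ν') = ∫⁻ t, ∫⁻ g, ∫⁻ s, ∫⁻ n, f (g, t, s, n)
        ∂(cnStd (Fin S.k)) ∂(cn e) ∂ρ ∂(cn (σ ^ 2 - e)) := by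
    intro f hf
    rw [lintegral_prod _ hf.aemeasurable]
    have e1 : ∀ g, ∫⁻ q, f (g, q) ∂ν' = ∫⁻ t, ∫⁻ s, ∫⁻ n, f (g, t, s, n)
        ∂(cnStd (Fin S.k)) ∂(cn e) ∂(cn (σ ^ 2 - e)) := by
      intro g
      have hfg : Measurable fun q => f (g, q) := hf.comp measurable_prodMk_left
      refine (lintegral_prod _ hfg.aemeasurable).trans (lintegral_congr fun t => ?_)
      have hfgt : Measurable fun q => f (g, t, q) := hfg.comp measurable_prodMk_left
      exact lintegral_prod _ hfgt.aemeasurable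
    simp_rw [e1]
    rw [lintegral_lintegral_swap]
    have hm' : Measurable fun p : (((Fin (N - 1) → ℂ) × ℂ) × ℂ) × (Fin S.k → ℂ) =>
        f (p.1.1.1, p.1.1.2, p.1.2, p.2) := hf.comp (by fun_prop :
          Measurable fun p : (((Fin (N - 1) → ℂ) × ℂ) × ℂ) × (Fin S.k → ℂ) =>
            (p.1.1.1, p.1.1.2, p.1.2, p.2))
    exact hm'.lintegral_prod_right'.lintegral_prod_right'.aemeasurable
  obtain ⟨i1, m1⟩ : Integrable (fun q => sqNorm (dist q)) (ρ.prod ν') ∧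
      ∫ q, sqNorm (dist q) ∂(ρ.prod ν') = S.k := by
    refine hasIntegral_of_lintegral (by fun_prop) (fun q => sqNorm_nonneg _)
      (Nat.cast_nonneg _) ?_
    rw [hiter _ (by fun_prop)]
    -- With zero signal matrix and `M = 1` this is the mean squared norm of the whitened
    -- disturbance, its dimension `k`.
    have h1 := lintegral_qf_signal (PosSemidef.one (n := Fin S.k) (R := ℂ))
      (0 : Matrix (Fin S.k) (Fin (N - 1)) ℂ) A T c he.le hwhite
    have h2 : ((1 : Matrix (Fin S.k) (Fin S.k) ℂ) *
        cov (0 : Matrix (Fin S.k) (Fin (N - 1)) ℂ)).trace.re = S.k := by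
      simp [cov]
    rw [h2] at h1
    simp only [zero_mulVec, zero_add, qf_one] at h1
    refine (lintegral_congr fun t => h1).trans ?_
    rw [lintegral_const, measure_univ, mul_one]
  obtain ⟨i2, m2⟩ : Integrable (fun q => qf (cov (K q.2.1))⁻¹ (K q.2.1 *ᵥ q.1 + dist q))
      (ρ.prod ν') ∧
      ∫ q, qf (cov (K q.2.1))⁻¹ (K q.2.1 *ᵥ q.1 + dist q) ∂(ρ.prod ν') = S.k := by
    have hm := (continuous_qf_cov_inv hKq hKdc).measurable
    refine hasIntegral_of_lintegral hm (fun q => qf_cov_inv_nonneg _ _) (Nat.cast_nonneg _) ?_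
    rw [hiter _ hm.ennreal_ofReal]
    have h1 : ∀ t, ∫⁻ g, ∫⁻ s, ∫⁻ n, ENNReal.ofReal (qf (cov (K t))⁻¹
        (K t *ᵥ g + (s • (A *ᵥ g + c) + T *ᵥ n))) ∂(cnStd (Fin S.k)) ∂(cn e) ∂ρ =
        ENNReal.ofReal S.k := by
      intro t
      rw [lintegral_qf_signal (cov_inv_posSemidef (K t)) (K t) A T c he.le hwhite,
        nonsing_inv_mul _ (cov_posDef (K t)).det_pos.ne'.isUnit]
      simp
    refine (lintegral_congr fun t => h1 t).trans ?_
    rw [lintegral_const, measure_univ, mul_one]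
  have mp3 : MeasurePreserving (fun q : (Fin (N - 1) → ℂ) × ℂ × ℂ × (Fin S.k → ℂ) => q.2.1)
      (ρ.prod ν') (cn (σ ^ 2 - e)) := measurePreserving_fst.comp measurePreserving_snd
  have i30 : Integrable (fun s => logDet (K s)) (cn (σ ^ 2 - e)) := by
    have := integrable_logDet_affine (T * S.Uᴴ * F * S.V * CFC.sqrt S.Qd) A hv
    refine this.congr (ae_of_all _ fun s => ?_)
    simp only [hK, effChannel, hA, Matrix.mul_add, Matrix.add_mul, Matrix.mul_smul,
      Matrix.smul_mul]
    rfl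
  have i3 : Integrable (fun q : (Fin (N - 1) → ℂ) × ℂ × ℂ × (Fin S.k → ℂ) => logDet (K q.2.1))
      (ρ.prod ν') := mp3.integrable_comp_of_integrable i30
  have m3 : ∫ q : (Fin (N - 1) → ℂ) × ℂ × ℂ × (Fin S.k → ℂ), logDet (K q.2.1) ∂(ρ.prod ν') =
      ∫ s, logDet (K s) ∂(cn (σ ^ 2 - e)) := by
    have := integral_map (μ := ρ.prod ν') mp3.measurable.aemeasurable
      (continuous_logDet hKc).aestronglyMeasurable
    rw [mp3.map_eq] at this
    exact this.symm
  have i4 : Integrable h (ρ.prod ν') := (i3.add i2).sub i1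
  -- Both quadratic terms have mean `k` and cancel. No Gaussianity of the disturbance enters, only
  -- its covariance.
  have m4 : ∫ q, h q ∂(ρ.prod ν') = S.rate σ := by
    have i32 : Integrable (fun q => logDet (K q.2.1) +
      qf (cov (K q.2.1))⁻¹ (K q.2.1 *ᵥ q.1 + dist q)) (ρ.prod ν') := i3.add i2
    simp only [hh]
    rw [integral_sub i32 i1, integral_add i3 i2, m1, m2, m3, S.rate_eq hσ]
    simp
    rfl
  have hr : Integrable (fun p => Real.log (S.metric σ p)) (jointLaw F G σ S.inputLaw) := by
    rw [← mpJ.map_eq, integrable_map_measure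
      S.continuous_metric.measurable.log.aestronglyMeasurable mpJ.measurable.aemeasurable]
    refine (mpΨ.integrable_comp_of_integrable i4).congr (ae_of_all _ fun q => ?_)
    exact (hlog q).symm
  have hval : ∫ p, Real.log (S.metric σ p) ∂(jointLaw F G σ S.inputLaw) = S.rate σ := by
    rw [← mpJ.map_eq, integral_map mpJ.measurable.aemeasurable
      S.continuous_metric.measurable.log.aestronglyMeasurable, ← m4, ← mpΨ.map_eq,
      integral_map mpΨ.measurable.aemeasurable (by rw [mpΨ.map_eq]; exact i4.1)]
    exact integral_congr_ae (ae_of_all _ hlog)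
  rw [← hval]
  exact le_mutualInfo_of_metric hin.integrable hσ S.continuous_metric.measurable S.metric_pos
    S.lintegral_metric hr

end PilotScheme

end
end RankOneChannel
namespace RankOneChannel
noncomputable section

/-! ### Logarithmic moments of the determinant of an affine matrix pencil -/

lemma ae_ne_cn {v : ℝ} (hv : 0 < v) (l : ℂ) : ∀ᵐ s ∂(cn v), s ≠ l := by
  have hc : (Real.sqrt v : ℂ) ≠ 0 := by exact_mod_cast (Real.sqrt_pos.2 hv).ne'
  have h1 : ∀ᵐ z ∂(cn 1), z ≠ l / (Real.sqrt v : ℂ) := by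
    rw [cn_one_eq]
    refine (withDensity_absolutelyContinuous _ _).ae_le ?_
    exact compl_mem_ae_iff.2 (measure_singleton (μ := (volume : Measure ℂ)) _)
  rw [cn_eq_map hv.le]
  refine (ae_map_iff (p := fun s => s ≠ l) (by fun_prop) (measurableSet_singleton l).compl).2 ?_
  filter_upwards [h1] with z hz h
  exact hz ((eq_div_iff hc).2 (by rw [mul_comm]; exact h))

/-- The inverse distance to a point has a mean of order `1 / √v` under `CN(0, v)`. -/
lemma exists_hasIntegral_inv_norm_sub_le : ∃ K : ℝ, 0 ≤ K ∧ ∀ v : ℝ, 0 < v → ∀ l : ℂ,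
    Integrable (fun s => ‖s - l‖⁻¹) (cn v) ∧
      ∫ s, ‖s - l‖⁻¹ ∂(cn v) ≤ (Real.sqrt v)⁻¹ * K := by
  obtain ⟨K, hK⟩ := exists_lintegral_inv_norm_sub_le
  have h1 : ∀ l : ℂ, Integrable (fun s => ‖s - l‖⁻¹) (cn 1) := fun l => by
    refine ⟨Measurable.aestronglyMeasurable (by fun_prop), ?_⟩
    rw [hasFiniteIntegral_iff_ofReal (ae_of_all _ fun s => by positivity)]
    exact (hK l).trans_lt ENNReal.coe_lt_top
  have h2 : ∀ l : ℂ, ∫ s, ‖s - l‖⁻¹ ∂(cn 1) ≤ K := fun l => by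
    rw [integral_eq_lintegral_of_nonneg_ae (ae_of_all _ fun s => by positivity) (h1 l).1]
    exact ENNReal.toReal_le_coe_of_le_coe (hK l)
  refine ⟨K, K.2, fun v hv l => ?_⟩
  have hs := Real.sqrt_pos.2 hv
  have hc : (Real.sqrt v : ℂ) ≠ 0 := by exact_mod_cast hs.ne'
  have e : ∀ z : ℂ, ‖(Real.sqrt v : ℂ) * z - l‖⁻¹ =
      (Real.sqrt v)⁻¹ * ‖z - l / (Real.sqrt v : ℂ)‖⁻¹ := fun z => by
    have h : (Real.sqrt v : ℂ) * z - l = (Real.sqrt v : ℂ) * (z - l / (Real.sqrt v : ℂ)) := by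
      field_simp
    rw [h, norm_mul, mul_inv, Complex.norm_of_nonneg hs.le]
  rw [cn_eq_map hv.le, integrable_map_measure (Measurable.aestronglyMeasurable (by fun_prop))
    (by fun_prop), integral_map (by fun_prop) (Measurable.aestronglyMeasurable (by fun_prop))]
  simp only [Function.comp_def, e]
  refine ⟨(h1 _).const_mul _, ?_⟩
  rw [integral_const_mul]
  exact mul_le_mul_of_nonneg_left (h2 _) (by positivity)

lemma neg_inv_le_log {x : ℝ} (hx : 0 ≤ x) : -x⁻¹ ≤ Real.log x := by
  rcases hx.eq_or_lt with rfl | hx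
  -- At zero the conventions `0⁻¹ = 0` and `log 0 = 0` make this an equality.
  · simp
  · have := Real.one_sub_inv_le_log_of_pos hx
    linarith

/-- Factoring out `B` leaves the characteristic polynomial of `-B⁻¹ A` at `s`, which splits over
`ℂ`. -/
lemma exists_det_affine_eq {ι : Type*} [Fintype ι] [DecidableEq ι] (A B : Matrix ι ι ℂ)
    (hB : IsUnit B.det) : ∃ R : Multiset ℂ, ∀ s : ℂ,
      (A + s • B).det = B.det * (R.map fun l => s - l).prod := by
  refine ⟨(-(B⁻¹ * A)).charpoly.roots, fun s => ?_⟩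
  have h1 : A + s • B = B * (scalar ι s - -(B⁻¹ * A)) := by
    rw [sub_neg_eq_add, Matrix.mul_add, ← Matrix.mul_assoc, mul_nonsing_inv _ hB, Matrix.one_mul,
      scalar_apply, ← smul_one_eq_diagonal, Matrix.mul_smul, Matrix.mul_one, add_comm]
  have h2 := IsAlgClosed.splits (-(B⁻¹ * A)).charpoly
  have h3 := h2.eq_prod_roots_of_monic (charpoly_monic _)
  rw [h1, det_mul, ← eval_charpoly]
  congr 1
  conv_lhs => rw [h3]
  rw [Polynomial.eval_multiset_prod, Multiset.map_map]
  simp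

/-- Under `CN(0, v)`, a function exceeding `a + log |det (A + s B)|²` has mean at least `a - K`,
with `K` uniform over `v` bounded away from `0`. -/
lemma exists_integral_ge_of_log_det_le {ι : Type*} [Fintype ι] [DecidableEq ι]
    (A B : Matrix ι ι ℂ) (hB : IsUnit B.det) {v₀ : ℝ} (hv₀ : 0 < v₀) :
    ∃ K : ℝ, ∀ v, v₀ ≤ v → ∀ f : ℂ → ℝ, Integrable f (cn v) → ∀ a : ℝ,
      (∀ s, (A + s • B).det ≠ 0 → a + Real.log (‖(A + s • B).det‖ ^ 2) ≤ f s) →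
      a - K ≤ ∫ s, f s ∂(cn v) := by
  obtain ⟨R, hR⟩ := exists_det_affine_eq A B hB
  obtain ⟨C, hC, hI⟩ := exists_hasIntegral_inv_norm_sub_le
  have hlog : ∀ (T : Multiset ℂ) (s : ℂ), (T.map fun l => s - l).prod ≠ 0 →
      -(T.map fun l => ‖s - l‖⁻¹).sum ≤ Real.log ‖(T.map fun l => s - l).prod‖ := by
    intro T s
    induction T using Multiset.induction_on with
    | empty => simp
    | cons l T ih =>
      intro h
      simp only [Multiset.map_cons, Multiset.prod_cons, Multiset.sum_cons] at h ⊢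
      have h1 := neg_inv_le_log (norm_nonneg (s - l))
      have h2 := ih (right_ne_zero_of_mul h)
      rw [norm_mul, Real.log_mul (norm_ne_zero_iff.2 (left_ne_zero_of_mul h))
        (norm_ne_zero_iff.2 (right_ne_zero_of_mul h))]
      linarith
  have hint : ∀ (T : Multiset ℂ) (v : ℝ), v₀ ≤ v →
      Integrable (fun s => (T.map fun l => ‖s - l‖⁻¹).sum) (cn v) ∧
        ∫ s, (T.map fun l => ‖s - l‖⁻¹).sum ∂(cn v) ≤ T.card * ((Real.sqrt v₀)⁻¹ * C) := by
    intro T v hv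
    induction T using Multiset.induction_on with
    | empty => simp
    | cons l T ih =>
      simp only [Multiset.map_cons, Multiset.sum_cons, Multiset.card_cons]
      have h := hI v (hv₀.trans_le hv) l
      refine ⟨h.1.add ih.1, ?_⟩
      rw [integral_add h.1 ih.1]
      have h1 : (Real.sqrt v)⁻¹ * C ≤ (Real.sqrt v₀)⁻¹ * C :=
        mul_le_mul_of_nonneg_right
          (inv_anti₀ (Real.sqrt_pos.2 hv₀) (Real.sqrt_le_sqrt hv)) hC
      push_cast
      linarith [h.2, ih.2]
  have hae : ∀ (T : Multiset ℂ) (v : ℝ), 0 < v →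
      ∀ᵐ s ∂(cn v), (T.map fun l => s - l).prod ≠ 0 := by
    intro T v hv
    induction T using Multiset.induction_on with
    | empty => simp
    | cons l T ih =>
      filter_upwards [ae_ne_cn hv l, ih] with s h1 h2
      rw [Multiset.map_cons, Multiset.prod_cons]
      exact mul_ne_zero (sub_ne_zero.2 h1) h2
  have hB0 := hB.ne_zero
  -- `log |det (A + s B)|²` equals `2 log |det B| + 2 ∑ log |s - l|` off the roots. Each summand is
  -- at least `-|s - l|⁻¹`, whose mean is at least `-C/√v₀`.
  refine ⟨2 * (R.card * ((Real.sqrt v₀)⁻¹ * C)) - 2 * Real.log ‖B.det‖, fun v hv f hf a h => ?_⟩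
  obtain ⟨i1, m1⟩ := hint R v hv
  have i2 := (integrable_const (μ := cn v) (a + 2 * Real.log ‖B.det‖)).sub (i1.const_mul 2)
  have h1 : ∫ s, ((a + 2 * Real.log ‖B.det‖) - 2 * (R.map fun l => ‖s - l‖⁻¹).sum) ∂(cn v) ≤
      ∫ s, f s ∂(cn v) := by
    refine integral_mono_ae i2 hf ?_
    filter_upwards [hae R v (hv₀.trans_le hv)] with s hs
    have h2 : (A + s • B).det ≠ 0 := by rw [hR]; exact mul_ne_zero hB0 hs
    have h3 := hlog R s hs
    have h4 := h s h2
    rw [hR, norm_mul, Real.log_pow, Real.log_mul (norm_ne_zero_iff.2 hB0)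
      (norm_ne_zero_iff.2 hs)] at h4
    push_cast at h4
    linarith
  rw [integral_sub (integrable_const _) (i1.const_mul 2), integral_const_mul] at h1
  simp only [integral_const, probReal_univ, one_smul] at h1
  linarith

/-- In terms of the eigenvalues of `Kᴴ K` this is `∏ d ≤ ∏ (1 + d)`: the noise is dropped, which
costs little at high power. -/
lemma norm_sq_det_le {ι : Type*} [Fintype ι] [DecidableEq ι] (K : Matrix ι ι ℂ) :
    ‖K.det‖ ^ 2 ≤ (cov K).det.re := by
  obtain ⟨W, d, hW, hd, hK⟩ := exists_diagonalization K
  have hWn : ‖W.det‖ ^ 2 = 1 := by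
    have := congrArg Matrix.det hW
    rw [det_mul, det_conjTranspose, RCLike.star_def, Complex.mul_conj', det_one] at this
    exact_mod_cast this
  have h1 : ((‖K.det‖ ^ 2 : ℝ) : ℂ) = ((∏ i, d i : ℝ) : ℂ) := by
    have := congrArg Matrix.det hK
    rw [det_mul, det_conjTranspose, RCLike.star_def, Complex.conj_mul', det_diagonal, det_mul,
      norm_mul] at this
    push_cast
    rw [← this]
    have hWn' : (‖W.det‖ : ℂ) ^ 2 = 1 := by exact_mod_cast hWn
    push_cast
    rw [mul_pow, hWn', mul_one]
  rw [← cov_mul_unitary K hW, det_cov_of_diagonal hK, Complex.ofReal_injective h1]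
  exact Finset.prod_le_prod (fun i _ => hd i) fun i _ => by linarith

lemma log_norm_sq_det_le {ι : Type*} [Fintype ι] [DecidableEq ι] {K : Matrix ι ι ℂ}
    (hK : K.det ≠ 0) : Real.log (‖K.det‖ ^ 2) ≤ logDet K := by
  have := norm_pos_iff.2 hK
  exact Real.log_le_log (by positivity) (norm_sq_det_le K)

lemma norm_sq_det_sqrt {ι : Type*} [Fintype ι] [DecidableEq ι] {Q : Matrix ι ι ℂ}
    (hQ : Q.PosSemidef) : ‖(CFC.sqrt Q).det‖ ^ 2 = ‖Q.det‖ := by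
  conv_rhs => rw [← sqrt_mul_conjTranspose_sqrt hQ]
  rw [det_mul, det_conjTranspose, norm_mul, norm_star, sq]

lemma log_det_one_add_le {ι : Type*} [Fintype ι] [DecidableEq ι] {M : Matrix ι ι ℂ}
    (hM : M.PosSemidef) : Real.log (1 + M).det.re ≤ M.trace.re := by
  have := logDet_le (CFC.sqrt M)
  rwa [logDet, cov, sqrt_mul_conjTranspose_sqrt hM] at this

/-- Multiplicativity of the determinant pulls `T` and `Q` out of the mean. The constant depends only
on the pencil and `v₀`, although `T`, `Q` and `v` all vary with `P`. -/
lemma exists_le_integral_logDet {ι : Type*} [Fintype ι] [DecidableEq ι]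
    (A B : Matrix ι ι ℂ) (hB : IsUnit B.det) {v₀ : ℝ} (hv₀ : 0 < v₀) :
    ∃ K : ℝ, ∀ v, v₀ ≤ v → ∀ T Q : Matrix ι ι ℂ, T.det ≠ 0 → Q.PosSemidef → Q.det ≠ 0 →
      Real.log (‖T.det‖ ^ 2) + Real.log ‖Q.det‖ - K ≤
        ∫ s, logDet (T * (A + s • B) * CFC.sqrt Q) ∂(cn v) := by
  obtain ⟨K, hK⟩ := exists_integral_ge_of_log_det_le A B hB hv₀
  refine ⟨K, fun v hv T Q hT hQ hQd => hK v hv _ ?_ _ fun s hs => ?_⟩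
  · have := integrable_logDet_affine (T * A * CFC.sqrt Q) (T * B * CFC.sqrt Q) (hv₀.le.trans hv)
    simpa only [Matrix.mul_add, Matrix.mul_smul, Matrix.add_mul, Matrix.smul_mul] using this
  · have hS := norm_sq_det_sqrt hQ
    have hQ0 := norm_pos_iff.2 hQd
    have hS0 : (CFC.sqrt Q).det ≠ 0 := fun h => by
      rw [h, norm_zero, zero_pow two_ne_zero] at hS
      exact hQ0.ne hS
    have h := log_norm_sq_det_le (K := T * (A + s • B) * CFC.sqrt Q) (by
      rw [det_mul, det_mul]; exact mul_ne_zero (mul_ne_zero hT hs) hS0)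
    have hT' := norm_pos_iff.2 hT
    have hs' := norm_pos_iff.2 hs
    rw [det_mul, det_mul, norm_mul, norm_mul, mul_pow, mul_pow, hS,
      Real.log_mul (by positivity) hQ0.ne', Real.log_mul (by positivity) (by positivity)] at h
    linarith

end
end RankOneChannel
namespace RankOneChannel
noncomputable section

variable {N : ℕ} {F G : Matrix (Fin N) (Fin N) ℂ} {σ : ℝ}

/-! ### Growth of the bounds -/

/-- Both traces are mean squared norms of Gaussian vectors with the same `g`, so a pointwise
operator bound suffices. -/
lemma exists_re_trace_conj_le {ι κ : Type*} [Fintype ι] [Fintype κ] [DecidableEq κ]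
    (A : Matrix ι κ ℂ) :
    ∃ C : ℝ, 0 ≤ C ∧ ∀ Q : Matrix κ κ ℂ, Q.PosSemidef →
      (A * Q * Aᴴ).trace.re ≤ C * Q.trace.re := by
  obtain ⟨C, hC, h⟩ := exists_sqNorm_mulVec_le A
  refine ⟨C, hC, fun Q hQ => ?_⟩
  set T := CFC.sqrt Q
  have hT : T * Tᴴ = Q := sqrt_mul_conjTranspose_sqrt hQ
  have hAT : A * Q * Aᴴ = (A * T) * (A * T)ᴴ := by
    rw [conjTranspose_mul, ← hT]; simp only [Matrix.mul_assoc]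
  obtain ⟨i1, m1⟩ := hasIntegral_sqNorm_affine (A * T) 0
  obtain ⟨i2, m2⟩ := hasIntegral_sqNorm_affine T 0
  simp only [add_zero, sqNorm_zero] at i1 m1 i2 m2
  rw [hAT, ← hT, ← m1, ← m2, ← integral_const_mul]
  refine integral_mono i1 (i2.const_mul C) fun g => ?_
  simp only [← mulVec_mulVec]
  exact h _

lemma re_trace_conj_nonneg {ι κ : Type*} [Fintype ι] [Fintype κ] (A : Matrix ι κ ℂ)
    {Q : Matrix κ κ ℂ} (hQ : Q.PosSemidef) : 0 ≤ (A * Q * Aᴴ).trace.re :=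
  re_trace_nonneg (hQ.mul_mul_conjTranspose_same A)

lemma le_meanGam {Q : Matrix (Fin N) (Fin N) ℂ} (hQ : Q.PosSemidef) :
    (N : ℝ) ≤ meanGam F G σ 1 Q := by
  have h1 := re_trace_conj_nonneg F hQ
  have h2 := mul_nonneg (sq_nonneg σ) (re_trace_conj_nonneg G hQ)
  rw [meanGam_one]
  linarith

lemma exists_closedBound_le (hN : 2 ≤ N) : ∃ K : ℝ, ∀ P : ℝ, 1 ≤ P → ∀ Q ∈ covSet N P,
    closedBound F G σ Q ≤ ((N : ℝ) - 1) * Real.log P + K := by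
  obtain ⟨C, hC, hF⟩ := exists_re_trace_conj_le F
  obtain ⟨D, hD, hG⟩ := exists_re_trace_conj_le G
  have hN2 : (2 : ℝ) ≤ N := by exact_mod_cast hN
  have hN1 : (0 : ℝ) < (N : ℝ) - 1 := by linarith
  refine ⟨((N : ℝ) - 1) * Real.log ((N + C + σ ^ 2 * D) / ((N : ℝ) - 1)) +
    Real.log (1 / ((N : ℝ) - 1)) - 1 + Real.log (ratioBound F G σ), fun P hP Q hQ => ?_⟩
  have hm : meanGam F G σ 1 Q ≤ P * (N + C + σ ^ 2 * D) := by
    have h1 := (hF Q hQ.1).trans (mul_le_mul_of_nonneg_left hQ.2 hC)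
    have h2 := mul_le_mul_of_nonneg_left
      ((hG Q hQ.1).trans (mul_le_mul_of_nonneg_left hQ.2 hD)) (sq_nonneg σ)
    have h3 : (N : ℝ) ≤ P * N := le_mul_of_one_le_left (by linarith) hP
    rw [meanGam_one]
    linarith
  have hp : 0 < meanGam F G σ 1 Q := by
    have := le_meanGam (F := F) (G := G) (σ := σ) hQ.1
    linarith
  have hE : 0 < (N + C + σ ^ 2 * D) / ((N : ℝ) - 1) := by positivity
  have hl : Real.log (meanGam F G σ 1 Q / ((N : ℝ) - 1)) ≤
      Real.log P + Real.log ((N + C + σ ^ 2 * D) / ((N : ℝ) - 1)) := by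
    rw [← Real.log_mul (by linarith) hE.ne', ← mul_div_assoc]
    exact Real.log_le_log (by positivity) (div_le_div_of_nonneg_right hm hN1.le)
  have := mul_le_mul_of_nonneg_left hl hN1.le
  rw [closedBound_eq]
  linarith

/-- The isotropic input covariance of total power `P`. -/
def isotropic (N : ℕ) (P : ℝ) : Matrix (Fin N) (Fin N) ℂ := ((P / N : ℝ) : ℂ) • 1

lemma smul_one_posSemidef {ι : Type*} [Fintype ι] [DecidableEq ι] {c : ℝ} (hc : 0 ≤ c) :
    ((c : ℂ) • (1 : Matrix ι ι ℂ)).PosSemidef :=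
  PosSemidef.one.smul (by exact_mod_cast hc)

lemma norm_det_smul_one {ι : Type*} [Fintype ι] [DecidableEq ι] {c : ℝ} (hc : 0 ≤ c) :
    ‖((c : ℂ) • (1 : Matrix ι ι ℂ)).det‖ = c ^ Fintype.card ι := by
  rw [det_smul, det_one, mul_one, norm_pow, Complex.norm_of_nonneg hc]

lemma isotropic_mem_covSet (hN : 0 < N) {P : ℝ} (hP : 0 ≤ P) : isotropic N P ∈ covSet N P := by
  refine ⟨smul_one_posSemidef (by positivity), ?_⟩
  have : (N : ℝ) ≠ 0 := by exact_mod_cast hN.ne'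
  rw [isotropic, trace_smul, trace_one, smul_eq_mul, Complex.re_ofReal_mul, Fintype.card_fin,
    Complex.natCast_re, div_mul_cancel₀ _ this]

lemma re_trace_conj_isotropic (A : Matrix (Fin N) (Fin N) ℂ) (P : ℝ) :
    (A * isotropic N P * Aᴴ).trace.re = P / N * (A * Aᴴ).trace.re := by
  rw [isotropic, Matrix.mul_smul, Matrix.smul_mul, Matrix.mul_one, trace_smul, smul_eq_mul,
    Complex.re_ofReal_mul]

lemma re_trace_mul_conjTranspose_pos (hN : 0 < N) (hG : IsUnit G.det) :
    0 < (G * Gᴴ).trace.re := by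
  rw [re_trace_mul_conjTranspose]
  refine Finset.sum_pos (fun i _ => sqNorm_pos fun h => hG.ne_zero ?_) ⟨⟨0, hN⟩, Finset.mem_univ _⟩
  exact det_eq_zero_of_row_eq_zero i fun j => congrFun h j

/-- Only the `G` part of the mean output power and the nonnegativity of the ball supremum are kept,
so the constant is independent of `r`. -/
lemma exists_le_dualityBound (hN : 2 ≤ N) (hG : IsUnit G.det) (hσ : 0 < σ) :
    ∃ K : ℝ, ∀ P : ℝ, 1 ≤ P → ∀ r,
      ((N : ℝ) - 1) * Real.log P - K ≤ dualityBound F G σ r ((N : ℝ) - 1) 1 (isotropic N P) := by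
  have hN2 : (2 : ℝ) ≤ N := by exact_mod_cast hN
  have hN1 : (0 : ℝ) < (N : ℝ) - 1 := by linarith
  have ht := re_trace_mul_conjTranspose_pos (by omega) hG
  set E := σ ^ 2 * ((G * Gᴴ).trace.re / N) / ((N : ℝ) - 1) with hE
  have hE0 : 0 < E := by positivity
  refine ⟨-(((N : ℝ) - 1) * Real.log E + Real.log (1 / ((N : ℝ) - 1)) - 1), fun P hP r => ?_⟩
  have hP0 : 0 < P := by linarith
  have hl : Real.log P + Real.log E ≤
      Real.log (meanGam F G σ 1 (isotropic N P) / ((N : ℝ) - 1)) := by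
    rw [← Real.log_mul hP0.ne' hE0.ne']
    refine Real.log_le_log (by positivity) ?_
    rw [hE, ← mul_div_assoc]
    refine div_le_div_of_nonneg_right ?_ hN1.le
    have := re_trace_conj_nonneg F (isotropic_mem_covSet (N := N) (by omega) hP0.le).1
    rw [meanGam_one, re_trace_conj_isotropic G]
    have e : P * (σ ^ 2 * ((G * Gᴴ).trace.re / N)) = σ ^ 2 * (P / N * (G * Gᴴ).trace.re) := by
      ring
    linarith
  have := mul_le_mul_of_nonneg_left hl hN1.le
  have h2 := ballSup_nonneg (F := F) (by omega) hG hσ r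
  rw [dualityBound_eq hN]
  linarith

/-- With isotropic input the determinant supplies `N log P` and the fading penalty removes one `log
P`. -/
lemma exists_le_gaussianRate (hN : 2 ≤ N) (hG : IsUnit G.det) (hσ : 0 < σ) :
    ∃ K : ℝ, ∀ P : ℝ, 1 ≤ P →
      ((N : ℝ) - 1) * Real.log P - K ≤ gaussianRate F G σ (isotropic N P) := by
  obtain ⟨K, hK⟩ := exists_le_integral_logDet F G hG (pow_pos hσ 2)
  have hN2 : (2 : ℝ) ≤ N := by exact_mod_cast hN
  have ht := re_trace_mul_conjTranspose_pos (by omega) hG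
  set E := 1 + σ ^ 2 * ((G * Gᴴ).trace.re / N) with hE
  have hE0 : 0 < E := by positivity
  refine ⟨K + Real.log E + N * Real.log N, fun P hP => ?_⟩
  have hP0 : 0 < P := by linarith
  have hQ := (isotropic_mem_covSet (N := N) (by omega) hP0.le).1
  have hPN : 0 < P / N := by positivity
  have hd : ‖(isotropic N P).det‖ = (P / N) ^ N := by
    rw [isotropic, norm_det_smul_one hPN.le, Fintype.card_fin]
  have h1 := hK (σ ^ 2) le_rfl 1 _ (by simp) hQ
    (norm_pos_iff.1 (by rw [hd]; positivity))
  simp only [det_one, norm_one, one_pow, Real.log_one, zero_add, Matrix.one_mul] at h1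
  have hl : Real.log (1 + σ ^ 2 * (G * isotropic N P * Gᴴ).trace.re) ≤ Real.log P + Real.log E := by
    rw [← Real.log_mul hP0.ne' hE0.ne', re_trace_conj_isotropic]
    refine Real.log_le_log (by positivity) ?_
    rw [hE]
    have e : P * (1 + σ ^ 2 * ((G * Gᴴ).trace.re / N)) =
      P + σ ^ 2 * (P / N * (G * Gᴴ).trace.re) := by ring
    linarith
  rw [gaussianRate_eq hQ]
  rw [hd, Real.log_pow, Real.log_div hP0.ne' (by positivity)] at h1
  linarith

end
end RankOneChannel
namespace RankOneChannel
noncomputable section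

/-! ### Aligned subspaces -/

/-- A unit vector has an orthonormal complement. -/
lemma exists_orthonormal_complement {N : ℕ} (hN : 0 < N) {u : Fin N → ℂ} (hu : sqNorm u = 1) :
    ∃ V : Matrix (Fin N) (Fin (N - 1)) ℂ, Vᴴ * V = 1 ∧ Vᴴ *ᵥ u = 0 ∧
      V * Vᴴ = 1 - vecMulVec u (star u) := by
  obtain ⟨n, rfl⟩ : ∃ n, N = n + 1 := ⟨N - 1, by omega⟩
  change ∃ V : Matrix (Fin (n + 1)) (Fin n) ℂ, _
  have huu : star u ⬝ᵥ u = 1 := by rw [star_dotProduct_self, hu]; simp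
  -- Place `u` as vector `0` of an orthonormal basis. The remaining vectors are the columns sought,
  -- and completeness of the basis gives `V Vᴴ = 1 - u uᴴ`.
  obtain ⟨b, hb⟩ := Orthonormal.exists_orthonormalBasis_extension_of_card_eq (𝕜 := ℂ)
    (E := EuclideanSpace ℂ (Fin (n + 1))) (ι := Fin (n + 1)) (by simp)
    (v := fun _ => WithLp.toLp 2 u) (s := {0}) (by
      refine ⟨fun i => ?_, fun i j hij => absurd (Subsingleton.elim i j) hij⟩
      have : ‖WithLp.toLp 2 u‖ ^ 2 = 1 := by rw [EuclideanSpace.norm_sq_eq]; exact hu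
      exact (pow_eq_one_iff_of_nonneg (norm_nonneg _) two_ne_zero).1 this)
  set W : Matrix (Fin (n + 1)) (Fin (n + 1)) ℂ := Matrix.of fun i j => b j i with hW
  have hW0 : ∀ i, W i 0 = u i := fun i => by
    have := congrArg (fun x : EuclideanSpace ℂ (Fin (n + 1)) => x i) (hb 0 rfl)
    exact this
  have hWW : Wᴴ * W = 1 := by
    ext i j
    have := orthonormal_iff_ite.1 b.orthonormal i j
    rw [EuclideanSpace.inner_eq_star_dotProduct, dotProduct_comm] at this
    rw [one_apply, ← this]
    rfl
  have hWW' : W * Wᴴ = 1 := mul_eq_one_comm.1 hWW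
  refine ⟨W.submatrix id Fin.succ, ?_, ?_, ?_⟩
  · ext i j
    have := congrFun (congrFun hWW i.succ) j.succ
    rw [one_apply] at this
    simp only [Fin.succ_inj] at this
    rw [one_apply, ← this]
    rfl
  · ext i
    have := congrFun (congrFun hWW i.succ) 0
    rw [one_apply, if_neg (Fin.succ_ne_zero i)] at this
    rw [Pi.zero_apply, ← this, mulVec, dotProduct, mul_apply]
    refine Finset.sum_congr rfl fun k _ => ?_
    rw [hW0]
    rfl
  · ext i j
    have := congrFun (congrFun hWW' i) j
    rw [mul_apply, Fin.sum_univ_succ] at this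
    rw [Matrix.sub_apply, ← this, vecMulVec_apply, conjTranspose_apply, hW0, hW0, Pi.star_apply,
      add_sub_cancel_left, mul_apply]
    rfl

lemma exists_unit_eigenvector {N : ℕ} (hN : 0 < N) (A : Matrix (Fin N) (Fin N) ℂ) :
    ∃ (μ : ℂ) (u : Fin N → ℂ), sqNorm u = 1 ∧ A *ᵥ u = μ • u := by
  have : Nonempty (Fin N) := ⟨⟨0, hN⟩⟩
  obtain ⟨μ, hμ⟩ := Module.End.exists_eigenvalue (toLin' A)
  obtain ⟨v, hv⟩ := hμ.exists_hasEigenvector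
  have h1 : A *ᵥ v = μ • v := by rw [← toLin'_apply]; exact hv.apply_eq_smul
  have h2 := sqNorm_pos hv.2
  have h3 := Real.sqrt_pos.2 h2
  refine ⟨μ, (((Real.sqrt (sqNorm v))⁻¹ : ℝ) : ℂ) • v, ?_, ?_⟩
  · rw [sqNorm_smul, Complex.norm_of_nonneg (by positivity), inv_pow, Real.sq_sqrt h2.le,
      inv_mul_cancel₀ h2.ne']
  · rw [mulVec_smul, h1, smul_comm]

lemma range_le_of_eq_mul {m k p : Type*} [Fintype m] [Fintype k] [Fintype p]
    {U : Matrix m k ℂ} {M : Matrix m p ℂ} (C : Matrix p k ℂ) (h : U = M * C) :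
    LinearMap.range U.mulVecLin ≤ LinearMap.range M.mulVecLin := by
  rintro _ ⟨x, rfl⟩
  refine ⟨C *ᵥ x, ?_⟩
  rw [mulVecLin_apply, mulVecLin_apply, mulVec_mulVec, h]

/-- For every channel with invertible `G` there is a precoder whose image under the whole pencil
lies in a fixed hyperplane, and a direction that the channel moves out of it. -/
lemma exists_alignment {N : ℕ} (hN : 0 < N) (F : Matrix (Fin N) (Fin N) ℂ)
    {G : Matrix (Fin N) (Fin N) ℂ} (hG : IsUnit G.det) :
    ∃ (V U : Matrix (Fin N) (Fin (N - 1)) ℂ) (W : Matrix (Fin N) (Fin 1) ℂ) (u : Fin N → ℂ),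
      Vᴴ * V = 1 ∧ Uᴴ * U = 1 ∧ Wᴴ * W = 1 ∧ sqNorm u = 1 ∧
      LinearMap.range U.mulVecLin = LinearMap.range (fromCols (F * V) (G * V)).mulVecLin ∧
      LinearMap.range W.mulVecLin = LinearMap.ker ((fromCols (F * V) (G * V))ᴴ).mulVecLin ∧
      Wᴴ *ᵥ (G *ᵥ u) ≠ 0 ∧ IsUnit (Uᴴ * G * V).det := by
  -- As `u` is an eigenvector of the adjoint, its orthogonal complement is invariant under `G⁻¹ F`.
  -- Hence `F V` factors through `G V`, and the joint span is the image under `G` of that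
  -- complement: a hyperplane with unit normal `q` proportional to `(G⁻¹)ᴴ u`.
  obtain ⟨μ, u, hu, hμ⟩ := exists_unit_eigenvector hN (G⁻¹ * F)ᴴ
  obtain ⟨V, hV, hVu, hVV⟩ := exists_orthonormal_complement hN hu
  have huu : star u ⬝ᵥ u = 1 := by rw [star_dotProduct_self, hu]; simp
  have hGi : G * G⁻¹ = 1 := mul_nonsing_inv _ hG
  have hGi' : G⁻¹ * G = 1 := nonsing_inv_mul _ hG
  set w := (G⁻¹)ᴴ *ᵥ u with hw
  have hGw : Gᴴ *ᵥ w = u := by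
    rw [hw, mulVec_mulVec, ← conjTranspose_mul, hGi', conjTranspose_one, one_mulVec]
  have hw0 : 0 < sqNorm w := sqNorm_pos fun h => by
    rw [h, mulVec_zero] at hGw
    rw [← hGw, sqNorm_zero] at hu
    exact zero_ne_one hu
  set c : ℝ := (Real.sqrt (sqNorm w))⁻¹ with hc
  have hc0 : 0 < c := inv_pos.2 (Real.sqrt_pos.2 hw0)
  have hcC : (c : ℂ) ≠ 0 := by exact_mod_cast hc0.ne'
  obtain ⟨q, hq⟩ : ∃ q : Fin N → ℂ, q = (c : ℂ) • w := ⟨_, rfl⟩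
  have hq1 : sqNorm q = 1 := by
    rw [hq, sqNorm_smul, Complex.norm_of_nonneg hc0.le, hc, inv_pow, Real.sq_sqrt hw0.le,
      inv_mul_cancel₀ hw0.ne']
  have hGq : Gᴴ *ᵥ q = (c : ℂ) • u := by rw [hq, mulVec_smul, hGw]
  have hqG : star q ᵥ* G = (c : ℂ) • star u := by
    have := congrArg star hGq
    rwa [star_mulVec, conjTranspose_conjTranspose, star_smul, Complex.star_def,
      Complex.conj_ofReal] at this
  obtain ⟨U, hU, hUq, hUU⟩ := exists_orthonormal_complement hN hq1
  have hVu' : star u ᵥ* V = 0 := by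
    have := congrArg star hVu
    rwa [star_mulVec, conjTranspose_conjTranspose, star_zero] at this
  have hUq' : star q ᵥ* U = 0 := by
    have := congrArg star hUq
    rwa [star_mulVec, conjTranspose_conjTranspose, star_zero] at this
  have hvz : ∀ x : Fin N → ℂ, vecMulVec x (0 : Fin (N - 1) → ℂ) = 0 := fun x => by
    ext; simp [vecMulVec_apply]
  have hF : F * V = G * V * (Vᴴ * (G⁻¹ * F) * V) := by
    have h1 : V * Vᴴ * ((G⁻¹ * F) * V) = (G⁻¹ * F) * V := by
      have h2 : star u ᵥ* (G⁻¹ * F) = star μ • star u := by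
        have := congrArg star hμ
        rwa [star_mulVec, conjTranspose_conjTranspose, star_smul] at this
      rw [hVV, Matrix.sub_mul, Matrix.one_mul, vecMulVec_mul, ← vecMul_vecMul, h2, smul_vecMul,
        hVu', smul_zero, hvz, sub_zero]
    calc F * V = G * ((G⁻¹ * F) * V) := by
          rw [← Matrix.mul_assoc, ← Matrix.mul_assoc, hGi, Matrix.one_mul]
      _ = _ := by rw [← h1]; simp only [Matrix.mul_assoc]
  have hUG : U * Uᴴ * (G * V) = G * V := by
    rw [hUU, Matrix.sub_mul, Matrix.one_mul, vecMulVec_mul, ← vecMul_vecMul, hqG, smul_vecMul,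
      hVu', smul_zero, hvz, sub_zero]
  have hGU : G * V * (Vᴴ * G⁻¹ * U) = U := by
    have h1 : star u ᵥ* G⁻¹ = (c : ℂ)⁻¹ • star q := by
      rw [eq_inv_smul_iff₀ hcC, ← smul_vecMul, ← hqG, vecMul_vecMul, hGi, vecMul_one]
    calc G * V * (Vᴴ * G⁻¹ * U) = G * (V * Vᴴ * (G⁻¹ * U)) := by simp only [Matrix.mul_assoc]
      _ = G * (G⁻¹ * U) := by
        rw [hVV, Matrix.sub_mul, Matrix.one_mul, vecMulVec_mul, ← vecMul_vecMul, h1, smul_vecMul,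
          hUq', smul_zero, hvz, sub_zero]
      _ = U := by rw [← Matrix.mul_assoc, hGi, Matrix.one_mul]
  have hcols : fromCols (F * V) (G * V) =
      U * fromCols (Uᴴ * (F * V)) (Uᴴ * (G * V)) := by
    have hUF : U * Uᴴ * (F * V) = F * V := by rw [hF, ← Matrix.mul_assoc, hUG]
    rw [mul_fromCols, ← Matrix.mul_assoc, ← Matrix.mul_assoc U, hUG, hUF]
  obtain ⟨D, hD⟩ : ∃ D : Matrix (Fin (N - 1) ⊕ Fin (N - 1)) (Fin (N - 1)) ℂ,
      fromCols (F * V) (G * V) * D = U := by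
    refine ⟨fromRows (0 : Matrix (Fin (N - 1)) (Fin (N - 1)) ℂ) (Vᴴ * G⁻¹ * U), ?_⟩
    rw [fromCols_mul_fromRows, Matrix.mul_zero, zero_add, hGU]
  set W : Matrix (Fin N) (Fin 1) ℂ := Matrix.of fun i _ => q i with hWdef
  have hWv : ∀ y : Fin 1 → ℂ, W *ᵥ y = y 0 • q := fun y => by
    ext i
    simp [W, mulVec, dotProduct, mul_comm]
  refine ⟨V, U, W, u, hV, hU, ?_, hu, ?_, ?_, ?_, ?_⟩
  · ext i j
    have : star q ⬝ᵥ q = 1 := by rw [star_dotProduct_self, hq1]; simp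
    rw [Subsingleton.elim i 0, Subsingleton.elim j 0, one_apply_eq, ← this]
    rfl
  · exact le_antisymm (range_le_of_eq_mul D hD.symm) (range_le_of_eq_mul _ hcols)
  · apply le_antisymm
    · rintro _ ⟨y, rfl⟩
      rw [LinearMap.mem_ker, mulVecLin_apply, mulVecLin_apply, hcols, conjTranspose_mul,
        ← mulVec_mulVec, hWv, mulVec_smul, hUq, smul_zero, mulVec_zero]
    · intro y hy
      rw [LinearMap.mem_ker, mulVecLin_apply] at hy
      have h1 : Uᴴ *ᵥ y = 0 := by
        rw [← hD, conjTranspose_mul, ← mulVec_mulVec, hy, mulVec_zero]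
      refine ⟨fun _ => star q ⬝ᵥ y, ?_⟩
      have h3 : (U * Uᴴ) *ᵥ y = 0 := by rw [← mulVec_mulVec, h1, mulVec_zero]
      rw [hUU, sub_mulVec, one_mulVec, vecMulVec_mulVec, sub_eq_zero] at h3
      rw [mulVecLin_apply, hWv]
      conv_rhs => rw [h3]
      ext i
      simp [mul_comm]
  -- A pilot along `u` leaves the hyperplane, since `qᴴ G u = c ≠ 0`.
  · intro h
    have h1 := congrFun h 0
    have h2 : (Wᴴ *ᵥ (G *ᵥ u)) 0 = star q ⬝ᵥ (G *ᵥ u) := rfl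
    rw [h2, dotProduct_mulVec, hqG, smul_dotProduct, huu] at h1
    simp [hcC] at h1
  -- `G` maps the complement of `u` bijectively onto the complement of `q`; the inverse in these
  -- bases is `Vᴴ G⁻¹ U`.
  · refine isUnit_det_of_right_inverse (B := Vᴴ * G⁻¹ * U) ?_
    rw [Matrix.mul_assoc, Matrix.mul_assoc, ← Matrix.mul_assoc G, hGU, hU]

end
end RankOneChannel
namespace RankOneChannel
noncomputable section

/-! ### Rate of the scheme at high power. -/

variable {N : ℕ} {F G : Matrix (Fin N) (Fin N) ℂ} {P σ : ℝ}

namespace PilotScheme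

variable (S : PilotScheme F G P)

lemma norm_sq_det_whitener (hσ : 0 < σ) :
    ‖(S.whitener σ).det‖ ^ 2 = ((S.distCov σ).det.re)⁻¹ := by
  have hp := S.distCov_posDef hσ
  have h0 : 0 ≤ (S.distCov σ).det := hp.det_pos.le
  rw [whitener, norm_sq_det_sqrt hp.inv.posSemidef, det_nonsing_inv, Ring.inverse_eq_inv',
    norm_inv]
  congr 1
  obtain ⟨h1, h2⟩ := Complex.le_def.1 h0
  conv_lhs => rw [show (S.distCov σ).det = (((S.distCov σ).det.re : ℝ) : ℂ) from
    Complex.ext rfl (by simpa using h2.symm)]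
  exact Complex.norm_of_nonneg h1

/-- The second moment of data plus pilot has trace at most `P`, and `log det (1 + M) ≤ tr M`. The
penalty thus stays bounded as soon as the error variance is `O(1/P)`. -/
lemma log_det_distCov_le (hσ : 0 < σ) {C : ℝ} (hC : 0 ≤ C)
    (h : ∀ Q : Matrix (Fin N) (Fin N) ℂ, Q.PosSemidef →
      (S.Uᴴ * G * Q * (S.Uᴴ * G)ᴴ).trace.re ≤ C * Q.trace.re) :
    Real.log (S.distCov σ).det.re ≤ S.errVar σ * (C * P) := by
  set M := vecMulVec S.xp (star S.xp) + S.V * S.Qd * S.Vᴴ with hM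
  have hMp : M.PosSemidef :=
    (posSemidef_vecMulVec_self_star S.xp).add (S.Qd_posSemidef.mul_mul_conjTranspose_same S.V)
  have hMt : M.trace.re ≤ P := by
    have h1 : (vecMulVec S.xp (star S.xp)).trace.re = ‖S.wp‖ ^ 2 := by
      rw [trace_vecMulVec, dotProduct_comm, ← sqNorm_eq, xp, sqNorm_smul, S.vp_unit, mul_one]
    have h2 : (S.V * S.Qd * S.Vᴴ).trace = S.Qd.trace := by
      rw [trace_mul_comm, ← Matrix.mul_assoc, S.V_semiunitary, Matrix.one_mul]
    rw [hM, trace_add, Complex.add_re, h1, h2]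
    linarith [S.power]
  have he := S.errVar_pos hσ
  have e : S.distCov σ = 1 + ((S.errVar σ : ℝ) : ℂ) • (S.Uᴴ * G * M * (S.Uᴴ * G)ᴴ) := by
    rw [distCov, ← hM, conjTranspose_mul, conjTranspose_conjTranspose, Matrix.mul_smul,
      Matrix.smul_mul]
    simp only [Matrix.mul_assoc]
  rw [e]
  refine (log_det_one_add_le ((hMp.mul_mul_conjTranspose_same _).smul
    (by exact_mod_cast he.le))).trans ?_
  rw [trace_smul, smul_eq_mul, Complex.re_ofReal_mul]
  exact mul_le_mul_of_nonneg_left ((h M hMp).trans (mul_le_mul_of_nonneg_left hMt hC)) he.le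

end PilotScheme

/-- Half the power goes to the pilot and half evenly to the `N - 1` data streams. The error variance
is then at most `2/(P β)`, which bounds the disturbance penalty by `2 C/β`. The threshold `4/(β σ²)`
makes that variance at most `σ²/2`, so the estimate keeps variance at least `σ²/2` and the bound on
the mean log determinant is uniform. -/
lemma exists_le_rate (hN : 2 ≤ N) (hG : IsUnit G.det) (hσ : 0 < σ) :
    ∃ K P₀ : ℝ, ∀ P, P₀ ≤ P → ∃ S : PilotScheme F G P,
      ((N : ℝ) - 1) * Real.log P - K ≤ S.rate σ := by
  obtain ⟨V, U, W, u, hV, hU, hW, hu, hUr, hWr, hWu, hdet⟩ := exists_alignment (by omega) F hG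
  have hv₀ : 0 < σ ^ 2 / 2 := by positivity
  obtain ⟨K, hK⟩ := exists_le_integral_logDet (Uᴴ * F * V) (Uᴴ * G * V) hdet hv₀
  obtain ⟨C, hC, hCt⟩ := exists_re_trace_conj_le (Uᴴ * G)
  set β := sqNorm (Wᴴ *ᵥ (G *ᵥ u)) with hβ
  have hβ0 : 0 < β := sqNorm_pos hWu
  have hN2 : (2 : ℝ) ≤ N := by exact_mod_cast hN
  have hN1 : (0 : ℝ) < (N : ℝ) - 1 := by linarith
  refine ⟨K + 2 / β * C + ((N : ℝ) - 1) * Real.log (2 * ((N : ℝ) - 1)),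
    max 1 (4 / (β * σ ^ 2)), fun P hP => ?_⟩
  have hP1 : 1 ≤ P := (le_max_left _ _).trans hP
  have hP2 : 4 / (β * σ ^ 2) ≤ P := (le_max_right _ _).trans hP
  have hP0 : 0 < P := by linarith
  set c := P / (2 * ((N : ℝ) - 1)) with hc
  have hc0 : 0 < c := by positivity
  have hcard : ((N - 1 : ℕ) : ℝ) = (N : ℝ) - 1 := by rw [Nat.cast_sub (by omega)]; simp
  let S : PilotScheme F G P :=
    { V := V
      V_semiunitary := hV
      aligned := by
        rw [rank, ← hUr]
        exact (rank_le_width U)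
      k := N - 1
      U := U
      U_semiunitary := hU
      U_range := hUr
      d := 1
      Uperp := W
      Uperp_semiunitary := hW
      Uperp_range := hWr
      vp := u
      vp_unit := hu
      wp := ((Real.sqrt (P / 2) : ℝ) : ℂ)
      Qd := (c : ℂ) • 1
      Qd_posSemidef := smul_one_posSemidef hc0.le
      power := by
        rw [Complex.norm_of_nonneg (Real.sqrt_nonneg _), Real.sq_sqrt (by positivity), trace_smul,
          trace_one, smul_eq_mul, Complex.re_ofReal_mul, Fintype.card_fin, Complex.natCast_re,
          hcard, hc]
        refine le_of_eq ?_
        field_simp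
        ring }
  refine ⟨S, ?_⟩
  have hb : sqNorm (S.Uperpᴴ *ᵥ (G *ᵥ S.xp)) = P / 2 * β := by
    change sqNorm (Wᴴ *ᵥ (G *ᵥ (((Real.sqrt (P / 2) : ℝ) : ℂ) • u))) = _
    rw [mulVec_smul, mulVec_smul, sqNorm_smul, Complex.norm_of_nonneg (Real.sqrt_nonneg _),
      Real.sq_sqrt (by positivity)]
  have he1 : S.errVar σ ≤ 2 / (P * β) := by
    rw [PilotScheme.errVar, hb]
    refine inv_le_of_inv_le₀ (by positivity) ?_
    have : 0 < (σ ^ 2)⁻¹ := by positivity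
    have e : (2 / (P * β))⁻¹ = P / 2 * β := by rw [inv_div]; ring
    linarith
  have he2 : S.errVar σ ≤ σ ^ 2 / 2 := by
    refine he1.trans ?_
    rw [div_le_iff₀ (by positivity)] at hP2 ⊢
    nlinarith
  have hlogR : Real.log (S.distCov σ).det.re ≤ 2 / β * C := by
    refine (S.log_det_distCov_le hσ hC hCt).trans ?_
    refine (mul_le_mul_of_nonneg_right he1 (by positivity)).trans (le_of_eq ?_)
    field_simp
  have hR0 : 0 < (S.distCov σ).det.re := (Complex.lt_def.1 (S.distCov_posDef hσ).det_pos).1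
  have hT := S.norm_sq_det_whitener hσ
  have hT0 : (S.whitener σ).det ≠ 0 := fun h => by
    rw [h, norm_zero, zero_pow two_ne_zero] at hT
    exact (inv_pos.2 hR0).ne hT
  have hQd : ‖((c : ℂ) • (1 : Matrix (Fin (N - 1)) (Fin (N - 1)) ℂ)).det‖ = c ^ (N - 1) := by
    rw [norm_det_smul_one hc0.le, Fintype.card_fin]
  have h1 := hK (σ ^ 2 - S.errVar σ) (by linarith) (S.whitener σ) ((c : ℂ) • 1) hT0
    (smul_one_posSemidef hc0.le) (norm_pos_iff.1 (by rw [hQd]; positivity))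
  have hrate : S.rate σ = ∫ s, logDet ((S.whitener σ : Matrix (Fin (N - 1)) (Fin (N - 1)) ℂ) *
      (Uᴴ * F * V + s • (Uᴴ * G * V)) * CFC.sqrt ((c : ℂ) • 1)) ∂(cn (σ ^ 2 - S.errVar σ)) := by
    rw [S.rate_eq hσ]
    refine integral_congr_ae (ae_of_all _ fun s => ?_)
    have : Uᴴ * F * V + s • (Uᴴ * G * V) = Uᴴ * ((F + s • G) * V) := by
      simp only [Matrix.mul_add, Matrix.add_mul, Matrix.mul_smul, Matrix.smul_mul,
        Matrix.mul_assoc]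
    beta_reduce
    rw [this, PilotScheme.effChannel, Matrix.mul_assoc (S.whitener σ * S.Uᴴ),
      Matrix.mul_assoc (S.whitener σ)]
  rw [← hrate] at h1
  have hT' : Real.log (‖(S.whitener σ).det‖ ^ 2) = -Real.log (S.distCov σ).det.re := by
    rw [hT, Real.log_inv]
  have hQl : Real.log ‖((c : ℂ) • (1 : Matrix (Fin (N - 1)) (Fin (N - 1)) ℂ)).det‖ =
      ((N : ℝ) - 1) * Real.log P - ((N : ℝ) - 1) * Real.log (2 * ((N : ℝ) - 1)) := by
    rw [hQd, Real.log_pow, hcard, hc, Real.log_div hP0.ne' (by positivity), mul_sub]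
  rw [hQl] at h1
  have h2 := hT'.symm.le.trans' (neg_le_neg hlogR)
  have h3 : -(2 / β * C) + (((N : ℝ) - 1) * Real.log P -
      ((N : ℝ) - 1) * Real.log (2 * ((N : ℝ) - 1))) - K ≤ S.rate σ :=
    le_trans (by gcongr) h1
  linarith

/-! ### High-SNR behavior -/

lemma hasDegreesOfFreedom_of_logGrowth {C : ℝ → ℝ≥0∞} {d : ℝ}
    (h : LogGrowth (fun P => (C P : EReal)) d) : HasDegreesOfFreedom C d := by
  obtain ⟨K, hK⟩ := h
  have hfin : ∀ᶠ P in atTop, C P ≠ ⊤ := by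
    filter_upwards [hK] with P hP htop
    have := hP.2
    rw [htop, EReal.coe_ennreal_top, top_le_iff] at this
    exact EReal.coe_ne_top _ this
  refine ⟨hfin, ?_⟩
  have hlog := Real.tendsto_log_atTop
  have hK0 : Tendsto (fun P => K / Real.log P) atTop (𝓝 0) :=
    hlog.const_div_atTop K
  have hl := hK0.const_sub d
  have hu := hK0.const_add d
  rw [sub_zero] at hl
  rw [add_zero] at hu
  have hb : ∀ᶠ P in atTop, d - K / Real.log P ≤ (C P).toReal / Real.log P ∧
      (C P).toReal / Real.log P ≤ d + K / Real.log P := by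
    filter_upwards [hK, hfin, hlog.eventually_gt_atTop 0] with P hP hf hl0
    have e : (C P : EReal) = (((C P).toReal : ℝ) : EReal) := by
      rw [← EReal.toReal_coe_ennreal, EReal.coe_toReal (by simpa using hf)
        (EReal.coe_ennreal_ne_bot _)]
    rw [e, EReal.coe_le_coe_iff, EReal.coe_le_coe_iff] at hP
    have e1 : K / Real.log P * Real.log P = K := div_mul_cancel₀ _ hl0.ne'
    constructor
    · rw [le_div_iff₀ hl0]; linarith [hP.1]
    · rw [div_le_iff₀ hl0]; linarith [hP.2]
  exact tendsto_of_tendsto_of_tendsto_of_le_of_le' hl hu (hb.mono fun _ h => h.1)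
    (hb.mono fun _ h => h.2)

end
end RankOneChannel
open RankOneChannel
-- Assembly of the bounds.
theorem mainTheorem1 (N : ℕ) (hN : 2 ≤ N) (F G : Matrix (Fin N) (Fin N) ℂ) (hG : IsUnit G.det)
    (σ : ℝ) (hσ : 0 < σ) :
    -- Gaussian signaling achieves `(N - 1) log P + O(1)`
    (∀ P : ℝ, 0 < P → ∀ Q ∈ covSet N P,
      ((gaussianRate F G σ Q : ℝ) : EReal) ≤ mutualInfo F G σ (cnVec Q) ∧
        mutualInfo F G σ (cnVec Q) ≤ capacity F G σ P) ∧
    LogGrowth (fun P => ⨆ Q : covSet N P, ((gaussianRate F G σ Q.1 : ℝ) : EReal)) (N - 1) ∧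
    -- so does the pilot-based subspace-alignment scheme
    (∀ P : ℝ, 0 < P → ∀ S : PilotScheme F G P,
      ((S.rate σ : ℝ) : EReal) ≤ mutualInfo F G σ S.inputLaw ∧
        mutualInfo F G σ S.inputLaw ≤ capacity F G σ P) ∧
    LogGrowth (fun P => ⨆ S : PilotScheme F G P, ((S.rate σ : ℝ) : EReal)) (N - 1) ∧
    -- the duality bound with `α = N - 1` and `S = I`, uniformly in the input radius `r`
    (∀ P : ℝ, 0 < P → ∀ r : ℝ, 0 ≤ r →
      (peakCapacity F G σ P r : EReal) ≤
        (⨆ Q : covSet N P, ((dualityBound F G σ r (N - 1) 1 Q.1 : ℝ) : EReal))) ∧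
    (∃ K : ℝ, ∀ᶠ P in atTop, ∀ r : ℝ, 0 ≤ r →
      ((((N : ℝ) - 1) * Real.log P - K : ℝ) : EReal) ≤
        (⨆ Q : covSet N P, ((dualityBound F G σ r (N - 1) 1 Q.1 : ℝ) : EReal)) ∧
      (⨆ Q : covSet N P, ((dualityBound F G σ r (N - 1) 1 Q.1 : ℝ) : EReal)) ≤
        ((((N : ℝ) - 1) * Real.log P + K : ℝ) : EReal)) ∧
    -- its closed form
    (∀ Q : Matrix (Fin N) (Fin N) ℂ, Q.PosSemidef → ∀ r : ℝ, 0 ≤ r →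
      dualityBound F G σ r (N - 1) 1 Q ≤ closedBound F G σ Q) ∧
    (∀ P : ℝ, 0 < P → (capacity F G σ P : EReal) ≤
      ⨆ Q : covSet N P, ((closedBound F G σ Q.1 : ℝ) : EReal)) ∧
    LogGrowth (fun P => ⨆ Q : covSet N P, ((closedBound F G σ Q.1 : ℝ) : EReal)) (N - 1) ∧
    -- hence the capacity
    LogGrowth (fun P => (capacity F G σ P : EReal)) (N - 1) ∧
    HasDegreesOfFreedom (capacity F G σ) (N - 1) := by
  have hN0 : 0 < N := by omega
  obtain ⟨K₁, hK₁⟩ := exists_closedBound_le (F := F) (G := G) (σ := σ) hN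
  obtain ⟨K₂, hK₂⟩ := exists_le_dualityBound (F := F) hN hG hσ
  obtain ⟨K₃, hK₃⟩ := exists_le_gaussianRate (F := F) hN hG hσ
  obtain ⟨K₄, P₀, hK₄⟩ := exists_le_rate (F := F) hN hG hσ
  have hG1 : ∀ P : ℝ, 0 < P → ∀ Q ∈ covSet N P,
      ((gaussianRate F G σ Q : ℝ) : EReal) ≤ mutualInfo F G σ (cnVec Q) ∧
        mutualInfo F G σ (cnVec Q) ≤ capacity F G σ P := fun P _ Q hQ =>
    ⟨gaussianRate_le_mutualInfo hσ hQ.1, mutualInfo_le_capacity (cnVec_isInput hQ)⟩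
  have hS1 : ∀ P : ℝ, 0 < P → ∀ S : PilotScheme F G P,
      ((S.rate σ : ℝ) : EReal) ≤ mutualInfo F G σ S.inputLaw ∧
        mutualInfo F G σ S.inputLaw ≤ capacity F G σ P := fun P _ S =>
    ⟨S.rate_le_mutualInfo hσ, mutualInfo_le_capacity S.inputLaw_isInput⟩
  have hB : ∀ P : ℝ, 1 ≤ P → (⨆ Q : covSet N P, ((closedBound F G σ Q.1 : ℝ) : EReal)) ≤
      ((((N : ℝ) - 1) * Real.log P + K₁ : ℝ) : EReal) := fun P hP =>
    iSup_le fun Q => EReal.coe_le_coe_iff.2 (hK₁ P hP Q.1 Q.2)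
  have hC : ∀ P : ℝ, 1 ≤ P → (capacity F G σ P : EReal) ≤
      ((((N : ℝ) - 1) * Real.log P + K₁ : ℝ) : EReal) := fun P hP =>
    (capacity_le hN hG hσ (by linarith)).trans (hB P hP)
  have hGl : ∀ P : ℝ, 1 ≤ P → ((((N : ℝ) - 1) * Real.log P - K₃ : ℝ) : EReal) ≤
      ⨆ Q : covSet N P, ((gaussianRate F G σ Q.1 : ℝ) : EReal) := fun P hP =>
    (EReal.coe_le_coe_iff.2 (hK₃ P hP)).trans
      (le_iSup (fun Q : covSet N P => ((gaussianRate F G σ Q.1 : ℝ) : EReal))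
        ⟨isotropic N P, isotropic_mem_covSet hN0 (by linarith)⟩)
  have hGu : ∀ P : ℝ, 1 ≤ P → (⨆ Q : covSet N P, ((gaussianRate F G σ Q.1 : ℝ) : EReal)) ≤
      capacity F G σ P := fun P hP => iSup_le fun Q =>
    have h := hG1 P (by linarith) Q.1 Q.2
    h.1.trans (EReal.coe_ennreal_le_coe_ennreal_iff.2 h.2)
  have hDl : ∀ P : ℝ, 1 ≤ P → ∀ r : ℝ, ((((N : ℝ) - 1) * Real.log P - K₂ : ℝ) : EReal) ≤
      ⨆ Q : covSet N P, ((dualityBound F G σ r (N - 1) 1 Q.1 : ℝ) : EReal) := fun P hP r =>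
    (EReal.coe_le_coe_iff.2 (hK₂ P hP r)).trans
      (le_iSup (fun Q : covSet N P => ((dualityBound F G σ r (N - 1) 1 Q.1 : ℝ) : EReal))
        ⟨isotropic N P, isotropic_mem_covSet hN0 (by linarith)⟩)
  have hDB : ∀ P r : ℝ,
      (⨆ Q : covSet N P, ((dualityBound F G σ r (N - 1) 1 Q.1 : ℝ) : EReal)) ≤
        ⨆ Q : covSet N P, ((closedBound F G σ Q.1 : ℝ) : EReal) := fun P r =>
    iSup_mono fun Q => EReal.coe_le_coe_iff.2 (dualityBound_le_closedBound hN hG hσ r Q.1)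
  have hsub : ∀ {L x K K' : ℝ}, K ≤ K' → ((L * x - K' : ℝ) : EReal) ≤ ((L * x - K : ℝ) : EReal) :=
    fun h => EReal.coe_le_coe_iff.2 (by linarith)
  have hadd : ∀ {L x K K' : ℝ}, K ≤ K' → ((L * x + K : ℝ) : EReal) ≤ ((L * x + K' : ℝ) : EReal) :=
    fun h => EReal.coe_le_coe_iff.2 (by linarith)
  -- The capacity lies between the Gaussian rate and the closed form of the duality bound.
  have hcap : LogGrowth (fun P => (capacity F G σ P : EReal)) (N - 1) := by
    refine ⟨max K₃ K₁, ?_⟩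
    filter_upwards [eventually_ge_atTop 1] with P hP
    exact ⟨(hsub (le_max_left _ _)).trans ((hGl P hP).trans (hGu P hP)),
      (hC P hP).trans (hadd (le_max_right _ _))⟩
  refine ⟨hG1, ⟨max K₃ K₁, ?_⟩, hS1, ⟨max K₄ K₁, ?_⟩, fun P hP r _ => peakCapacity_le hN hG hσ hP r,
    ⟨max K₂ K₁, ?_⟩, fun Q _ r _ => dualityBound_le_closedBound hN hG hσ r Q,
    fun P hP => capacity_le hN hG hσ hP, ⟨max K₂ K₁, ?_⟩, hcap,
    hasDegreesOfFreedom_of_logGrowth hcap⟩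
  · filter_upwards [eventually_ge_atTop 1] with P hP
    exact ⟨(hsub (le_max_left _ _)).trans (hGl P hP),
      ((hGu P hP).trans (hC P hP)).trans (hadd (le_max_right _ _))⟩
  · filter_upwards [eventually_ge_atTop 1, eventually_ge_atTop P₀] with P hP hP'
    constructor
    · obtain ⟨S, hS⟩ := hK₄ P hP'
      exact ((hsub (le_max_left _ _)).trans (EReal.coe_le_coe_iff.2 hS)).trans
        (le_iSup (fun S : PilotScheme F G P => ((S.rate σ : ℝ) : EReal)) S)
    · refine (iSup_le fun S => ?_).trans ((hC P hP).trans (hadd (le_max_right _ _)))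
      have h := hS1 P (by linarith) S
      exact h.1.trans (EReal.coe_ennreal_le_coe_ennreal_iff.2 h.2)
  · filter_upwards [eventually_ge_atTop 1] with P hP r _
    exact ⟨(hsub (le_max_left _ _)).trans (hDl P hP r),
      ((hDB P r).trans (hB P hP)).trans (hadd (le_max_right _ _))⟩
  -- The closed form dominates the duality bound at every radius, so its lower growth can be read
  -- off at `r = 0`.
  · filter_upwards [eventually_ge_atTop 1] with P hP
    exact ⟨(hsub (le_max_left _ _)).trans ((hDl P hP 0).trans (hDB P 0)),
      (hB P hP).trans (hadd (le_max_right _ _))⟩
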